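/- **Theorem (Ribaucour transform for $k$-tuples).** *Setting.* Let $0\le \ell\le k$, $n=k+1$, $J={\rm diag}(\epsilon_1,\dots,\epsilon_k)$ with $\epsilon_j=1$ for $j\le k-\ell$ and $\epsilon_j=-1$ for $j>k-\ell$, and $Q={\rm diag}({\rm I}_n,J)$. For a real $k\times n$ matrix $\xi$ put $v_\xi=\begin{pmatrix}0&-\xi^tJ\\ \xi&0\end{pmatrix}$, and let $a_i=v_{D_i^t}$, $D_i^t=(e_{ii},0)\in\mathcal M_{k\times n}$, $1\le i\le k$. Let $\Omega\subset\mathbb R^k$ be open and connected, $x_0\in\Omega$. A solution of the $\frac{O(n+k-\ell,\ell)}{O(n)\times O(k-\ell,\ell)}$-system is a smooth $\xi:\Omega\to\mathcal M_{k\times n}(\mathbb R)$ with $\xi_{ii}=0$ for $1\le i\le k$ such that $v=v_\xi$ satisfies $[a_i,v_{x_j}]-[a_j,v_{x_i}]=[[a_i,v],[a_j,v]]$ for all $i,j$. A frame of its Lax pair is a smooth $E(x,\lambda)$ with $E_{x_i}=E\,(a_i\lambda+[a_i,v])$ for all $i$. Let $\xi$ be a solution and let $E$ be a parallel frame on $\Omega\times\mathbb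 C$, meaning a frame whose initial value $g=E(x_0,\cdot)$ is entire in $\lambda$ and satisfies $g(\lambda)^tQg(\lambda)=Q$, $\overline{g(\bar\lambda)}=g(\lambda)$ and ${\rm I}_{n,k}\,g(-\lambda)\,{\rm I}_{n,k}=g(\lambda)$, ${\rm I}_{n,k}={\rm diag}({\rm I}_n,-{\rm I}_k)$ (for instance $g\equiv {\rm I}$). *Dressing.* Let $s\in\mathbb R\setminus\{0\}$, $W\in\mathbb R^n$, $Z\in\mathbb R^k$ with $W^tW=Z^tJZ=1$. For such unit vectors let $$\pi=\tfrac12\begin{pmatrix}WW^t&-{\bf i}WZ^tJ\\ {\bf i}ZW^t&ZZ^tJ\end{pmatrix},\qquad p_{{\bf i}s,\pi}(\lambda)=\tfrac{\lambda+{\bf i}s}{\lambda-{\bf i}s}\bar\pi+\tfrac{\lambda-{\bf i}s}{\lambda+{\bf i}s}\pi+{\rm I}-\pi-\bar\pi .$$ Let $\tilde W(x)$ be the real part of the first $n$ entries and $\tilde Z(x)$ the imaginary part of the last $k$ entries of $E(x,{\bf i}s)^{-1}\begin{pmatrix}W\\ {\bf i}Z\end{pmatrix}$. Let $\Omega'=\{x\in\Omega:\tilde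 W(x)\ne0\}$, and on $\Omega'$ let $\hat W=\tilde W/(\tilde W^t\tilde W)^{1/2}=(q_1,\dots,q_{k+1})^t$, $\hat Z=\tilde Z/(\tilde Z^tJ\tilde Z)^{1/2}$, let $\hat\pi(x)$ be the projection defined as above from $\hat W(x),\hat Z(x)$, and $\hat E(x,\lambda)=E(x,\lambda)\,p_{{\bf i}s,\hat\pi(x)}(\lambda)^{-1}$. *Geometric notions.* Let $U\subset\mathbb R^k$ be open. A map $f$ on $U$ with values in a Euclidean space is parametrized by line of curvature coordinates if it is a smooth immersion, $f_{x_i}\perp f_{x_j}$ for $i\neq j$, and $f_{x_ix_j}=\sum_m c_{ijm}f_{x_m}$ for $i\ne j$ with smooth $c_{ijm}$. The normal bundle is flat if the curvature of the induced normal connection vanishes. For two such parametrizations $f,\tilde f$ on $U$, $f(x)\mapsto\tilde f(x)$ is a Combescure O-transform if $f,\tilde f$ have the same tangent space at each $x$ and parallel normal fields of $f$ are parallel for $\tilde f$. A $k$-tuple in $\mathbb R^n$ of type $\mathbb R^{k-\ell,\ell}$ is a map $Y=(Y_1,\dots,Y_k)$ on $U$ such that all $Y_i$ are parametrized by line of curvature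 coordinates and have flat normal bundle, $Y_i\mapsto Y_{i+1}$ is a Combescure O-transform for $i<k$, $(Y_i)_{x_j}=a_{ij}e_j$ with $e_j$ the unit direction of $(Y_1)_{x_j}$, the metric matrix $(a_{ij})$ has rank $k$ everywhere, and $\sum_j\epsilon_ja_{ij}^2$ is constant for each $i$. An immersed $k$-submanifold is isothermic$_\ell$ if its normal bundle is flat and it has a line of curvature coordinate system with first fundamental form $\sum g_{ii}dx_i^2$ such that $\sum_i\epsilon_ig_{ii}=0$. For immersions $f,\tilde f$ on $U$ with flat normal bundles, $f(x)\mapsto\tilde f(x)$ is a Ribaucour transform if it is covered by a smooth isomorphism $\Phi$ of normal bundles which maps parallel normal fields to parallel normal fields and is such that for every nonzero normal vector $\nu$ at $f(x)$ the normal lines $f(x)+t\nu$ and $\tilde f(x)+t\Phi(\nu)$ meet at a common parameter $t$, at equal distance from $f(x)$ and $\tilde f(x)$, and if for every principal direction $u$ of $f$ at $x$ (common eigenvector of the shape operators) $u$ is also principal for $\tilde f$ and the tangent lines through $f(x)$ in direction $df_x(u)$ and through $\tilde f(x)$ in direction $d\tilde f_x(u)$ meet at equal distance. It is a Ribaucour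 transform in moving frame form if the last conditions hold for the coordinate directions $u=\partial_{x_1},\dots,\partial_{x_k}$, these being principal for both $f$ and $\tilde f$. *Conclusion.* $E(x,{\bf i}s)^{-1}(W,{\bf i}Z)^t=(\tilde W,{\bf i}\tilde Z)^t$ and $\tilde W^t\tilde W=\tilde Z^tJ\tilde Z$ on $\Omega$. On $\Omega'$, $\hat\xi=\xi-2s(\hat Z\hat W^t)_*$ is a solution of the system, where $\eta_*$ is $\eta$ with the entries $\eta_{ii}$, $i\le k$, replaced by $0$; and $\hat E$ is a frame of the Lax pair of $\hat\xi$ for $\lambda\neq\pm{\bf i}s$. Moreover: 1. There are maps $\Xi:\Omega\to\mathcal M_{(k+1)\times k}(\mathbb R)$ and $\hat\Xi:\Omega'\to\mathcal M_{(k+1)\times k}(\mathbb R)$ such that $$\frac{\partial E}{\partial\lambda}E^{-1}\Big|_{\lambda=0}=\begin{pmatrix}0&\Xi\\-J\Xi^t&0\end{pmatrix},\qquad \frac{\partial\hat E}{\partial\lambda}\hat E^{-1}\Big|_{\lambda=0}=\begin{pmatrix}0&\hat\Xi\\-J\hat\Xi^t&0\end{pmatrix}.$$ 2. For ${\bf c}\in\mathbb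 R^k$, on every open $U\subset\Omega$ where the differential of $\Xi{\bf c}$ is injective, $\Xi{\bf c}$ is an immersed hypersurface in $\mathbb R^{k+1}$ with flat normal bundle, $x$ is a line of curvature coordinate system, and ${\rm I}=\sum g_{ii}dx_i^2$ satisfies $\sum_{i=1}^k\epsilon_ig_{ii}={\bf c}^tJ{\bf c}$. In particular $\Xi{\bf c}$ is isothermic$_\ell$ if ${\bf c}$ is null (${\bf c}^tJ{\bf c}=0$). 3. For ${\bf c}_1,{\bf c}_2\in\mathbb R^k$, on every open $U\subset\Omega$ where the differentials of $\Xi{\bf c}_1$ and $\Xi{\bf c}_2$ are injective, $\Xi{\bf c}_1\mapsto\Xi{\bf c}_2$ is a Combescure O-transform. 4. Let $C=({\bf c}_1,\dots,{\bf c}_k)\in GL(k,\mathbb R)$, $Y=\Xi C=(Y_1,\dots,Y_k)$, $\hat Y=\hat\Xi C=(\hat Y_1,\dots,\hat Y_k)$. Then: (a) $Y$ is a $k$-tuple in $\mathbb R^{k+1}$ of type $\mathbb R^{k-\ell,\ell}$ on every open $U\subset\Omega$ where the differentials of all $Y_i$ are injective, and so is $\hat Y$ on every open $U\subset\Omega'$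 where the differentials of all $\hat Y_i$ are injective. (b) If all ${\bf c}_i$ are null, then each $Y_i$ (each $\hat Y_i$) is an isothermic$_\ell$ hypersurface on every open subset of $\Omega$ (of $\Omega'$) where its differential is injective. (c) $E(x,0)={\rm diag}(g_1,g_2)$ for $x\in\Omega$ and $\hat E(x,0)={\rm diag}(\hat g_1,\hat g_2)$ for $x\in\Omega'$ lie in $O(k+1)\times O(k-\ell,\ell)$. (d) With $g_1=(e_1,\dots,e_{k+1})$, $\hat g_1=(\hat e_1,\dots,\hat e_{k+1})$ and $\beta_i=\hat Z^tJg_2^{-1}{\bf c}_i$, on $\Omega'$ $$\hat Y_i=Y_i-\frac{2\beta_i}{s}\sum_{j=1}^{k+1}q_je_j .$$ (e) For $x\in\Omega'$, $1\le i\le k$ and $1\le j\le k+1$ with $q_j(x)\ne0$, $$\hat Y_i-\frac{\beta_i}{sq_j}\hat e_j=Y_i-\frac{\beta_i}{sq_j}e_j .$$ On every open $U\subset\Omega'$ where the differentials of $Y_i$ and $\hat Y_i$ are injective and $q_1,\dots,q_{k+1}$ do not vanish, $Y_i\mapsto\hat Y_i$ is a Ribaucour transform in moving frame form; and it is a Ribaucour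 transform whenever the only principal directions of $Y_i$ on $U$ are the coordinate directions. -/

import Mathlib

open scoped Matrix ContDiff

noncomputable section

namespace KTuple

/-! ### Parametrized submanifolds of Euclidean space -/

section Submanifolds

variable {k N m : ℕ}

/-- The partial derivative `∂f/∂x_j` of a map on `ℝ^k`. -/
def pd {F : Type*} [NormedAddCommGroup F] [NormedSpace ℝ F]
    (j : Fin k) (f : (Fin k → ℝ) → F) (x : Fin k → ℝ) : F :=
  fderiv ℝ f x (Pi.single j 1)

/-- `f` is a smooth immersion on `U`. -/
def IsImmersionOn {F : Type*} [NormedAddCommGroup F] [NormedSpace ℝ F]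
    (f : (Fin k → ℝ) → F) (U : Set (Fin k → ℝ)) : Prop :=
  ContDiffOn ℝ ∞ f U ∧ ∀ x ∈ U, Function.Injective (fderiv ℝ f x)

/-- The tangent space of the parametrized submanifold `f` at `f x`. -/
def tangentSpace (f : (Fin k → ℝ) → EuclideanSpace ℝ (Fin N)) (x : Fin k → ℝ) :
    Submodule ℝ (EuclideanSpace ℝ (Fin N)) :=
  LinearMap.range (fderiv ℝ f x).toLinearMap

/-- The normal space of the parametrized submanifold `f` at `f x`. -/
def normalSpace (f : (Fin k → ℝ) → EuclideanSpace ℝ (Fin N)) (x : Fin k → ℝ) :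
    Submodule ℝ (EuclideanSpace ℝ (Fin N)) :=
  (tangentSpace f x)ᗮ

/-- The covariant derivative of a normal field `ν` along `x_j` for the induced normal connection:
the normal component of `∂ν/∂x_j`. -/
def normalDeriv (f : (Fin k → ℝ) → EuclideanSpace ℝ (Fin N)) (j : Fin k)
    (ν : (Fin k → ℝ) → EuclideanSpace ℝ (Fin N)) (x : Fin k → ℝ) : EuclideanSpace ℝ (Fin N) :=
  (normalSpace f x).starProjection (pd j ν x)

/-- `ν` is a smooth normal field of `f` on `V`. -/
def IsNormalField (f : (Fin k → ℝ) → EuclideanSpace ℝ (Fin N)) (V : Set (Fin k → ℝ))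
    (ν : (Fin k → ℝ) → EuclideanSpace ℝ (Fin N)) : Prop :=
  ContDiffOn ℝ ∞ ν V ∧ ∀ x ∈ V, ν x ∈ normalSpace f x

/-- `ν` is a parallel normal field of `f` on `V`. -/
def IsParallelNormalField (f : (Fin k → ℝ) → EuclideanSpace ℝ (Fin N)) (V : Set (Fin k → ℝ))
    (ν : (Fin k → ℝ) → EuclideanSpace ℝ (Fin N)) : Prop :=
  IsNormalField f V ν ∧ ∀ x ∈ V, ∀ j, normalDeriv f j ν x = 0

/-- The normal bundle of `f` is flat on `U`: the curvature of the normal connection vanishes. -/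
def HasFlatNormalBundle (f : (Fin k → ℝ) → EuclideanSpace ℝ (Fin N))
    (U : Set (Fin k → ℝ)) : Prop :=
  ∀ V ⊆ U, IsOpen V → ∀ ν, IsNormalField f V ν → ∀ x ∈ V, ∀ i j,
    normalDeriv f i (normalDeriv f j ν) x = normalDeriv f j (normalDeriv f i ν) x

/-- `f` is an immersion on `U` parametrized by line of curvature coordinates, i.e. by an
orthogonal conjugate coordinate system. -/
def IsLineOfCurvatureParam (f : (Fin k → ℝ) → EuclideanSpace ℝ (Fin N))
    (U : Set (Fin k → ℝ)) : Prop :=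
  IsImmersionOn f U ∧
  (∀ x ∈ U, ∀ i j, i ≠ j → inner ℝ (pd i f x) (pd j f x) = 0) ∧
  ∃ c : Fin k → Fin k → Fin k → (Fin k → ℝ) → ℝ,
    (∀ i j l, ContDiffOn ℝ ∞ (c i j l) U) ∧
    ∀ x ∈ U, ∀ i j, i ≠ j → pd i (pd j f) x = ∑ l, c i j l x • pd l f x

/-- The tangent vector with coordinates `u` is a common eigenvector of all shape operators of `f`
at `f x`; here `⟪II(u, w), ν⟫ = ⟪D²f(u, w), ν⟫` for normal vectors `ν`. -/
def IsPrincipal (f : (Fin k → ℝ) → EuclideanSpace ℝ (Fin N)) (x u : Fin k → ℝ) : Prop :=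
  u ≠ 0 ∧ ∀ ν ∈ normalSpace f x, ∃ κ : ℝ, ∀ w : Fin k → ℝ,
    inner ℝ (fderiv ℝ (fun y => fderiv ℝ f y w) x u) ν
      = κ * inner ℝ (fderiv ℝ f x u) (fderiv ℝ f x w)

/-- The map `f x ↦ f' x` is a Combescure O-transform between submanifolds parametrized by line of
curvature coordinates. -/
def IsCombescureOTransform (f f' : (Fin k → ℝ) → EuclideanSpace ℝ (Fin N))
    (U : Set (Fin k → ℝ)) : Prop :=
  IsLineOfCurvatureParam f U ∧ IsLineOfCurvatureParam f' U ∧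
  (∀ x ∈ U, tangentSpace f x = tangentSpace f' x) ∧
  ∀ V ⊆ U, IsOpen V → ∀ ν, IsParallelNormalField f V ν → IsParallelNormalField f' V ν

/-- The `i`-th column of a matrix valued map, as a map to Euclidean space. -/
def col (Y : (Fin k → ℝ) → Matrix (Fin N) (Fin m) ℝ) (i : Fin m) (x : Fin k → ℝ) :
    EuclideanSpace ℝ (Fin N) :=
  WithLp.toLp 2 (fun r => Y x r i)

/-- The unit direction of `∂f/∂x_j`. -/
def unitDir (f : (Fin k → ℝ) → EuclideanSpace ℝ (Fin N)) (j : Fin k) (x : Fin k → ℝ) :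
    EuclideanSpace ℝ (Fin N) :=
  ‖pd j f x‖⁻¹ • pd j f x

/-- The metric matrix `(a_ij)` of `Y = (Y_1, …, Y_m)`: the coefficient of `∂Y_i/∂x_j` along the
unit direction `e_j` of `∂Y_1/∂x_j`. -/
def metricMatrix (Y : (Fin k → ℝ) → Matrix (Fin N) (Fin m) ℝ) (x : Fin k → ℝ) :
    Matrix (Fin m) (Fin k) ℝ :=
  Matrix.of fun i j => inner ℝ (unitDir (col Y ⟨0, i.pos⟩) j x) (pd j (col Y i) x)

/-- `Y = (Y_1, …, Y_m)` is a Combescure O-map on `U`. -/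
def IsCombescureOMap (Y : (Fin k → ℝ) → Matrix (Fin N) (Fin m) ℝ)
    (U : Set (Fin k → ℝ)) : Prop :=
  (∀ i, IsLineOfCurvatureParam (col Y i) U ∧ HasFlatNormalBundle (col Y i) U) ∧
  (∀ i i' : Fin m, (i : ℕ) + 1 = i' → IsCombescureOTransform (col Y i) (col Y i') U) ∧
  (∀ x ∈ U, ∀ i j,
    pd j (col Y i) x = metricMatrix Y x i j • unitDir (col Y ⟨0, i.pos⟩) j x) ∧
  ∀ x ∈ U, (metricMatrix Y x).rank = m

/-- The signs `ε_1, …, ε_k`: the first `k - ℓ` are `1`, the last `ℓ` are `-1`. -/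
def eps (k ℓ : ℕ) (j : Fin k) : ℝ := if (j : ℕ) < k - ℓ then 1 else -1

/-- `J = I_{k-ℓ,ℓ} = diag(ε_1, …, ε_k)`, the metric of `ℝ^{k-ℓ,ℓ}`. -/
def J (k ℓ : ℕ) : Matrix (Fin k) (Fin k) ℝ := Matrix.diagonal (eps k ℓ)

/-- `Y` is a `k`-tuple in `ℝ^N` of type `ℝ^{k-ℓ,ℓ}` on `U`: a Combescure O-map such that each row
of its metric matrix has constant length in `ℝ^{k-ℓ,ℓ}`. -/
def IsKTuple (ℓ : ℕ) (Y : (Fin k → ℝ) → Matrix (Fin N) (Fin k) ℝ)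
    (U : Set (Fin k → ℝ)) : Prop :=
  IsCombescureOMap Y U ∧
  ∀ i, ∃ r : ℝ, ∀ x ∈ U, metricMatrix Y x i ⬝ᵥ (J k ℓ *ᵥ metricMatrix Y x i) = r

/-- The submanifold parametrized by `f` on `U` is isothermic_ℓ: its normal bundle is flat, and for
some line of curvature coordinate system the first fundamental form `∑ g_ii dx_i²` satisfies
`∑ ε_i g_ii = 0`. Here `ψ : V → U` is the change of coordinates. -/
def IsIsothermic (ℓ : ℕ) (f : (Fin k → ℝ) → EuclideanSpace ℝ (Fin N))
    (U : Set (Fin k → ℝ)) : Prop :=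
  HasFlatNormalBundle f U ∧
  ∃ (V : Set (Fin k → ℝ)) (ψ : (Fin k → ℝ) → (Fin k → ℝ)),
    IsOpen V ∧ IsImmersionOn ψ V ∧ Set.BijOn ψ V U ∧
    IsLineOfCurvatureParam (f ∘ ψ) V ∧
    ∀ x ∈ V, ∑ i, eps k ℓ i * ‖pd i (f ∘ ψ) x‖ ^ 2 = 0

/-- The map `f x ↦ f' x` is a Ribaucour transform, with the conditions on principal directions
imposed for those in `P x`: it is covered by a bundle isomorphism `Φ` of the normal bundles that
preserves parallel normal fields and such that the normal lines `f x + t ν` and `f' x + t Φ ν`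
meet at equal distance; and the directions in `P x` are principal for `f` and for `f'`, and the
tangent lines of `f` and `f'` in these directions meet at equal distance. -/
structure IsRibaucourAlong (f f' : (Fin k → ℝ) → EuclideanSpace ℝ (Fin N))
    (U : Set (Fin k → ℝ)) (P : (Fin k → ℝ) → Set (Fin k → ℝ)) : Prop where
  immersion : IsImmersionOn f U ∧ IsImmersionOn f' U
  flat : HasFlatNormalBundle f U ∧ HasFlatNormalBundle f' U
  normal : ∃ Φ : (Fin k → ℝ) → (EuclideanSpace ℝ (Fin N) →L[ℝ] EuclideanSpace ℝ (Fin N)),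
    ContDiffOn ℝ ∞ Φ U ∧
    (∀ x ∈ U, Set.BijOn (Φ x) (normalSpace f x) (normalSpace f' x)) ∧
    (∀ V ⊆ U, IsOpen V → ∀ ν, IsParallelNormalField f V ν →
      IsParallelNormalField f' V (fun x => Φ x (ν x))) ∧
    ∀ x ∈ U, ∀ ν ∈ normalSpace f x, ν ≠ 0 → ∃ r : ℝ,
      f x + r • ν = f' x + r • Φ x ν ∧ ‖r • ν‖ = ‖r • Φ x ν‖
  principal : ∀ x ∈ U, ∀ u ∈ P x, IsPrincipal f x u ∧ IsPrincipal f' x u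
  tangent : ∀ x ∈ U, ∀ u ∈ P x, ∃ t t' : ℝ,
    f x + t • fderiv ℝ f x u = f' x + t' • fderiv ℝ f' x u ∧
      ‖t • fderiv ℝ f x u‖ = ‖t' • fderiv ℝ f' x u‖

/-- `f x ↦ f' x` is a Ribaucour transform: the conditions on principal directions hold for all
common eigenvectors of the shape operators. -/
def IsRibaucour (f f' : (Fin k → ℝ) → EuclideanSpace ℝ (Fin N)) (U : Set (Fin k → ℝ)) : Prop :=
  IsRibaucourAlong f f' U (fun x => {u | IsPrincipal f x u})

/-- Ribaucour transform in moving frame form: the conditions on principal directions hold for the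
principal frame given by the coordinate directions. -/
def IsRibaucourFrame (f f' : (Fin k → ℝ) → EuclideanSpace ℝ (Fin N))
    (U : Set (Fin k → ℝ)) : Prop :=
  IsRibaucourAlong f f' U (fun _ => Set.range fun j => Pi.single j 1)

end Submanifolds

/-! ### The `O(n+k-ℓ,ℓ) / (O(n) × O(k-ℓ,ℓ))`-system for `n = k + 1` -/

section System

variable {k : ℕ}

/-- Index set of `(n + k) × (n + k)` matrices in block form, `n = k + 1`. -/
abbrev Idx (k : ℕ) : Type := Fin (k + 1) ⊕ Fin k

/-- A real matrix, viewed as a complex one. -/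
def cplx {α β : Type*} (A : Matrix α β ℝ) : Matrix α β ℂ := A.map Complex.ofReal

/-- The `n × k` matrix `D_i`, `D_iᵗ = (e_ii, 0)`. -/
def D (i : Fin k) : Matrix (Fin (k + 1)) (Fin k) ℝ := Matrix.single i.castSucc i 1

/-- The element of `𝒫` with lower left block `ξ`. -/
def pMat (ℓ : ℕ) (ξ : Matrix (Fin k) (Fin (k + 1)) ℝ) : Matrix (Idx k) (Idx k) ℝ :=
  Matrix.fromBlocks 0 (-(ξᵀ * J k ℓ)) ξ 0

/-- The basis `a_1, …, a_k` of the maximal abelian subalgebra of `𝒫`. -/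
def a (ℓ : ℕ) (i : Fin k) : Matrix (Idx k) (Idx k) ℝ := pMat ℓ (D i)ᵀ

/-- The solutions `ξ = (y, γ)` on `Ω`, with values in `gl_*(k) × ℳ_{k,1}`, of the system
`[a_i, v_{x_j}] - [a_j, v_{x_i}] = [[a_i, v], [a_j, v]]`, where `v = pMat ℓ ξ`. -/
structure IsSolution (ℓ : ℕ) (Ω : Set (Fin k → ℝ))
    (ξ : (Fin k → ℝ) → Matrix (Fin k) (Fin (k + 1)) ℝ) : Prop where
  smooth : ∀ b c, ContDiffOn ℝ ∞ (fun x => ξ x b c) Ω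
  diag : ∀ x ∈ Ω, ∀ i : Fin k, ξ x i i.castSucc = 0
  eqn : ∀ x ∈ Ω, ∀ i j : Fin k,
    ⁅a ℓ i, pMat ℓ (Matrix.of fun b c => pd j (fun y => ξ y b c) x)⁆
      - ⁅a ℓ j, pMat ℓ (Matrix.of fun b c => pd i (fun y => ξ y b c) x)⁆
    = ⁅⁅a ℓ i, pMat ℓ (ξ x)⁆, ⁅a ℓ j, pMat ℓ (ξ x)⁆⁆

/-- The coefficient of `dx_i` in the Lax pair `θ_μ = ∑ (a_i μ + [a_i, v]) dx_i`. -/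
def lax (ℓ : ℕ) (ξ : (Fin k → ℝ) → Matrix (Fin k) (Fin (k + 1)) ℝ) (i : Fin k)
    (x : Fin k → ℝ) (μ : ℂ) : Matrix (Idx k) (Idx k) ℂ :=
  μ • cplx (a ℓ i) + cplx ⁅a ℓ i, pMat ℓ (ξ x)⁆

/-- The bilinear form `I_{n+k-ℓ,ℓ} = diag(I_n, J)`. -/
def Q (k ℓ : ℕ) : Matrix (Idx k) (Idx k) ℝ := Matrix.fromBlocks 1 0 0 (J k ℓ)

/-- `I_{n,k} = diag(I_n, -I_k)`; conjugation by it is the involution `σ`. -/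
def S (k : ℕ) : Matrix (Idx k) (Idx k) ℝ := Matrix.fromBlocks 1 0 0 (-1)

/-- `g` is an entire loop in `O(n+k-ℓ,ℓ;ℂ)` satisfying the reality condition of the symmetric
space: an element of the positive loop group. -/
structure IsPositiveLoop (ℓ : ℕ) (g : ℂ → Matrix (Idx k) (Idx k) ℂ) : Prop where
  entire : ∀ b c, Differentiable ℂ (fun μ => g μ b c)
  group : ∀ μ, (g μ)ᵀ * cplx (Q k ℓ) * g μ = cplx (Q k ℓ)
  real : ∀ μ, (g (starRingEnd ℂ μ)).map (starRingEnd ℂ) = g μ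
  sigma : ∀ μ, cplx (S k) * g (-μ) * cplx (S k) = g μ

/-- `E` is a (smooth) frame of the Lax pair of `ξ` on `Ω`, for all spectral parameters in `Λ`:
`E⁻¹ dE = θ_μ`, i.e. `dE = E θ_μ`. -/
def IsFrameFor (ℓ : ℕ) (Ω : Set (Fin k → ℝ)) (Λ : Set ℂ)
    (ξ : (Fin k → ℝ) → Matrix (Fin k) (Fin (k + 1)) ℝ)
    (E : (Fin k → ℝ) → ℂ → Matrix (Idx k) (Idx k) ℂ) : Prop :=
  (∀ b c, ContDiffOn ℝ ∞ (fun p : (Fin k → ℝ) × ℂ => E p.1 p.2 b c) (Ω ×ˢ Λ)) ∧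
  ∀ x ∈ Ω, ∀ μ ∈ Λ, ∀ i,
    (Matrix.of fun b c => pd i (fun y => E y μ b c) x) = E x μ * lax ℓ ξ i x μ

/-- `E` is a parallel frame of the Lax pair of `ξ`, whose initial value at `x₀` is a positive loop
(for the normalized parallel frame it is the constant loop `1`). -/
def IsParallelFrame (ℓ : ℕ) (Ω : Set (Fin k → ℝ)) (x₀ : Fin k → ℝ)
    (ξ : (Fin k → ℝ) → Matrix (Fin k) (Fin (k + 1)) ℝ)
    (E : (Fin k → ℝ) → ℂ → Matrix (Idx k) (Idx k) ℂ) : Prop :=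
  IsFrameFor ℓ Ω Set.univ ξ E ∧ IsPositiveLoop ℓ (E x₀)

/-- `∂E/∂μ` at `μ = 0`, entry by entry. -/
def dSpec (E : (Fin k → ℝ) → ℂ → Matrix (Idx k) (Idx k) ℂ) (x : Fin k → ℝ) :
    Matrix (Idx k) (Idx k) ℂ :=
  Matrix.of fun b c => deriv (fun μ => E x μ b c) 0

/-- The upper left block `g₁` of `E(x, 0)` (the matrix of real parts). -/
def blk₁ (E : (Fin k → ℝ) → ℂ → Matrix (Idx k) (Idx k) ℂ) (x : Fin k → ℝ) :
    Matrix (Fin (k + 1)) (Fin (k + 1)) ℝ :=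
  Matrix.of fun b c => (E x 0 (Sum.inl b) (Sum.inl c)).re

/-- The lower right block `g₂` of `E(x, 0)` (the matrix of real parts). -/
def blk₂ (E : (Fin k → ℝ) → ℂ → Matrix (Idx k) (Idx k) ℂ) (x : Fin k → ℝ) :
    Matrix (Fin k) (Fin k) ℝ :=
  Matrix.of fun b c => (E x 0 (Sum.inr b) (Sum.inr c)).re

/-! ### Simple elements and dressing -/

/-- The vector `(W, iZ)`. -/
def vec (W : Fin (k + 1) → ℝ) (Z : Fin k → ℝ) : Idx k → ℂ :=
  Sum.elim (fun b => (W b : ℂ)) (fun b => Complex.I * (Z b : ℂ))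

/-- For unit vectors `W ∈ ℝ^n` and `Z ∈ ℝ^{k-ℓ,ℓ}`, the projection `u ↦ ½ (w^* Q u) w` of
`ℂ^{n+k}` onto `ℂ w`, `w = (W, iZ)`, that is self-adjoint for the Hermitian form of `Q`;
as a matrix, `½ [[W Wᵗ, -i W Zᵗ J], [i Z Wᵗ, Z Zᵗ J]]`. -/
def proj (ℓ : ℕ) (W : Fin (k + 1) → ℝ) (Z : Fin k → ℝ) : Matrix (Idx k) (Idx k) ℂ :=
  (1 / 2 : ℂ) • (Matrix.vecMulVec (vec W Z) (star (vec W Z)) * cplx (Q k ℓ))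

/-- The simple element `p_{is,π}`. -/
def simpleElt (s : ℝ) (π : Matrix (Idx k) (Idx k) ℂ) (μ : ℂ) : Matrix (Idx k) (Idx k) ℂ :=
  ((μ + Complex.I * s) / (μ - Complex.I * s)) • π.map (starRingEnd ℂ)
    + ((μ - Complex.I * s) / (μ + Complex.I * s)) • π
    + (1 - π - π.map (starRingEnd ℂ))

variable (ℓ : ℕ) (E : (Fin k → ℝ) → ℂ → Matrix (Idx k) (Idx k) ℂ) (s : ℝ)
  (W : Fin (k + 1) → ℝ) (Z : Fin k → ℝ)

/-- `W̃(x)`, where `E(x, is)⁻¹ (W, iZ) = (W̃, iZ̃)`. -/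
def tildeW (x : Fin k → ℝ) : Fin (k + 1) → ℝ :=
  fun b => (((E x (Complex.I * s))⁻¹ *ᵥ vec W Z) (Sum.inl b)).re

/-- `Z̃(x)`, where `E(x, is)⁻¹ (W, iZ) = (W̃, iZ̃)`. -/
def tildeZ (x : Fin k → ℝ) : Fin k → ℝ :=
  fun b => (((E x (Complex.I * s))⁻¹ *ᵥ vec W Z) (Sum.inr b)).im

/-- The unit direction of `W̃` in `ℝ^n`. -/
def hatW (x : Fin k → ℝ) : Fin (k + 1) → ℝ :=
  (Real.sqrt (tildeW E s W Z x ⬝ᵥ tildeW E s W Z x))⁻¹ • tildeW E s W Z x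

/-- The unit direction of `Z̃` in `ℝ^{k-ℓ,ℓ}`. -/
def hatZ (x : Fin k → ℝ) : Fin k → ℝ :=
  (Real.sqrt (tildeZ E s W Z x ⬝ᵥ (J k ℓ *ᵥ tildeZ E s W Z x)))⁻¹ • tildeZ E s W Z x

/-- The part of `Ω` on which the dressing is defined. -/
def dressedDomain (Ω : Set (Fin k → ℝ)) : Set (Fin k → ℝ) :=
  {x ∈ Ω | tildeW E s W Z x ≠ 0}

/-- The dressed frame `Ê(x, μ) = E(x, μ) p_{is,π̂(x)}(μ)⁻¹ = p_{is,π}(μ)⁻¹ Ẽ(x, μ)`, where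
`p_{is,π} E = Ẽ p_{is,π̂}` is the factorization defining the dressing action. -/
def dressedFrame (x : Fin k → ℝ) (μ : ℂ) : Matrix (Idx k) (Idx k) ℂ :=
  E x μ * (simpleElt s (proj ℓ (hatW E s W Z x) (hatZ ℓ E s W Z x)) μ)⁻¹

/-- The dressed solution `ξ - 2s (Ẑ Ŵᵗ)_*`, where `η_*` is `η` with the entries `η_ii` removed. -/
def dressedSolution (ξ : (Fin k → ℝ) → Matrix (Fin k) (Fin (k + 1)) ℝ) (x : Fin k → ℝ) :
    Matrix (Fin k) (Fin (k + 1)) ℝ :=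
  ξ x - (2 * s) • Matrix.of fun i c =>
    if c = i.castSucc then 0 else hatZ ℓ E s W Z x i * hatW E s W Z x c

end System

end KTuple

end

/-!
The hypersurfaces, their curvature line coordinates and their transforms are all read off the frame
`E`, so that everything reduces to linear algebra of `E` at the spectral parameters `0` and `±is`.

*Symmetries.* If `A` and `B` solve `A' = A θ`, `B' = B θ'` with `θ Q + Q θ'ᵗ = 0`, then `A Q Bᵗ` is
constant. Comparing `E` with itself, with its conjugate and with its image under the involution
`I_{n,k}` shows that the symmetries of the initial loop hold on all of `Ω`
(`IsParallelFrame.mul_Q_transpose_Q`, `IsParallelFrame.conj_eq`, `IsParallelFrame.sigma_eq`). Hence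
`E(x, 0) = diag(g₁, g₂)` is block diagonal and `∂_λ E E⁻¹` at `λ = 0` is block off-diagonal, with
upper right block `Ξ`.

*Hypersurfaces.* Only the initial loop is assumed entire; for other `x` the frame is complex
differentiable at `λ = 0` because the failure of the Cauchy–Riemann equations, multiplied by `E⁻¹`,
is constant in `x` (`IsParallelFrame.differentiableAt`). Differentiating the Lax pair in `λ` gives
`∂_j (∂_λ E E⁻¹) = E a_j E⁻¹` at `λ = 0`. Thus the `j`-th partial derivative of `Ξ c` is a multiple
`b_j e_j` of the `j`-th column of `g₁`, with `∑ ε_j b_j² = cᵗ J c`, and the Lax pair at `λ = 0`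
shows that the columns of `g₁` form an orthonormal frame which turns along `x_j` only in planes
containing `e_j` (`IsSymFrame.isPrincipalFrame`). For hypersurfaces with such a principal frame
(`IsPrincipalFrame`) the geometric notions become identities for the frame: the last vector is a
parallel unit normal field, hypersurfaces with a common frame are Combescure transforms of each
other, and two hypersurfaces with `f + ρ_m e_m = f' + ρ_m e'_m` for all `m` are related by a
Ribaucour transform (`IsPrincipalFrame.isRibaucourFrame`, `IsPrincipalFrame.isRibaucour`).

*Dressing.* The projection `π̂` onto the line spanned by `E(x, is)⁻¹ (W, iZ)` is `Y / tr Y` for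
`Y = E(x, is)⁻¹ π E(x, -is)`, which satisfies `∂_j Y = Y θ(-is) - θ(is) Y`. Normalizing the
trace of this matrix of rank one adds a quadratic term, and the derivative of `π̂` is
`π̂ θ(-is) - θ(is) π̂ + 2is π̂ a_j π̂` (`IsRealFrame.hasPD_proj_hat`). Comparing
this with the poles at `±is` of `E p⁻¹` shows that `E p⁻¹` solves the Lax pair of the dressed map
(`IsRealFrame.isFrameFor_dressedFrame`); the dressed map then solves the system, since the mixed
second derivatives of its frame agree
(`IsFrameFor.isSolution`). At `λ = 0` dressing multiplies `g₁` and `g₂` on the right by the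
reflections along `Ŵ` and `Ẑ` and translates `Ξ` by `-(2/s) g₁ Ŵ Ẑᵗ J g₂⁻¹`, so that the dressed
frame has the same properties as the original one (`IsRealFrame.isSymFrame_dressed`) and the line
congruences meet (`IsRealFrame.dressedSymBlock_mulVec_sub`).
-/

namespace KTuple

/-! ### Hypersurfaces with a principal orthonormal frame -/

/-- An orthonormal frame `e_1, …, e_{k+1}` along `f`, adapted to principal coordinates:
`∂f/∂x_j = b_j e_j` with `b_j ≠ 0`, and `∂e_m/∂x_j = -h_{jm} e_j` for `m ≠ j`. In particular
`e_{k+1}` is a unit normal field. The frame vectors are indexed by `Fin (k + 1)`, the tangent ones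
being the `e j.castSucc`. -/
structure IsPrincipalFrame {k : ℕ} (U : Set (Fin k → ℝ))
    (f : (Fin k → ℝ) → EuclideanSpace ℝ (Fin (k + 1)))
    (e : (Fin k → ℝ) → Fin (k + 1) → EuclideanSpace ℝ (Fin (k + 1)))
    (b : (Fin k → ℝ) → Fin k → ℝ) (h : (Fin k → ℝ) → Fin k → Fin (k + 1) → ℝ) : Prop where
  smooth : ContDiffOn ℝ ∞ f U
  smooth_frame : ∀ m, ContDiffOn ℝ ∞ (fun x => e x m) U
  smooth_coeff : ∀ j, ContDiffOn ℝ ∞ (fun x => b x j) U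
  smooth_rot : ∀ j m, ContDiffOn ℝ ∞ (fun x => h x j m) U
  orthonormal : ∀ x ∈ U, Orthonormal ℝ (e x)
  pd_eq : ∀ x ∈ U, ∀ j, pd j f x = b x j • e x j.castSucc
  pd_frame : ∀ x ∈ U, ∀ j m, m ≠ j.castSucc →
    pd j (fun y => e y m) x = -(h x j m) • e x j.castSucc
  coeff_ne : ∀ x ∈ U, ∀ j, b x j ≠ 0

section PartialDerivatives

variable {k : ℕ} {F : Type*} [NormedAddCommGroup F] [NormedSpace ℝ F]

theorem fderiv_apply_eq_sum_pd (f : (Fin k → ℝ) → F) (x u : Fin k → ℝ) :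
    fderiv ℝ f x u = ∑ j, u j • pd j f x := by
  conv_lhs => rw [pi_eq_sum_univ' u]
  simp [pd, map_sum]

theorem _root_.Filter.EventuallyEq.pd_eq {f g : (Fin k → ℝ) → F} {x : Fin k → ℝ} (j : Fin k)
    (h : f =ᶠ[nhds x] g) : pd j f x = pd j g x := by
  simp only [pd, h.fderiv_eq]

theorem pd_congr {f g : (Fin k → ℝ) → F} {U : Set (Fin k → ℝ)} (hU : IsOpen U)
    (h : ∀ x ∈ U, f x = g x) (j : Fin k) {x : Fin k → ℝ} (hx : x ∈ U) : pd j f x = pd j g x :=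
  (Filter.eventuallyEq_of_mem (hU.mem_nhds hx) h).pd_eq j

theorem pd_smul {a : (Fin k → ℝ) → ℝ} {f : (Fin k → ℝ) → F} {x : Fin k → ℝ} (j : Fin k)
    (ha : DifferentiableAt ℝ a x) (hf : DifferentiableAt ℝ f x) :
    pd j (fun y => a y • f y) x = a x • pd j f x + pd j a x • f x := by
  have := fderiv_smul ha hf
  simp only [pd]
  rw [show (fun y => a y • f y) = a • f from rfl, this]
  simp

theorem _root_.ContDiffOn.pd {f : (Fin k → ℝ) → F} {U : Set (Fin k → ℝ)} (hf : ContDiffOn ℝ ∞ f U)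
    (hU : IsOpen U) (j : Fin k) : ContDiffOn ℝ ∞ (KTuple.pd j f) U :=
  (hf.fderiv_of_isOpen hU (m := ∞) (by simp)).clm_apply contDiffOn_const

theorem _root_.ContDiffOn.differentiableAt_of_isOpen {E G : Type*} [NormedAddCommGroup E]
    [NormedSpace ℝ E] [NormedAddCommGroup G] [NormedSpace ℝ G] {f : E → G} {U : Set E}
    (hf : ContDiffOn ℝ ∞ f U) (hU : IsOpen U) {x : E} (hx : x ∈ U) : DifferentiableAt ℝ f x :=
  (hf.contDiffAt (hU.mem_nhds hx)).differentiableAt (by simp)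

/-- Partial derivatives of a smooth map commute. -/
theorem pd_comm {f : (Fin k → ℝ) → F} {x : Fin k → ℝ} (hf : ContDiffAt ℝ ∞ f x) (i j : Fin k) :
    pd i (pd j f) x = pd j (pd i f) x := by
  have hd : DifferentiableAt ℝ (fderiv ℝ f) x :=
    (hf.fderiv_right (m := ∞) (by simp)).differentiableAt (by simp)
  have hs : IsSymmSndFDerivAt ℝ f x := hf.isSymmSndFDerivAt (by
    rw [minSmoothness_of_isRCLikeNormedField]
    exact ENat.LEInfty.out)
  have key : ∀ i j : Fin k, pd i (pd j f) x
      = fderiv ℝ (fderiv ℝ f) x (Pi.single i 1) (Pi.single j 1) := by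
    intro i j
    have := (hd.hasFDerivAt.clm_apply (hasFDerivAt_const (Pi.single j (1 : ℝ)) x)).fderiv
    change fderiv ℝ (fun y => fderiv ℝ f y (Pi.single j 1)) x (Pi.single i 1) = _
    rw [this]
    simp
  rw [key, key, hs.eq]

end PartialDerivatives

namespace IsPrincipalFrame

variable {k : ℕ} {U : Set (Fin k → ℝ)} {f f' : (Fin k → ℝ) → EuclideanSpace ℝ (Fin (k + 1))}
  {e e' : (Fin k → ℝ) → Fin (k + 1) → EuclideanSpace ℝ (Fin (k + 1))}
  {b b' : (Fin k → ℝ) → Fin k → ℝ} {h h' : (Fin k → ℝ) → Fin k → Fin (k + 1) → ℝ}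

theorem mono (F : IsPrincipalFrame U f e b h) {V : Set (Fin k → ℝ)} (hV : V ⊆ U) :
    IsPrincipalFrame V f e b h where
  smooth := F.smooth.mono hV
  smooth_frame m := (F.smooth_frame m).mono hV
  smooth_coeff j := (F.smooth_coeff j).mono hV
  smooth_rot j m := (F.smooth_rot j m).mono hV
  orthonormal x hx := F.orthonormal x (hV hx)
  pd_eq x hx := F.pd_eq x (hV hx)
  pd_frame x hx := F.pd_frame x (hV hx)
  coeff_ne x hx := F.coeff_ne x (hV hx)

theorem fderiv_apply (F : IsPrincipalFrame U f e b h) {x : Fin k → ℝ} (hx : x ∈ U)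
    (u : Fin k → ℝ) : fderiv ℝ f x u = ∑ j, (u j * b x j) • e x j.castSucc := by
  simp [fderiv_apply_eq_sum_pd, F.pd_eq x hx, smul_smul]

theorem inner_frame (F : IsPrincipalFrame U f e b h) {x : Fin k → ℝ} (hx : x ∈ U)
    (m m' : Fin (k + 1)) : inner ℝ (e x m) (e x m') = if m = m' then 1 else 0 :=
  orthonormal_iff_ite.mp (F.orthonormal x hx) m m'

theorem tangentSpace_eq (F : IsPrincipalFrame U f e b h) {x : Fin k → ℝ} (hx : x ∈ U) :
    tangentSpace f x = Submodule.span ℝ (Set.range fun j : Fin k => e x j.castSucc) := by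
  apply le_antisymm
  · rintro _ ⟨u, rfl⟩
    change fderiv ℝ f x u ∈ _
    rw [F.fderiv_apply hx]
    exact Submodule.sum_mem _ fun j _ => Submodule.smul_mem _ _ (Submodule.subset_span ⟨j, rfl⟩)
  · rw [Submodule.span_le]
    rintro _ ⟨j, rfl⟩
    refine ⟨Pi.single j (b x j)⁻¹, ?_⟩
    change fderiv ℝ f x _ = _
    rw [F.fderiv_apply hx, Finset.sum_eq_single j]
    · simp [F.coeff_ne x hx j]
    · intro i _ hi
      simp [hi]
    · simp

/-- The normal space is the line spanned by the last frame vector. -/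
theorem normalSpace_eq (F : IsPrincipalFrame U f e b h) {x : Fin k → ℝ} (hx : x ∈ U) :
    normalSpace f x = Submodule.span ℝ {e x (Fin.last k)} := by
  rw [normalSpace, F.tangentSpace_eq hx]
  apply le_antisymm
  · intro v hv
    rw [Submodule.mem_orthogonal] at hv
    have hsp : ⊤ ≤ Submodule.span ℝ (Set.range (e x)) := by
      rw [(F.orthonormal x hx).linearIndependent.span_eq_top_of_card_eq_finrank (by simp)]
    have hsum := (OrthonormalBasis.mk (F.orthonormal x hx) hsp).sum_repr v
    simp only [OrthonormalBasis.repr_apply_apply, OrthonormalBasis.coe_mk] at hsum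
    rw [Fin.sum_univ_castSucc, Finset.sum_eq_zero, zero_add] at hsum
    · rw [← hsum]
      exact Submodule.smul_mem _ _ (Submodule.mem_span_singleton_self _)
    · intro j _
      rw [hv _ (Submodule.subset_span ⟨j, rfl⟩), zero_smul]
  · rw [Submodule.span_singleton_le_iff_mem, Submodule.mem_orthogonal]
    intro u hu
    induction hu using Submodule.span_induction with
    | mem u hu =>
      obtain ⟨j, rfl⟩ := hu
      simp [F.inner_frame hx, (Fin.castSucc_lt_last j).ne]
    | zero => simp
    | add u v _ _ hu hv => rw [inner_add_left, hu, hv, add_zero]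
    | smul t u _ hu => rw [inner_smul_left, hu, mul_zero]

theorem norm_frame (F : IsPrincipalFrame U f e b h) {x : Fin k → ℝ} (hx : x ∈ U)
    (m : Fin (k + 1)) : ‖e x m‖ = 1 := (F.orthonormal x hx).1 m

theorem mem_normalSpace_iff (F : IsPrincipalFrame U f e b h) {x : Fin k → ℝ} (hx : x ∈ U)
    {v : EuclideanSpace ℝ (Fin (k + 1))} :
    v ∈ normalSpace f x ↔ inner ℝ (e x (Fin.last k)) v • e x (Fin.last k) = v := by
  rw [F.normalSpace_eq hx]
  constructor
  · intro hv
    obtain ⟨t, rfl⟩ := Submodule.mem_span_singleton.mp hv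
    rw [inner_smul_right, F.inner_frame hx, if_pos rfl, mul_one]
  · intro hv
    rw [← hv]
    exact Submodule.smul_mem _ _ (Submodule.mem_span_singleton_self _)

theorem inner_castSucc_normal (F : IsPrincipalFrame U f e b h) {x : Fin k → ℝ} (hx : x ∈ U)
    {v : EuclideanSpace ℝ (Fin (k + 1))} (hv : v ∈ normalSpace f x) (j : Fin k) :
    inner ℝ (e x j.castSucc) v = 0 := by
  rw [← (F.mem_normalSpace_iff hx).mp hv, inner_smul_right, F.inner_frame hx,
    if_neg (Fin.castSucc_lt_last j).ne, mul_zero]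

/-- The unit normal is parallel, so the normal derivative of a normal field is the derivative of its
coordinate along the unit normal. -/
theorem normalDeriv_eq (F : IsPrincipalFrame U f e b h) (hU : IsOpen U)
    {ν : (Fin k → ℝ) → EuclideanSpace ℝ (Fin (k + 1))} (hν : IsNormalField f U ν)
    {x : Fin k → ℝ} (hx : x ∈ U) (j : Fin k) :
    normalDeriv f j ν x
      = pd j (fun y => inner ℝ (e y (Fin.last k)) (ν y)) x • e x (Fin.last k) := by
  rw [normalDeriv]
  simp only [F.normalSpace_eq hx]
  rw [Submodule.starProjection_unit_singleton ℝ (F.norm_frame hx _)]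
  congr 1
  have := fderiv_inner_apply ℝ ((F.smooth_frame (Fin.last k)).differentiableAt_of_isOpen hU hx)
    (hν.1.differentiableAt_of_isOpen hU hx) (Pi.single j 1)
  have h2 := F.pd_frame x hx j (Fin.last k) (Fin.castSucc_lt_last j).ne'
  simp only [pd] at h2 ⊢
  rw [this, h2, inner_smul_left, F.inner_castSucc_normal hx (hν.2 x hx)]
  simp

theorem hasFlatNormalBundle (F : IsPrincipalFrame U f e b h) : HasFlatNormalBundle f U := by
  intro V hVU hV ν hν x hx i j
  replace F := F.mono hVU
  have hs : ContDiffOn ℝ ∞ (fun y => inner ℝ (e y (Fin.last k)) (ν y)) V :=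
    (F.smooth_frame _).inner ℝ hν.1
  have hN : ∀ j, IsNormalField f V (normalDeriv f j ν) := fun j => by
    refine ⟨?_, fun y _ => Submodule.starProjection_apply_mem _ _⟩
    exact ((hs.pd hV j).smul (F.smooth_frame _)).congr fun y hy => F.normalDeriv_eq hV hν hy j
  have hc : ∀ j, ∀ y ∈ V, inner ℝ (e y (Fin.last k)) (normalDeriv f j ν y)
      = pd j (fun y => inner ℝ (e y (Fin.last k)) (ν y)) y := fun j y hy => by
    rw [F.normalDeriv_eq hV hν hy, inner_smul_right, F.inner_frame hy, if_pos rfl, mul_one]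
  rw [F.normalDeriv_eq hV (hN j) hx, F.normalDeriv_eq hV (hN i) hx,
    pd_congr hV (hc j) i hx, pd_congr hV (hc i) j hx,
    pd_comm (hs.contDiffAt (hV.mem_nhds hx))]

theorem isImmersionOn (F : IsPrincipalFrame U f e b h) : IsImmersionOn f U := by
  refine ⟨F.smooth, fun x hx => ?_⟩
  rw [injective_iff_map_eq_zero]
  intro u hu
  rw [F.fderiv_apply hx] at hu
  ext j
  have h1 : inner ℝ (e x j.castSucc) (∑ j, (u j * b x j) • e x j.castSucc) = u j * b x j := by
    rw [inner_sum, Finset.sum_eq_single j]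
    · rw [inner_smul_right, F.inner_frame hx, if_pos rfl, mul_one]
    · intro i _ hi
      rw [inner_smul_right, F.inner_frame hx, if_neg (by simpa using hi.symm), mul_zero]
    · simp
  rw [hu, inner_zero_right] at h1
  simpa [F.coeff_ne x hx j] using h1.symm

theorem isLineOfCurvatureParam (F : IsPrincipalFrame U f e b h) (hU : IsOpen U) :
    IsLineOfCurvatureParam f U := by
  refine ⟨F.isImmersionOn, fun x hx i j hij => ?_, ?_⟩
  · rw [F.pd_eq x hx, F.pd_eq x hx, inner_smul_left, inner_smul_right, F.inner_frame hx,
      if_neg (by simpa using hij)]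
    simp
  -- `∂_i (b_j e_j) = (∂_i b_j) e_j - b_j h_{ij} e_i`, and `e_l = b_l⁻¹ ∂_l f`
  refine ⟨fun i j l x => if l = j then pd i (fun y => b y j) x / b x j
    else if l = i then -(b x j * h x i j.castSucc / b x i) else 0, ?_, ?_⟩
  · intro i j l
    by_cases h1 : l = j
    · simp only [h1, if_true]
      exact ((F.smooth_coeff j).pd hU i).div (F.smooth_coeff j) fun x hx => F.coeff_ne x hx j
    by_cases h2 : l = i
    · subst h2
      simp only [h1, if_false, if_true]
      exact (((F.smooth_coeff j).mul (F.smooth_rot _ _)).div (F.smooth_coeff _)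
        fun x hx => F.coeff_ne x hx _).neg
    · simp only [h1, h2, if_false]
      exact contDiffOn_const
  · intro x hx i j hij
    have h1 : pd i (pd j f) x = pd i (fun y => b y j • e y j.castSucc) x :=
      pd_congr hU (fun y hy => F.pd_eq y hy j) i hx
    rw [h1, pd_smul i ((F.smooth_coeff j).differentiableAt_of_isOpen hU hx)
      ((F.smooth_frame _).differentiableAt_of_isOpen hU hx),
      F.pd_frame x hx i j.castSucc (by simpa using hij.symm),
      Finset.sum_eq_add j i hij.symm]
    · have hbi := F.coeff_ne x hx i
      have hbj := F.coeff_ne x hx j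
      simp only [if_true, if_neg hij, F.pd_eq x hx, smul_smul]
      rw [div_mul_cancel₀ _ hbj, neg_mul, div_mul_cancel₀ _ hbi, mul_neg]
      exact add_comm _ _
    · intro l _ hl
      simp [hl.1, hl.2]
    · simp
    · simp

theorem sum_eps_mul_norm_sq (F : IsPrincipalFrame U f e b h) (ℓ : ℕ) {x : Fin k → ℝ}
    (hx : x ∈ U) : ∑ i, eps k ℓ i * ‖pd i f x‖ ^ 2 = ∑ i, eps k ℓ i * b x i ^ 2 := by
  refine Finset.sum_congr rfl fun i _ => ?_
  rw [F.pd_eq x hx, norm_smul, F.norm_frame hx, mul_one, Real.norm_eq_abs, sq_abs]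

theorem isIsothermic (F : IsPrincipalFrame U f e b h) (hU : IsOpen U) {ℓ : ℕ}
    (hb : ∀ x ∈ U, ∑ i, eps k ℓ i * b x i ^ 2 = 0) : IsIsothermic ℓ f U := by
  refine ⟨F.hasFlatNormalBundle, U, id, hU, ⟨contDiffOn_id, fun x _ => ?_⟩, Set.bijOn_id U,
    F.isLineOfCurvatureParam hU, fun x hx => ?_⟩
  · rw [fderiv_id]
    exact Function.injective_id
  · exact (F.sum_eps_mul_norm_sq ℓ hx).trans (hb x hx)

theorem isParallelNormalField_iff (F : IsPrincipalFrame U f e b h) (hU : IsOpen U)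
    {ν : (Fin k → ℝ) → EuclideanSpace ℝ (Fin (k + 1))} (hν : IsNormalField f U ν) :
    IsParallelNormalField f U ν ↔
      ∀ x ∈ U, ∀ j, pd j (fun y => inner ℝ (e y (Fin.last k)) (ν y)) x = 0 := by
  have hne : ∀ x ∈ U, e x (Fin.last k) ≠ 0 := fun x hx => (F.orthonormal x hx).ne_zero _
  constructor
  · intro hp x hx j
    have := hp.2 x hx j
    rw [F.normalDeriv_eq hU hν hx] at this
    exact (smul_eq_zero.mp this).resolve_right (hne x hx)
  · intro hp
    refine ⟨hν, fun x hx j => ?_⟩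
    rw [F.normalDeriv_eq hU hν hx, hp x hx j, zero_smul]

/-- Two hypersurfaces sharing a principal frame are related by a Combescure transform. -/
theorem isCombescureOTransform (F : IsPrincipalFrame U f e b h)
    (F' : IsPrincipalFrame U f' e b' h) (hU : IsOpen U) : IsCombescureOTransform f f' U := by
  refine ⟨F.isLineOfCurvatureParam hU, F'.isLineOfCurvatureParam hU, fun x hx => ?_, ?_⟩
  · rw [F.tangentSpace_eq hx, F'.tangentSpace_eq hx]
  · intro V hVU hV ν hν
    have hν' : IsNormalField f' V ν := ⟨hν.1.1, fun x hx => by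
      rw [F'.normalSpace_eq (hVU hx), ← F.normalSpace_eq (hVU hx)]
      exact hν.1.2 x hx⟩
    rw [(F'.mono hVU).isParallelNormalField_iff hV hν']
    exact ((F.mono hVU).isParallelNormalField_iff hV hν.1).mp hν

/-- Coordinate directions are principal: differentiating `⟪∂_w f, n⟫ = 0` along `x_j` and using
`∂_j n = -h e_j` gives the principal curvature. -/
theorem isPrincipal_single (F : IsPrincipalFrame U f e b h) (hU : IsOpen U) {x : Fin k → ℝ}
    (hx : x ∈ U) (j : Fin k) : IsPrincipal f x (Pi.single j 1) := by
  refine ⟨by simp, fun ν hν => ?_⟩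
  refine ⟨inner ℝ (e x (Fin.last k)) ν * h x j (Fin.last k) / b x j, fun w => ?_⟩
  have hw : ContDiffOn ℝ ∞ (fun y => fderiv ℝ f y w) U :=
    (F.smooth.fderiv_of_isOpen hU (m := ∞) (by simp)).clm_apply contDiffOn_const
  have h0 : ∀ y ∈ U, inner ℝ (fderiv ℝ f y w) (e y (Fin.last k)) = 0 := fun y hy => by
    rw [F.fderiv_apply hy, sum_inner]
    refine Finset.sum_eq_zero fun i _ => ?_
    rw [inner_smul_left, F.inner_frame hy, if_neg (Fin.castSucc_lt_last i).ne, mul_zero]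
  have h1 := fderiv_inner_apply ℝ (hw.differentiableAt_of_isOpen hU hx)
    ((F.smooth_frame (Fin.last k)).differentiableAt_of_isOpen hU hx) (Pi.single j 1)
  have h2 : pd j (fun y => inner ℝ (fderiv ℝ f y w) (e y (Fin.last k))) x = 0 := by
    rw [pd_congr hU h0 j hx]
    simp [pd]
  have h3 := F.pd_frame x hx j (Fin.last k) (Fin.castSucc_lt_last j).ne'
  have h4 := F.pd_eq x hx j
  simp only [pd] at h2 h3 h4
  rw [h2, h3, inner_smul_right] at h1
  conv_lhs => rw [← (F.mem_normalSpace_iff hx).mp hν]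
  rw [inner_smul_right, h4, inner_smul_left, real_inner_comm (fderiv ℝ f x w) (e x j.castSucc)]
  have hb := F.coeff_ne x hx j
  simp only [conj_trivial]
  field_simp
  linear_combination -inner ℝ (e x (Fin.last k)) ν * h1

theorem _root_.KTuple.IsPrincipal.smul {N : ℕ} {f : (Fin k → ℝ) → EuclideanSpace ℝ (Fin N)}
    {x u : Fin k → ℝ} (hu : IsPrincipal f x u) {t : ℝ} (ht : t ≠ 0) : IsPrincipal f x (t • u) := by
  refine ⟨smul_ne_zero ht hu.1, fun ν hν => ?_⟩
  obtain ⟨κ, hκ⟩ := hu.2 ν hν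
  refine ⟨κ, fun w => ?_⟩
  rw [map_smul, map_smul, inner_smul_left, inner_smul_left, hκ w]
  ring

/-- Two hypersurfaces with principal frames `e`, `e'` in the same coordinates, such that the lines
spanned by corresponding frame vectors meet at equal distance, are related by a Ribaucour
transform. -/
theorem isRibaucourAlong (F : IsPrincipalFrame U f e b h) (F' : IsPrincipalFrame U f' e' b' h')
    (hU : IsOpen U) (ρ : (Fin k → ℝ) → Fin (k + 1) → ℝ)
    (hρ : ∀ x ∈ U, ∀ m, f x + ρ x m • e x m = f' x + ρ x m • e' x m)
    {P : (Fin k → ℝ) → Set (Fin k → ℝ)}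
    (hP : ∀ x ∈ U, ∀ u ∈ P x, ∃ (j : Fin k) (t : ℝ), t ≠ 0 ∧ u = t • Pi.single j 1) :
    IsRibaucourAlong f f' U P where
  immersion := ⟨F.isImmersionOn, F'.isImmersionOn⟩
  flat := ⟨F.hasFlatNormalBundle, F'.hasFlatNormalBundle⟩
  normal := by
    refine ⟨fun x => (innerSL ℝ (e x (Fin.last k))).smulRight (e' x (Fin.last k)), ?_, ?_, ?_, ?_⟩
    · exact ((innerSL ℝ).contDiff.comp_contDiffOn (F.smooth_frame _)).smulRight
        (F'.smooth_frame _)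
    · intro x hx
      refine ⟨fun v _ => ?_, fun v hv w hw hvw => ?_, fun v hv => ?_⟩
      · rw [SetLike.mem_coe, F'.normalSpace_eq hx]
        exact Submodule.smul_mem _ _ (Submodule.mem_span_singleton_self _)
      · rw [← (F.mem_normalSpace_iff hx).mp hv, ← (F.mem_normalSpace_iff hx).mp hw]
        congr 1
        simpa [(F'.orthonormal x hx).ne_zero] using hvw
      · refine ⟨inner ℝ (e' x (Fin.last k)) v • e x (Fin.last k), ?_, ?_⟩
        · rw [SetLike.mem_coe, F.normalSpace_eq hx]
          exact Submodule.smul_mem _ _ (Submodule.mem_span_singleton_self _)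
        · simpa [inner_smul_right, F.norm_frame hx] using (F'.mem_normalSpace_iff hx).mp hv
    · intro V hVU hV ν hν
      have hs : ContDiffOn ℝ ∞ (fun y => inner ℝ (e y (Fin.last k)) (ν y)) V :=
        ((F.smooth_frame _).mono hVU).inner ℝ hν.1.1
      have hν' : IsNormalField f' V (fun x => inner ℝ (e x (Fin.last k)) (ν x) •
          e' x (Fin.last k)) := ⟨hs.smul ((F'.smooth_frame _).mono hVU), fun x hx => by
        rw [F'.normalSpace_eq (hVU hx)]
        exact Submodule.smul_mem _ _ (Submodule.mem_span_singleton_self _)⟩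
      refine ((F'.mono hVU).isParallelNormalField_iff hV hν').mpr fun x hx j => ?_
      rw [pd_congr hV (g := fun y => inner ℝ (e y (Fin.last k)) (ν y)) (fun y hy => ?_) j hx]
      · exact ((F.mono hVU).isParallelNormalField_iff hV hν.1).mp hν x hx j
      · rw [inner_smul_right, F'.inner_frame (hVU hy), if_pos rfl, mul_one]
    · intro x hx ν hν hν0
      have hv := (F.mem_normalSpace_iff hx).mp hν
      set t := inner ℝ (e x (Fin.last k)) ν with ht
      have ht0 : t ≠ 0 := fun h0 => hν0 (by rw [← hv, h0, zero_smul])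
      refine ⟨ρ x (Fin.last k) / t, ?_, ?_⟩
      · simp only [ContinuousLinearMap.smulRight_apply, innerSL_apply_apply]
        rw [← ht, smul_smul, div_mul_cancel₀ _ ht0, ← hρ x hx, ← hv, smul_smul,
          div_mul_cancel₀ _ ht0]
      · simp only [ContinuousLinearMap.smulRight_apply, innerSL_apply_apply]
        rw [← ht, ← hv]
        simp [norm_smul, F.norm_frame hx, F'.norm_frame hx]
  principal := by
    intro x hx u hu
    obtain ⟨j, t, ht, rfl⟩ := hP x hx u hu
    exact ⟨(F.isPrincipal_single hU hx j).smul ht, (F'.isPrincipal_single hU hx j).smul ht⟩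
  tangent := by
    intro x hx u hu
    obtain ⟨j, t, ht, rfl⟩ := hP x hx u hu
    have h1 : fderiv ℝ f x (Pi.single j 1) = _ := F.pd_eq x hx j
    have h2 : fderiv ℝ f' x (Pi.single j 1) = _ := F'.pd_eq x hx j
    have hb := F.coeff_ne x hx j
    have hb' := F'.coeff_ne x hx j
    refine ⟨ρ x j.castSucc / (t * b x j), ρ x j.castSucc / (t * b' x j), ?_, ?_⟩
    · rw [map_smul, map_smul, h1, h2, smul_smul, smul_smul, smul_smul, smul_smul, mul_assoc,
        mul_assoc, div_mul_cancel₀ _ (mul_ne_zero ht hb), div_mul_cancel₀ _ (mul_ne_zero ht hb'),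
        hρ x hx]
    · rw [map_smul, map_smul, h1, h2, smul_smul, smul_smul, smul_smul, smul_smul, mul_assoc,
        mul_assoc, div_mul_cancel₀ _ (mul_ne_zero ht hb), div_mul_cancel₀ _ (mul_ne_zero ht hb'),
        norm_smul, norm_smul, F.norm_frame hx, F'.norm_frame hx]

theorem isRibaucourFrame (F : IsPrincipalFrame U f e b h) (F' : IsPrincipalFrame U f' e' b' h')
    (hU : IsOpen U) (ρ : (Fin k → ℝ) → Fin (k + 1) → ℝ)
    (hρ : ∀ x ∈ U, ∀ m, f x + ρ x m • e x m = f' x + ρ x m • e' x m) :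
    IsRibaucourFrame f f' U := by
  refine F.isRibaucourAlong F' hU ρ hρ fun x _ u hu => ?_
  obtain ⟨j, rfl⟩ := hu
  exact ⟨j, 1, one_ne_zero, (one_smul _ _).symm⟩

theorem isRibaucour (F : IsPrincipalFrame U f e b h) (F' : IsPrincipalFrame U f' e' b' h')
    (hU : IsOpen U) (ρ : (Fin k → ℝ) → Fin (k + 1) → ℝ)
    (hρ : ∀ x ∈ U, ∀ m, f x + ρ x m • e x m = f' x + ρ x m • e' x m)
    (hP : ∀ x ∈ U, ∀ u, IsPrincipal f x u → ∃ (j : Fin k) (t : ℝ), u = t • Pi.single j 1) :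
    IsRibaucour f f' U := by
  refine F.isRibaucourAlong F' hU ρ hρ fun x hx u hu => ?_
  obtain ⟨j, t, rfl⟩ := hP x hx u hu
  exact ⟨j, t, fun h0 => hu.1 (by rw [h0, zero_smul]), rfl⟩

/-- Hypersurfaces `Y_1, …, Y_k` sharing a principal frame, whose matrix `B = (b_{ij})` is invertible
and has rows of constant length in `ℝ^{k-ℓ,ℓ}`, form a `k`-tuple. -/
theorem isKTuple {Y : (Fin k → ℝ) → Matrix (Fin (k + 1)) (Fin k) ℝ}
    {B : (Fin k → ℝ) → Matrix (Fin k) (Fin k) ℝ}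
    (F : ∀ i, IsPrincipalFrame U (col Y i) e (fun x => B x i) h) (hU : IsOpen U) (ℓ : ℕ)
    (hB : ∀ x ∈ U, IsUnit (B x)) (r : Fin k → ℝ)
    (hr : ∀ x ∈ U, ∀ i, ∑ j, eps k ℓ j * B x i j ^ 2 = r i) : IsKTuple ℓ Y U := by
  -- the unit direction of `∂_j Y_1` is `± e_j`, the sign being that of `b_{1j}`
  have hunit : ∀ x ∈ U, ∀ i j : Fin k, unitDir (col Y ⟨0, i.pos⟩) j x
      = (SignType.sign (B x ⟨0, i.pos⟩ j) : ℝ) • e x j.castSucc := fun x hx i j => by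
    rw [unitDir, (F _).pd_eq x hx, norm_smul, (F i).norm_frame hx, mul_one, smul_smul]
    congr 1
    have := (F ⟨0, i.pos⟩).coeff_ne x hx j
    rw [Real.norm_eq_abs, inv_mul_eq_iff_eq_mul₀ (abs_ne_zero.mpr this), mul_comm,
      sign_mul_abs]
  have hsq : ∀ x ∈ U, ∀ i j : Fin k, (SignType.sign (B x ⟨0, i.pos⟩ j) : ℝ) *
      (SignType.sign (B x ⟨0, i.pos⟩ j) : ℝ) = 1 := fun x hx i j => by
    rcases lt_or_gt_of_ne ((F ⟨0, i.pos⟩).coeff_ne x hx j) with h0 | h0 <;>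
      simp [sign_neg, sign_pos, h0]
  have hm : ∀ x ∈ U, ∀ i j : Fin k, metricMatrix Y x i j
      = (SignType.sign (B x ⟨0, i.pos⟩ j) : ℝ) * B x i j := fun x hx i j => by
    simp only [metricMatrix, Matrix.of_apply]
    rw [hunit x hx i, (F i).pd_eq x hx, inner_smul_left, inner_smul_right, (F i).inner_frame hx]
    simp
  refine ⟨⟨fun i => ⟨(F i).isLineOfCurvatureParam hU, (F i).hasFlatNormalBundle⟩,
    fun i i' _ => (F i).isCombescureOTransform (F i') hU, fun x hx i j => ?_, fun x hx => ?_⟩,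
    fun i => ⟨r i, fun x hx => ?_⟩⟩
  · rw [hunit x hx i, hm x hx, (F i).pd_eq x hx, smul_smul, mul_right_comm, hsq x hx i, one_mul]
  · rcases Nat.eq_zero_or_pos k with hk | hk
    · subst hk
      simpa using Matrix.rank_le_card_height (metricMatrix Y x)
    have hM : metricMatrix Y x
        = B x * Matrix.diagonal (fun j => (SignType.sign (B x ⟨0, hk⟩ j) : ℝ)) := by
      ext i j
      rw [hm x hx, Matrix.mul_diagonal, mul_comm]
    have hD : IsUnit (Matrix.diagonal (fun j => (SignType.sign (B x ⟨0, hk⟩ j) : ℝ))) := by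
      refine IsUnit.of_mul_eq_one (Matrix.diagonal
        (fun j => (SignType.sign (B x ⟨0, hk⟩ j) : ℝ))) ?_
      rw [Matrix.diagonal_mul_diagonal, ← Matrix.diagonal_one]
      congr 1
      funext j
      exact hsq x hx ⟨0, hk⟩ j
    rw [hM, Matrix.rank_of_isUnit _ ((hB x hx).mul hD), Fintype.card_fin]
  · rw [← hr x hx i, dotProduct]
    refine Finset.sum_congr rfl fun j _ => ?_
    rw [J, Matrix.mulVec_diagonal, hm x hx]
    linear_combination eps k ℓ j * B x i j ^ 2 * hsq x hx i j

end IsPrincipalFrame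

/-! ### Entrywise calculus of matrix valued maps -/

section MatrixCalculus

variable {k : ℕ} {𝕜 : Type*} [RCLike 𝕜] {α β γ : Type*}

/-- The matrix valued map `A` is differentiable at `x`, with partial derivative `A'` along `x_j`;
both are read entry by entry, since matrices carry no canonical norm. -/
def HasPD (j : Fin k) (A : (Fin k → ℝ) → Matrix α β 𝕜) (A' : Matrix α β 𝕜) (x : Fin k → ℝ) :
    Prop :=
  ∀ b c, DifferentiableAt ℝ (fun y => A y b c) x ∧ pd j (fun y => A y b c) x = A' b c

/-- The entries of `A` are smooth on `U`. -/
def IsSmoothOn {V : Type*} [NormedAddCommGroup V] [NormedSpace ℝ V] (A : V → Matrix α β 𝕜)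
    (U : Set V) : Prop :=
  ∀ b c, ContDiffOn ℝ ∞ (fun y => A y b c) U

variable {V : Type*} [NormedAddCommGroup V] [NormedSpace ℝ V] {U : Set V}

theorem isSmoothOn_const (A : Matrix α β 𝕜) : IsSmoothOn (fun _ : V => A) U :=
  fun _ _ => contDiffOn_const

theorem IsSmoothOn.mul [Fintype β] {A : V → Matrix α β 𝕜} {B : V → Matrix β γ 𝕜}
    (hA : IsSmoothOn A U) (hB : IsSmoothOn B U) : IsSmoothOn (fun y => A y * B y) U := by
  intro b c
  simp only [Matrix.mul_apply]
  exact ContDiffOn.sum fun i _ => (hA b i).mul (hB i c)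

theorem IsSmoothOn.add {A B : V → Matrix α β 𝕜}
    (hA : IsSmoothOn A U) (hB : IsSmoothOn B U) : IsSmoothOn (fun y => A y + B y) U :=
  fun b c => (hA b c).add (hB b c)

theorem IsSmoothOn.sub {A B : V → Matrix α β 𝕜}
    (hA : IsSmoothOn A U) (hB : IsSmoothOn B U) : IsSmoothOn (fun y => A y - B y) U :=
  fun b c => (hA b c).sub (hB b c)

theorem IsSmoothOn.smul {a : V → 𝕜} {A : V → Matrix α β 𝕜}
    (ha : ContDiffOn ℝ ∞ a U) (hA : IsSmoothOn A U) : IsSmoothOn (fun y => a y • A y) U :=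
  fun b c => ha.mul (hA b c)

theorem IsSmoothOn.transpose {A : V → Matrix α β 𝕜} (hA : IsSmoothOn A U) :
    IsSmoothOn (fun y => (A y)ᵀ) U :=
  fun b c => hA c b

theorem IsSmoothOn.conj {A : V → Matrix α β ℂ} (hA : IsSmoothOn A U) :
    IsSmoothOn (fun y => (A y).map (starRingEnd ℂ)) U :=
  fun b c => Complex.conjCLE.contDiff.comp_contDiffOn (hA b c)

variable {j : Fin k} {x : Fin k → ℝ}

theorem hasPD_const (A : Matrix α β 𝕜) : HasPD j (fun _ => A) 0 x :=
  fun _ _ => ⟨differentiableAt_const _, by simp [pd]⟩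

theorem HasPD.add {A B : (Fin k → ℝ) → Matrix α β 𝕜} {A' B' : Matrix α β 𝕜}
    (hA : HasPD j A A' x) (hB : HasPD j B B' x) : HasPD j (fun y => A y + B y) (A' + B') x := by
  intro b c
  refine ⟨(hA b c).1.add (hB b c).1, ?_⟩
  have := (((hA b c).1.hasFDerivAt).add (hB b c).1.hasFDerivAt).fderiv
  have h1 := (hA b c).2
  have h2 := (hB b c).2
  simp only [pd] at *
  rw [Matrix.add_apply, ← h1, ← h2, ← add_apply, ← this]
  rfl

theorem HasPD.mul [Fintype β] {A : (Fin k → ℝ) → Matrix α β 𝕜} {B : (Fin k → ℝ) → Matrix β γ 𝕜}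
    {A' : Matrix α β 𝕜} {B' : Matrix β γ 𝕜} (hA : HasPD j A A' x) (hB : HasPD j B B' x) :
    HasPD j (fun y => A y * B y) (A' * B x + A x * B') x := by
  intro b c
  have h := HasFDerivAt.fun_sum (u := Finset.univ) fun i _ =>
    ((hA b i).1.hasFDerivAt).mul (hB i c).1.hasFDerivAt
  have h2 : (fun y => (A y * B y) b c) = fun y => ∑ i, A y b i * B y i c := by
    funext y
    rw [Matrix.mul_apply]
  rw [h2]
  refine ⟨h.differentiableAt, ?_⟩
  rw [pd]
  erw [h.fderiv]
  rw [Matrix.add_apply, Matrix.mul_apply, Matrix.mul_apply, ← Finset.sum_add_distrib,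
    sum_apply]
  refine Finset.sum_congr rfl fun i _ => ?_
  rw [← (hA b i).2, ← (hB i c).2]
  simp [pd]
  ring

theorem HasPD.const_mul [Fintype β] (C : Matrix α β 𝕜) {B : (Fin k → ℝ) → Matrix β γ 𝕜}
    {B' : Matrix β γ 𝕜} (hB : HasPD j B B' x) : HasPD j (fun y => C * B y) (C * B') x := by
  simpa using (hasPD_const C).mul hB

theorem HasPD.mul_const [Fintype β] {A : (Fin k → ℝ) → Matrix α β 𝕜} {A' : Matrix α β 𝕜}
    (hA : HasPD j A A' x) (C : Matrix β γ 𝕜) : HasPD j (fun y => A y * C) (A' * C) x := by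
  simpa using hA.mul (hasPD_const C)

theorem HasPD.smul {a : (Fin k → ℝ) → 𝕜} {A : (Fin k → ℝ) → Matrix α β 𝕜} {A' : Matrix α β 𝕜}
    (ha : DifferentiableAt ℝ a x) (hA : HasPD j A A' x) :
    HasPD j (fun y => a y • A y) (a x • A' + pd j a x • A x) x := by
  intro b c
  have h := ha.hasFDerivAt.mul (hA b c).1.hasFDerivAt
  refine ⟨h.differentiableAt, ?_⟩
  rw [Matrix.add_apply, Matrix.smul_apply, Matrix.smul_apply, ← (hA b c).2]
  rw [pd]
  erw [h.fderiv]
  simp [pd]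
  ring

theorem HasPD.const_smul (a : 𝕜) {A : (Fin k → ℝ) → Matrix α β 𝕜} {A' : Matrix α β 𝕜}
    (hA : HasPD j A A' x) : HasPD j (fun y => a • A y) (a • A') x := by
  simpa [pd] using HasPD.smul (differentiableAt_const a) hA

theorem HasPD.sub {A B : (Fin k → ℝ) → Matrix α β 𝕜} {A' B' : Matrix α β 𝕜}
    (hA : HasPD j A A' x) (hB : HasPD j B B' x) : HasPD j (fun y => A y - B y) (A' - B') x := by
  simpa [sub_eq_add_neg] using hA.add (hB.const_smul (-1))

theorem HasPD.transpose {A : (Fin k → ℝ) → Matrix α β 𝕜} {A' : Matrix α β 𝕜}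
    (hA : HasPD j A A' x) : HasPD j (fun y => (A y)ᵀ) A'ᵀ x :=
  fun b c => hA c b

/-- Composition of the entries with a real linear map. -/
theorem HasPD.map {𝕜' : Type*} [RCLike 𝕜'] (L : 𝕜 →L[ℝ] 𝕜') {A : (Fin k → ℝ) → Matrix α β 𝕜}
    {A' : Matrix α β 𝕜} (hA : HasPD j A A' x) :
    HasPD j (fun y => (A y).map L) (A'.map L) x := by
  intro b c
  have h := (L.hasFDerivAt).comp x (hA b c).1.hasFDerivAt
  refine ⟨h.differentiableAt, ?_⟩
  rw [Matrix.map_apply, ← (hA b c).2, pd]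
  erw [h.fderiv]
  simp [pd]

theorem HasPD.conj {A : (Fin k → ℝ) → Matrix α β ℂ} {A' : Matrix α β ℂ} (hA : HasPD j A A' x) :
    HasPD j (fun y => (A y).map (starRingEnd ℂ)) (A'.map (starRingEnd ℂ)) x :=
  hA.map (Complex.conjCLE : ℂ →L[ℝ] ℂ)

theorem HasPD.congr {A B : (Fin k → ℝ) → Matrix α β 𝕜} {A' : Matrix α β 𝕜}
    (hA : HasPD j A A' x) {U : Set (Fin k → ℝ)} (hU : IsOpen U) (hx : x ∈ U)
    (hAB : ∀ y ∈ U, B y = A y) : HasPD j B A' x := by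
  intro b c
  have h : (fun y => B y b c) =ᶠ[nhds x] fun y => A y b c :=
    Filter.eventuallyEq_of_mem (hU.mem_nhds hx) fun y hy => by simp [hAB y hy]
  exact ⟨(hA b c).1.congr_of_eventuallyEq h, (h.pd_eq j).trans (hA b c).2⟩

theorem IsSmoothOn.hasPD {A : (Fin k → ℝ) → Matrix α β 𝕜} {U : Set (Fin k → ℝ)}
    (hA : IsSmoothOn A U) (hU : IsOpen U) (hx : x ∈ U) (j : Fin k) :
    HasPD j A (Matrix.of fun b c => pd j (fun y => A y b c) x) x :=
  fun b c => ⟨(hA b c).differentiableAt_of_isOpen hU hx, rfl⟩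

/-- A map with vanishing partial derivatives on a connected open set is constant. -/
theorem eq_of_hasPD_zero {A : (Fin k → ℝ) → Matrix α β 𝕜} {U : Set (Fin k → ℝ)} (hU : IsOpen U)
    (hUc : IsPreconnected U) (hA : ∀ x ∈ U, ∀ j, HasPD j A 0 x) {x y : Fin k → ℝ} (hx : x ∈ U)
    (hy : y ∈ U) (hk : ∀ b c, DifferentiableOn ℝ (fun y => A y b c) U) : A x = A y := by
  ext b c
  refine hU.is_const_of_fderiv_eq_zero hUc (hk b c) (fun z hz => ?_) hx hy
  ext u
  rw [fderiv_apply_eq_sum_pd]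
  simp [(hA z hz _ b c).2]

end MatrixCalculus

/-! ### The symmetric pair and the Lax pair -/

section Algebra

variable {k : ℕ} (ℓ : ℕ)

theorem eps_mul_self (j : Fin k) : eps k ℓ j * eps k ℓ j = 1 := by
  rw [eps]; split_ifs <;> norm_num

theorem J_mul_J : J k ℓ * J k ℓ = 1 := by
  rw [J, Matrix.diagonal_mul_diagonal, ← Matrix.diagonal_one]
  exact congrArg _ (funext fun j => eps_mul_self ℓ j)

theorem J_transpose : (J k ℓ)ᵀ = J k ℓ := Matrix.diagonal_transpose _

theorem Q_mul_Q : Q k ℓ * Q k ℓ = 1 := by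
  simp [Q, Matrix.fromBlocks_multiply, J_mul_J, Matrix.fromBlocks_one]

theorem Q_transpose : (Q k ℓ)ᵀ = Q k ℓ := by
  simp [Q, Matrix.fromBlocks_transpose, J_transpose]

theorem S_mul_S : S k * S k = 1 := by
  simp [S, Matrix.fromBlocks_multiply, Matrix.fromBlocks_one]

theorem S_transpose : (S k)ᵀ = S k := by
  simp [S, Matrix.fromBlocks_transpose]

theorem S_mul_Q : S k * Q k ℓ = Q k ℓ * S k := by
  simp [S, Q, Matrix.fromBlocks_multiply]

/-- `𝒫` lies in the Lie algebra of the orthogonal group of `Q`. -/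
theorem pMat_transpose_mul_Q (ξ : Matrix (Fin k) (Fin (k + 1)) ℝ) :
    (pMat ℓ ξ)ᵀ * Q k ℓ = -(Q k ℓ * pMat ℓ ξ) := by
  simp [pMat, Q, Matrix.fromBlocks_transpose, Matrix.fromBlocks_multiply, J_transpose,
    Matrix.fromBlocks_neg, ← Matrix.mul_assoc]

/-- `𝒫` lies in the `-1`-eigenspace of the involution. -/
theorem S_mul_pMat (ξ : Matrix (Fin k) (Fin (k + 1)) ℝ) :
    S k * pMat ℓ ξ = -(pMat ℓ ξ * S k) := by
  simp [pMat, S, Matrix.fromBlocks_multiply, Matrix.fromBlocks_neg]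

theorem fromBlocks_sub {l m n o R : Type*} [AddGroup R] (A A' : Matrix n l R) (B B' : Matrix n m R)
    (C C' : Matrix o l R) (D D' : Matrix o m R) :
    Matrix.fromBlocks A B C D - Matrix.fromBlocks A' B' C' D'
      = Matrix.fromBlocks (A - A') (B - B') (C - C') (D - D') := by
  ext (_ | _) (_ | _) <;> rfl

theorem pMat_sub (ξ η : Matrix (Fin k) (Fin (k + 1)) ℝ) :
    pMat ℓ (ξ - η) = pMat ℓ ξ - pMat ℓ η := by
  simp only [pMat, fromBlocks_sub, sub_zero, Matrix.transpose_sub, Matrix.sub_mul]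
  congr 1
  abel

theorem pMat_smul (t : ℝ) (ξ : Matrix (Fin k) (Fin (k + 1)) ℝ) :
    pMat ℓ (t • ξ) = t • pMat ℓ ξ := by
  simp [pMat, Matrix.fromBlocks_smul]

theorem lie_transpose_mul {m : Type*} [Fintype m] {A B q : Matrix m m ℝ}
    (hA : Aᵀ * q = -(q * A)) (hB : Bᵀ * q = -(q * B)) : (⁅A, B⁆)ᵀ * q = -(q * ⁅A, B⁆) := by
  simp only [Ring.lie_def, Matrix.transpose_sub, Matrix.transpose_mul, Matrix.sub_mul,
    Matrix.mul_sub, Matrix.mul_assoc, hA, hB, Matrix.mul_neg]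
  simp only [← Matrix.mul_assoc, hA, hB, Matrix.neg_mul]
  simp only [Matrix.mul_assoc]
  abel

theorem S_mul_lie_pMat (ξ η : Matrix (Fin k) (Fin (k + 1)) ℝ) :
    S k * ⁅pMat ℓ ξ, pMat ℓ η⁆ = ⁅pMat ℓ ξ, pMat ℓ η⁆ * S k := by
  simp only [Ring.lie_def, Matrix.mul_sub, Matrix.sub_mul, ← Matrix.mul_assoc, S_mul_pMat,
    Matrix.neg_mul]
  simp only [Matrix.mul_assoc, S_mul_pMat, Matrix.mul_neg, neg_neg]

/-- The bracket of two elements of `𝒫` is block diagonal. -/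
theorem lie_pMat (η ξ : Matrix (Fin k) (Fin (k + 1)) ℝ) :
    ⁅pMat ℓ η, pMat ℓ ξ⁆ = Matrix.fromBlocks (ξᵀ * J k ℓ * η - ηᵀ * J k ℓ * ξ) 0 0
      (ξ * ηᵀ * J k ℓ - η * ξᵀ * J k ℓ) := by
  simp only [Ring.lie_def, pMat, Matrix.fromBlocks_multiply, fromBlocks_sub]
  simp only [Matrix.zero_mul, Matrix.mul_zero, zero_add, add_zero, Matrix.neg_mul, Matrix.mul_neg,
    sub_zero, Matrix.mul_assoc]
  congr 1 <;> abel

section Complexification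

variable {α β γ : Type*}

theorem cplx_mul [Fintype β] (A : Matrix α β ℝ) (B : Matrix β γ ℝ) :
    cplx (A * B) = cplx A * cplx B := Matrix.map_mul (f := Complex.ofRealHom)

theorem cplx_add (A B : Matrix α β ℝ) : cplx (A + B) = cplx A + cplx B := by
  ext; simp [cplx]

theorem cplx_sub (A B : Matrix α β ℝ) : cplx (A - B) = cplx A - cplx B := by
  ext; simp [cplx]

theorem cplx_neg (A : Matrix α β ℝ) : cplx (-A) = -cplx A := by
  ext; simp [cplx]

theorem cplx_smul (t : ℝ) (A : Matrix α β ℝ) : cplx (t • A) = (t : ℂ) • cplx A := by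
  ext; simp [cplx]

theorem cplx_transpose (A : Matrix α β ℝ) : cplx Aᵀ = (cplx A)ᵀ := rfl

theorem cplx_one [DecidableEq α] : cplx (1 : Matrix α α ℝ) = 1 := by
  ext i j
  simp [cplx, Matrix.one_apply, apply_ite]

theorem cplx_injective : Function.Injective (cplx : Matrix α β ℝ → Matrix α β ℂ) :=
  Matrix.map_injective Complex.ofReal_injective

theorem cplx_conj (A : Matrix α β ℝ) : (cplx A).map (starRingEnd ℂ) = cplx A := by
  ext; simp [cplx]

theorem conj_mul [Fintype β] (A : Matrix α β ℂ) (B : Matrix β γ ℂ) :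
    (A * B).map (starRingEnd ℂ) = A.map (starRingEnd ℂ) * B.map (starRingEnd ℂ) :=
  Matrix.map_mul

theorem conj_conj (A : Matrix α β ℂ) :
    (A.map (starRingEnd ℂ)).map (starRingEnd ℂ) = A := by
  ext; simp

/-- A complex matrix fixed by conjugation is real. -/
theorem eq_cplx_of_conj_eq {A : Matrix α β ℂ} (h : A.map (starRingEnd ℂ) = A) :
    A = cplx (A.map Complex.re) := by
  ext b c
  have := congrFun (congrFun h b) c
  simpa [cplx] using (Complex.conj_eq_iff_re.mp this).symm

end Complexification

theorem cQ_mul_cQ : cplx (Q k ℓ) * cplx (Q k ℓ) = 1 := by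
  rw [← cplx_mul, Q_mul_Q, cplx_one]

theorem cQ_transpose : (cplx (Q k ℓ))ᵀ = cplx (Q k ℓ) := by
  rw [← cplx_transpose, Q_transpose]

theorem cS_mul_cS : cplx (S k) * cplx (S k) = 1 := by
  rw [← cplx_mul, S_mul_S, cplx_one]

theorem cS_mul_cQ : cplx (S k) * cplx (Q k ℓ) = cplx (Q k ℓ) * cplx (S k) := by
  rw [← cplx_mul, S_mul_Q, cplx_mul]

theorem ca_transpose (i : Fin k) :
    (cplx (a ℓ i))ᵀ * cplx (Q k ℓ) = -(cplx (Q k ℓ) * cplx (a ℓ i)) := by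
  rw [← cplx_transpose, ← cplx_mul, a, pMat_transpose_mul_Q, cplx_neg, cplx_mul]

variable (ξ : (Fin k → ℝ) → Matrix (Fin k) (Fin (k + 1)) ℝ) (i : Fin k) (x : Fin k → ℝ) (μ : ℂ)

theorem lax_transpose :
    (lax ℓ ξ i x μ)ᵀ * cplx (Q k ℓ) = -(cplx (Q k ℓ) * lax ℓ ξ i x μ) := by
  have h : (cplx ⁅a ℓ i, pMat ℓ (ξ x)⁆)ᵀ * cplx (Q k ℓ)
      = -(cplx (Q k ℓ) * cplx ⁅a ℓ i, pMat ℓ (ξ x)⁆) := by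
    rw [← cplx_transpose, ← cplx_mul, a, lie_transpose_mul (pMat_transpose_mul_Q ℓ _)
      (pMat_transpose_mul_Q ℓ _), cplx_neg, cplx_mul]
  rw [lax, Matrix.transpose_add, Matrix.add_mul, h, Matrix.transpose_smul, Matrix.smul_mul,
    ca_transpose, Matrix.mul_add, Matrix.mul_smul, smul_neg, neg_add]

theorem Q_mul_lax_transpose :
    cplx (Q k ℓ) * (lax ℓ ξ i x μ)ᵀ = -(lax ℓ ξ i x μ * cplx (Q k ℓ)) := by
  have h := congrArg (fun A => cplx (Q k ℓ) * A * cplx (Q k ℓ)) (lax_transpose ℓ ξ i x μ)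
  simp only [Matrix.mul_assoc, cQ_mul_cQ, Matrix.mul_one, Matrix.neg_mul, Matrix.mul_neg] at h
  rw [h, ← Matrix.mul_assoc, cQ_mul_cQ, Matrix.one_mul]

theorem S_mul_lax : cplx (S k) * lax ℓ ξ i x (-μ) = lax ℓ ξ i x μ * cplx (S k) := by
  rw [lax, lax, Matrix.mul_add, Matrix.add_mul, ← cplx_mul, a, S_mul_lie_pMat, cplx_mul,
    Matrix.mul_smul, ← cplx_mul, S_mul_pMat, cplx_neg, cplx_mul, Matrix.smul_mul]
  simp

theorem lax_conj : (lax ℓ ξ i x (starRingEnd ℂ μ)).map (starRingEnd ℂ) = lax ℓ ξ i x μ := by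
  ext b c
  simp [lax, cplx]

end Algebra

/-! ### Symmetries of parallel frames -/

section Frames

variable {k ℓ : ℕ} {Ω : Set (Fin k → ℝ)} {Λ : Set ℂ}
  {ξ : (Fin k → ℝ) → Matrix (Fin k) (Fin (k + 1)) ℝ}
  {E : (Fin k → ℝ) → ℂ → Matrix (Idx k) (Idx k) ℂ}

theorem IsFrameFor.isSmoothOn (h : IsFrameFor ℓ Ω Λ ξ E) {μ : ℂ} (hμ : μ ∈ Λ) :
    IsSmoothOn (fun x => E x μ) Ω := fun b c =>
  (h.1 b c).comp (contDiff_id.prodMk contDiff_const).contDiffOn fun _ hx => ⟨hx, hμ⟩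

theorem IsFrameFor.hasPD (h : IsFrameFor ℓ Ω Λ ξ E) (hΩ : IsOpen Ω) {μ : ℂ} (hμ : μ ∈ Λ)
    {x : Fin k → ℝ} (hx : x ∈ Ω) (j : Fin k) :
    HasPD j (fun y => E y μ) (E x μ * lax ℓ ξ j x μ) x := by
  have := (h.isSmoothOn hμ).hasPD hΩ hx j
  rwa [h.2 x hx μ hμ j] at this

/-- The inverse of an element of the orthogonal group of `Q`. -/
theorem inv_eq_Q_transpose_Q {A : Matrix (Idx k) (Idx k) ℂ}
    (hA : A * (cplx (Q k ℓ) * Aᵀ * cplx (Q k ℓ)) = 1) :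
    A⁻¹ = cplx (Q k ℓ) * Aᵀ * cplx (Q k ℓ) := Matrix.inv_eq_right_inv hA

theorem mul_Q_transpose_Q_iff {A : Matrix (Idx k) (Idx k) ℂ} :
    A * (cplx (Q k ℓ) * Aᵀ * cplx (Q k ℓ)) = 1 ↔ Aᵀ * cplx (Q k ℓ) * A = cplx (Q k ℓ) := by
  rw [mul_eq_one_comm]
  constructor <;> intro h
  · have := congrArg (cplx (Q k ℓ) * ·) h
    simpa only [← Matrix.mul_assoc, cQ_mul_cQ, Matrix.one_mul, Matrix.mul_one] using this
  · rw [Matrix.mul_assoc, Matrix.mul_assoc, ← Matrix.mul_assoc _ _ A, h, cQ_mul_cQ]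

/-- For two solutions `A`, `B` of `dA = A θ` with `θ` in the orthogonal Lie algebra of `Q`, the
product `A Q Bᵀ` is constant. -/
theorem mul_Q_mul_transpose_eq (hΩ : IsOpen Ω) (hΩc : IsPreconnected Ω)
    {A B : (Fin k → ℝ) → Matrix (Idx k) (Idx k) ℂ} {μ : ℂ}
    (hA : ∀ x ∈ Ω, ∀ j, HasPD j A (A x * lax ℓ ξ j x μ) x)
    (hB : ∀ x ∈ Ω, ∀ j, HasPD j B (B x * lax ℓ ξ j x μ) x)
    (hAs : IsSmoothOn A Ω) (hBs : IsSmoothOn B Ω)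
    {x y : Fin k → ℝ} (hx : x ∈ Ω) (hy : y ∈ Ω) :
    A x * cplx (Q k ℓ) * (B x)ᵀ = A y * cplx (Q k ℓ) * (B y)ᵀ := by
  refine eq_of_hasPD_zero (A := fun x => A x * cplx (Q k ℓ) * (B x)ᵀ) hΩ hΩc (fun z hz j => ?_)
    hx hy fun b c => ((hAs.mul (isSmoothOn_const _)).mul hBs.transpose b c).differentiableOn
      (by simp)
  have h := ((hA z hz j).mul_const (cplx (Q k ℓ))).mul (hB z hz j).transpose
  convert h using 1
  rw [Matrix.transpose_mul, ← Matrix.mul_assoc, Matrix.mul_assoc (A z) (cplx (Q k ℓ)),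
    Q_mul_lax_transpose]
  simp [Matrix.mul_assoc]

theorem frame_unique (hΩ : IsOpen Ω) (hΩc : IsPreconnected Ω)
    {A B : (Fin k → ℝ) → Matrix (Idx k) (Idx k) ℂ} {μ : ℂ}
    (hA : ∀ x ∈ Ω, ∀ j, HasPD j A (A x * lax ℓ ξ j x μ) x)
    (hB : ∀ x ∈ Ω, ∀ j, HasPD j B (B x * lax ℓ ξ j x μ) x)
    (hAs : IsSmoothOn A Ω) (hBs : IsSmoothOn B Ω)
    (hBQ : ∀ x ∈ Ω, B x * (cplx (Q k ℓ) * (B x)ᵀ * cplx (Q k ℓ)) = 1)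
    {x₀ x : Fin k → ℝ} (hx₀ : x₀ ∈ Ω) (hx : x ∈ Ω) (h0 : A x₀ = B x₀) : A x = B x := by
  have h := mul_Q_mul_transpose_eq hΩ hΩc hA hB hAs hBs hx hx₀
  have h1 : A x * (cplx (Q k ℓ) * (B x)ᵀ * cplx (Q k ℓ)) = 1 := by
    rw [← hBQ x₀ hx₀, ← h0, ← Matrix.mul_assoc, ← Matrix.mul_assoc, h, h0]
    simp only [Matrix.mul_assoc]
  calc A x = A x * (cplx (Q k ℓ) * (B x)ᵀ * cplx (Q k ℓ) * B x) := by
        rw [mul_eq_one_comm.mp (hBQ x hx), Matrix.mul_one]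
    _ = B x := by rw [← Matrix.mul_assoc, h1, Matrix.one_mul]

variable {x₀ : Fin k → ℝ}

theorem IsParallelFrame.mul_Q_transpose_Q (hE : IsParallelFrame ℓ Ω x₀ ξ E) (hΩ : IsOpen Ω)
    (hΩc : IsPreconnected Ω) (hx₀ : x₀ ∈ Ω) {x : Fin k → ℝ} (hx : x ∈ Ω) (μ : ℂ) :
    E x μ * (cplx (Q k ℓ) * (E x μ)ᵀ * cplx (Q k ℓ)) = 1 := by
  have h := mul_Q_mul_transpose_eq hΩ hΩc (fun z hz j => hE.1.hasPD hΩ (Set.mem_univ μ) hz j)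
    (fun z hz j => hE.1.hasPD hΩ (Set.mem_univ μ) hz j) (hE.1.isSmoothOn (Set.mem_univ μ))
    (hE.1.isSmoothOn (Set.mem_univ μ)) hx hx₀
  rw [← mul_Q_transpose_Q_iff.mpr (hE.2.group μ), ← Matrix.mul_assoc, ← Matrix.mul_assoc, h]
  simp only [Matrix.mul_assoc]

theorem IsParallelFrame.conj_eq (hE : IsParallelFrame ℓ Ω x₀ ξ E) (hΩ : IsOpen Ω)
    (hΩc : IsPreconnected Ω) (hx₀ : x₀ ∈ Ω) {x : Fin k → ℝ} (hx : x ∈ Ω) (μ : ℂ) :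
    (E x (starRingEnd ℂ μ)).map (starRingEnd ℂ) = E x μ := by
  refine frame_unique (A := fun x => (E x (starRingEnd ℂ μ)).map (starRingEnd ℂ)) hΩ hΩc
    (fun z hz j => ?_) (fun z hz j => hE.1.hasPD hΩ (Set.mem_univ μ) hz j)
    (hE.1.isSmoothOn (Set.mem_univ _)).conj (hE.1.isSmoothOn (Set.mem_univ μ))
    (fun z hz => hE.mul_Q_transpose_Q hΩ hΩc hx₀ hz μ) hx₀ hx (hE.2.real μ)
  have := (hE.1.hasPD hΩ (Set.mem_univ (starRingEnd ℂ μ)) hz j).conj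
  rwa [conj_mul, lax_conj] at this

theorem IsParallelFrame.sigma_eq (hE : IsParallelFrame ℓ Ω x₀ ξ E) (hΩ : IsOpen Ω)
    (hΩc : IsPreconnected Ω) (hx₀ : x₀ ∈ Ω) {x : Fin k → ℝ} (hx : x ∈ Ω) (μ : ℂ) :
    cplx (S k) * E x (-μ) * cplx (S k) = E x μ := by
  refine frame_unique (A := fun x => cplx (S k) * E x (-μ) * cplx (S k)) hΩ hΩc
    (fun z hz j => ?_) (fun z hz j => hE.1.hasPD hΩ (Set.mem_univ μ) hz j)
    (((isSmoothOn_const _).mul (hE.1.isSmoothOn (Set.mem_univ _))).mul (isSmoothOn_const _))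
    (hE.1.isSmoothOn (Set.mem_univ μ))
    (fun z hz => hE.mul_Q_transpose_Q hΩ hΩc hx₀ hz μ) hx₀ hx (hE.2.sigma μ)
  have := ((hE.1.hasPD hΩ (Set.mem_univ (-μ)) hz j).const_mul (cplx (S k))).mul_const (cplx (S k))
  convert this using 1
  have hl := S_mul_lax ℓ ξ j z (-μ)
  rw [neg_neg] at hl
  rw [Matrix.mul_assoc (cplx (S k) * _), hl]
  simp only [Matrix.mul_assoc]

end Frames

/-! ### Dependence of frames on the spectral parameter -/

section Spectral

variable {k ℓ : ℕ} {Ω : Set (Fin k → ℝ)} {Λ : Set ℂ}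
  {ξ : (Fin k → ℝ) → Matrix (Fin k) (Fin (k + 1)) ℝ}
  {E : (Fin k → ℝ) → ℂ → Matrix (Idx k) (Idx k) ℂ}

/-- The real directional derivative of `E` at `μ = 0` in the direction `v ∈ ℂ` of the spectral
parameter. -/
noncomputable def dDir (E : (Fin k → ℝ) → ℂ → Matrix (Idx k) (Idx k) ℂ) (v : ℂ) (x : Fin k → ℝ) :
    Matrix (Idx k) (Idx k) ℂ :=
  Matrix.of fun b c => fderiv ℝ (fun p : (Fin k → ℝ) × ℂ => E p.1 p.2 b c) (x, 0) (0, v)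

theorem hasDerivAt_fderiv_comp {V F : Type*} [NormedAddCommGroup V] [NormedSpace ℝ V]
    [NormedAddCommGroup F] [NormedSpace ℝ F] {e : V → F} {q v : V} (w : V)
    (hd : DifferentiableAt ℝ (fderiv ℝ e) q) {γ : ℝ → V} (hγ : HasDerivAt γ v 0) (h0 : γ 0 = q) :
    HasDerivAt (fun t => fderiv ℝ e (γ t) w) (fderiv ℝ (fderiv ℝ e) q v w) 0 := by
  subst h0
  have h := (hd.hasFDerivAt.comp_hasDerivAt (0 : ℝ) hγ).clm_apply (hasDerivAt_const (0 : ℝ) w)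
  simpa using h

theorem isSmoothOn_dDir (h : IsFrameFor ℓ Ω Λ ξ E) (hΩ : IsOpen Ω) (hΛ : IsOpen Λ)
    (h0 : (0 : ℂ) ∈ Λ) (v : ℂ) : IsSmoothOn (dDir E v) Ω := by
  intro b c
  have h1 : ContDiffOn ℝ ∞ (fun p => fderiv ℝ (fun p : (Fin k → ℝ) × ℂ => E p.1 p.2 b c) p (0, v))
      (Ω ×ˢ Λ) :=
    ((h.1 b c).fderiv_of_isOpen (hΩ.prod hΛ) (m := ∞) (by simp)).clm_apply contDiffOn_const
  exact h1.comp (contDiff_id.prodMk (contDiff_const (c := (0 : ℂ)))).contDiffOn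
    fun _ hx => ⟨hx, h0⟩

/-- Interchanging the derivatives in `x` and in the spectral parameter. -/
theorem hasPD_dDir (h : IsFrameFor ℓ Ω Λ ξ E) (hΩ : IsOpen Ω) (hΛ : IsOpen Λ)
    (h0 : (0 : ℂ) ∈ Λ) (v : ℂ) {x : Fin k → ℝ} (hx : x ∈ Ω) (j : Fin k) :
    HasPD j (dDir E v) (dDir E v x * lax ℓ ξ j x 0 + E x 0 * (v • cplx (a ℓ j))) x := by
  intro b c
  refine ⟨(isSmoothOn_dDir h hΩ hΛ h0 v b c).differentiableAt_of_isOpen hΩ hx, ?_⟩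
  have hopen := hΩ.prod hΛ
  have hmem : ((x, 0) : (Fin k → ℝ) × ℂ) ∈ Ω ×ˢ Λ := ⟨hx, h0⟩
  have he : ∀ b c, ∀ q ∈ Ω ×ˢ Λ,
      DifferentiableAt ℝ (fun p : (Fin k → ℝ) × ℂ => E p.1 p.2 b c) q :=
    fun b c q hq => (h.1 b c).differentiableAt_of_isOpen hopen hq
  set e : (Fin k → ℝ) × ℂ → ℂ := fun p => E p.1 p.2 b c with he_def
  have hd : DifferentiableAt ℝ (fderiv ℝ e) (x, 0) :=
    ((h.1 b c).fderiv_of_isOpen hopen (m := ∞) (by simp)).differentiableAt_of_isOpen hopen hmem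
  have hs : IsSymmSndFDerivAt ℝ e (x, 0) :=
    ((h.1 b c).contDiffAt (hopen.mem_nhds hmem)).isSymmSndFDerivAt (by
      rw [minSmoothness_of_isRCLikeNormedField]
      exact ENat.LEInfty.out)
  -- the left hand side is a mixed second derivative
  have h1 : pd j (fun y => dDir E v y b c) x
      = fderiv ℝ (fderiv ℝ e) (x, 0) (Pi.single j 1, 0) (0, v) := by
    have hl : HasFDerivAt (fun y : Fin k → ℝ => (y, (0 : ℂ)))
        ((ContinuousLinearMap.id ℝ (Fin k → ℝ)).prod 0) x :=
      (hasFDerivAt_id x).prodMk (hasFDerivAt_const _ _)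
    have hc := (hd.hasFDerivAt.comp x hl).clm_apply (hasFDerivAt_const ((0 : Fin k → ℝ), v) x)
    change fderiv ℝ (fun y => fderiv ℝ e (y, 0) (0, v)) x (Pi.single j 1) = _
    erw [hc.fderiv]
    simp
  -- along `t ↦ (x, t v)` the `x_j`-derivative of `e` is the entry of `E θ_j`
  have hmul : HasDerivAt (fun t : ℝ => (t : ℂ) * v) v 0 := by
    simpa using (Complex.ofRealCLM.hasDerivAt (x := (0 : ℝ))).mul_const v
  have hline : HasDerivAt (fun t : ℝ => (x, (t : ℂ) * v)) ((0 : Fin k → ℝ), v) 0 :=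
    (hasDerivAt_const (0 : ℝ) x).prodMk hmul
  have hline0 : ((x, ((0 : ℝ) : ℂ) * v) : (Fin k → ℝ) × ℂ) = (x, 0) := by simp
  have h3 : HasDerivAt (fun t : ℝ => fderiv ℝ e (x, (t : ℂ) * v) (Pi.single j 1, 0))
      (fderiv ℝ (fderiv ℝ e) (x, 0) (0, v) (Pi.single j 1, 0)) 0 :=
    hasDerivAt_fderiv_comp _ hd hline hline0
  have h6 : HasDerivAt (fun t : ℝ => (E x ((t : ℂ) * v) * lax ℓ ξ j x ((t : ℂ) * v)) b c)
      ((dDir E v x * lax ℓ ξ j x 0 + E x 0 * (v • cplx (a ℓ j))) b c) 0 := by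
    have h7 : ∀ i, HasDerivAt (fun t : ℝ => E x ((t : ℂ) * v) b i) (dDir E v x b i) 0 := fun i => by
      have h8 := (he b i (x, 0) hmem).hasFDerivAt
      rw [← hline0] at h8
      have h9 := h8.comp_hasDerivAt (0 : ℝ) hline
      rw [hline0] at h9
      exact h9
    have h8 : ∀ i, HasDerivAt (fun t : ℝ => lax ℓ ξ j x ((t : ℂ) * v) i c)
        ((v • cplx (a ℓ j)) i c) 0 := fun i => by
      have h9 := (hmul.mul_const (cplx (a ℓ j) i c)).add_const
        (cplx ⁅a ℓ j, pMat ℓ (ξ x)⁆ i c)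
      simpa [lax] using h9
    have h9 := HasDerivAt.fun_sum (u := Finset.univ) fun i _ => (h7 i).mul (h8 i)
    simp only [Matrix.mul_apply, Matrix.add_apply]
    rw [← Finset.sum_add_distrib]
    simpa using h9
  have h7 : (fun t : ℝ => fderiv ℝ e (x, (t : ℂ) * v) (Pi.single j 1, 0)) =ᶠ[nhds 0]
      fun t : ℝ => (E x ((t : ℂ) * v) * lax ℓ ξ j x ((t : ℂ) * v)) b c := by
    have hmv : ∀ᶠ t : ℝ in nhds 0, (x, (t : ℂ) * v) ∈ Ω ×ˢ Λ :=
      hline.continuousAt.eventually (hopen.mem_nhds (by simpa using hmem))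
    filter_upwards [hmv] with t ht
    have h8 := h.2 x hx _ ht.2 j
    rw [← h8, Matrix.of_apply, pd]
    have hl : HasFDerivAt (fun y : Fin k → ℝ => (y, (t : ℂ) * v))
        ((ContinuousLinearMap.id ℝ (Fin k → ℝ)).prod 0) x :=
      (hasFDerivAt_id x).prodMk (hasFDerivAt_const _ _)
    have hc := (he b c _ ht).hasFDerivAt.comp x hl
    erw [hc.fderiv]
    simp [e]
  rw [h1, hs.eq]
  exact h3.unique (h6.congr_of_eventuallyEq h7)

theorem differentiableAt_slice (h : IsFrameFor ℓ Ω Λ ξ E) (hΩ : IsOpen Ω) (hΛ : IsOpen Λ)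
    (h0 : (0 : ℂ) ∈ Λ) {x : Fin k → ℝ} (hx : x ∈ Ω) (b c : Idx k) :
    DifferentiableAt ℝ (fun μ => E x μ b c) 0 ∧
      ∀ v, fderiv ℝ (fun μ => E x μ b c) 0 v = dDir E v x b c := by
  have he := ((h.1 b c).differentiableAt_of_isOpen (hΩ.prod hΛ)
    (x := ((x, 0) : (Fin k → ℝ) × ℂ)) ⟨hx, h0⟩).hasFDerivAt
  have hl : HasFDerivAt (fun μ : ℂ => (x, μ)) ((0 : ℂ →L[ℝ] (Fin k → ℝ)).prod
      (ContinuousLinearMap.id ℝ ℂ)) 0 :=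
    (hasFDerivAt_const _ _).prodMk (hasFDerivAt_id _)
  have hc := he.comp (0 : ℂ) hl
  refine ⟨hc.differentiableAt, fun v => ?_⟩
  erw [hc.fderiv]
  simp [dDir]

/-- For a frame that is complex differentiable at `μ = 0`, the directional derivative along the
real axis is the complex derivative. -/
theorem dDir_one_eq (h : IsFrameFor ℓ Ω Λ ξ E) (hΩ : IsOpen Ω) (hΛ : IsOpen Λ)
    (h0 : (0 : ℂ) ∈ Λ) {x : Fin k → ℝ} (hx : x ∈ Ω)
    (hd : ∀ b c, DifferentiableAt ℂ (fun μ => E x μ b c) 0) : dDir E 1 x = dSpec E x := by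
  ext b c
  rw [← (differentiableAt_slice h hΩ hΛ h0 hx b c).2, (hd b c).fderiv_restrictScalars ℝ]
  simp [dSpec]

/-- A frame with values in the orthogonal group of `Q` has a Sym-type derivative: the partial
derivatives of `(∂_v E) E⁻¹` at `μ = 0` are `v E a_j E⁻¹`. -/
theorem hasPD_dDir_mul_inv (h : IsFrameFor ℓ Ω Λ ξ E) (hΩ : IsOpen Ω) (hΛ : IsOpen Λ)
    (h0 : (0 : ℂ) ∈ Λ) (hQ : ∀ x ∈ Ω, E x 0 * (cplx (Q k ℓ) * (E x 0)ᵀ * cplx (Q k ℓ)) = 1)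
    (v : ℂ) {x : Fin k → ℝ} (hx : x ∈ Ω) (j : Fin k) :
    HasPD j (fun y => dDir E v y * (E y 0)⁻¹)
      (v • (E x 0 * cplx (a ℓ j) * (E x 0)⁻¹)) x := by
  have hE := (((h.hasPD hΩ h0 hx j).transpose).const_mul (cplx (Q k ℓ))).mul_const (cplx (Q k ℓ))
  have h2 := (hasPD_dDir h hΩ hΛ h0 v hx j).mul hE
  rw [Matrix.transpose_mul, ← Matrix.mul_assoc (cplx (Q k ℓ)), Q_mul_lax_transpose] at h2
  have h3 := h2.congr hΩ hx (B := fun y => dDir E v y * (E y 0)⁻¹)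
    fun y hy => by rw [inv_eq_Q_transpose_Q (hQ y hy)]
  convert h3 using 1
  rw [inv_eq_Q_transpose_Q (hQ x hx)]
  simp only [Matrix.add_mul, Matrix.mul_assoc, Matrix.mul_smul, Matrix.smul_mul, Matrix.neg_mul,
    Matrix.mul_neg]
  abel

theorem isSmoothOn_dDir_mul_inv (h : IsFrameFor ℓ Ω Λ ξ E) (hΩ : IsOpen Ω) (hΛ : IsOpen Λ)
    (h0 : (0 : ℂ) ∈ Λ) (hQ : ∀ x ∈ Ω, E x 0 * (cplx (Q k ℓ) * (E x 0)ᵀ * cplx (Q k ℓ)) = 1)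
    (v : ℂ) : IsSmoothOn (fun y => dDir E v y * (E y 0)⁻¹) Ω := by
  have h2 := (isSmoothOn_dDir h hΩ hΛ h0 v).mul
    (((isSmoothOn_const (cplx (Q k ℓ))).mul (h.isSmoothOn h0).transpose).mul
      (isSmoothOn_const (cplx (Q k ℓ))))
  intro b c
  exact (h2 b c).congr fun y hy => by simp only [inv_eq_Q_transpose_Q (hQ y hy)]

/-- A parallel frame is complex differentiable in the spectral parameter at `μ = 0`. A frame is only
assumed to be real smooth in `μ`, but with `∂_v` the derivative in the direction `v ∈ ℂ` at `μ = 0`,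
the obstruction `(∂_v E) E⁻¹ - v (∂_1 E) E⁻¹` (for `v = √-1`) to the Cauchy–Riemann equations is
constant in `x`, and it vanishes at `x₀`. -/
theorem IsParallelFrame.differentiableAt {x₀ : Fin k → ℝ} (hE : IsParallelFrame ℓ Ω x₀ ξ E)
    (hΩ : IsOpen Ω) (hΩc : IsPreconnected Ω) (hx₀ : x₀ ∈ Ω) {x : Fin k → ℝ} (hx : x ∈ Ω)
    (b c : Idx k) : DifferentiableAt ℂ (fun μ => E x μ b c) 0 := by
  have hQ : ∀ x ∈ Ω, E x 0 * (cplx (Q k ℓ) * (E x 0)ᵀ * cplx (Q k ℓ)) = 1 :=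
    fun x hx => hE.mul_Q_transpose_Q hΩ hΩc hx₀ hx 0
  have hsl := fun {x : Fin k → ℝ} (hx : x ∈ Ω) =>
    differentiableAt_slice hE.1 hΩ isOpen_univ (Set.mem_univ 0) hx
  have hpd := fun (v : ℂ) {x : Fin k → ℝ} (hx : x ∈ Ω) =>
    hasPD_dDir_mul_inv hE.1 hΩ isOpen_univ (Set.mem_univ 0) hQ v hx
  have hsm := fun (v : ℂ) =>
    isSmoothOn_dDir_mul_inv hE.1 hΩ isOpen_univ (Set.mem_univ 0) hQ v
  have hI : ∀ b c, dDir E Complex.I x₀ b c = Complex.I * dDir E 1 x₀ b c := fun b c => by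
    rw [← (hsl hx₀ b c).2, ← (hsl hx₀ b c).2]
    exact (differentiableAt_complex_iff_differentiableAt_real.mp (hE.2.entire b c 0)).2
  have hconst := eq_of_hasPD_zero
    (A := fun y => dDir E Complex.I y * (E y 0)⁻¹ - Complex.I • (dDir E 1 y * (E y 0)⁻¹))
    hΩ hΩc (fun z hz j => by
      simpa using (hpd Complex.I hz j).sub ((hpd 1 hz j).const_smul Complex.I)) hx hx₀
    fun b c => ((hsm Complex.I).sub (IsSmoothOn.smul contDiffOn_const (hsm 1)) b c).differentiableOn
      (by simp)
  have h0 : dDir E Complex.I x₀ = Complex.I • dDir E 1 x₀ := by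
    ext b c
    simpa using hI b c
  have h1 : dDir E Complex.I x = Complex.I • dDir E 1 x := by
    simp only [h0, Matrix.smul_mul, sub_self] at hconst
    rw [sub_eq_zero, ← Matrix.smul_mul] at hconst
    have h2 := congrArg (· * E x 0) hconst
    have h3 : (E x 0)⁻¹ * E x 0 = 1 := by
      rw [inv_eq_Q_transpose_Q (hQ x hx)]
      exact mul_eq_one_comm.mp (hQ x hx)
    simpa only [Matrix.mul_assoc, h3, Matrix.mul_one] using h2
  rw [differentiableAt_complex_iff_differentiableAt_real]
  refine ⟨(hsl hx b c).1, ?_⟩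
  rw [(hsl hx b c).2, (hsl hx b c).2, h1]
  rfl

end Spectral

/-! ### Compatibility of the Lax pair -/

section Compatibility

variable {k ℓ : ℕ} {Ω : Set (Fin k → ℝ)} {Λ : Set ℂ}
  {ξ : (Fin k → ℝ) → Matrix (Fin k) (Fin (k + 1)) ℝ}
  {E : (Fin k → ℝ) → ℂ → Matrix (Idx k) (Idx k) ℂ}

theorem HasPD.submatrix {𝕜 α β α' β' : Type*} [RCLike 𝕜] {j : Fin k} {x : Fin k → ℝ}
    {A : (Fin k → ℝ) → Matrix α β 𝕜} {A' : Matrix α β 𝕜} (hA : HasPD j A A' x) (r : α' → α)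
    (c : β' → β) : HasPD j (fun y => (A y).submatrix r c) (A'.submatrix r c) x :=
  fun _ _ => hA _ _

theorem hasPD_pMat {j : Fin k} {x : Fin k → ℝ} {ξ' : Matrix (Fin k) (Fin (k + 1)) ℝ}
    (h : HasPD j ξ ξ' x) : HasPD j (fun y => pMat ℓ (ξ y)) (pMat ℓ ξ') x := by
  have h1 : HasPD j (fun y => -((ξ y)ᵀ * J k ℓ)) (-(ξ'ᵀ * J k ℓ)) x := by
    simpa using (h.transpose.mul_const (J k ℓ)).const_smul (-1)
  rintro (b | b) (c | c)
  · exact hasPD_const (0 : Matrix (Fin (k + 1)) (Fin (k + 1)) ℝ) b c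
  · exact h1 b c
  · exact h b c
  · exact hasPD_const (0 : Matrix (Fin k) (Fin k) ℝ) b c

theorem hasPD_lax_zero (i j : Fin k) {x : Fin k → ℝ} {ξ' : Matrix (Fin k) (Fin (k + 1)) ℝ}
    (h : HasPD j ξ ξ' x) : HasPD j (fun y => lax ℓ ξ i y 0) (cplx ⁅a ℓ i, pMat ℓ ξ'⁆) x := by
  have h1 := ((hasPD_pMat (ℓ := ℓ) h).const_mul (a ℓ i)).sub
    ((hasPD_pMat (ℓ := ℓ) h).mul_const (a ℓ i))
  have h2 := h1.map Complex.ofRealCLM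
  simp only [lax, zero_smul, zero_add, Ring.lie_def]
  exact h2

/-- The symmetry of second derivatives of an invertible frame at `μ = 0` is the system for `ξ`. -/
theorem IsFrameFor.isSolution (h : IsFrameFor ℓ Ω Λ ξ E) (hΩ : IsOpen Ω) (h0 : (0 : ℂ) ∈ Λ)
    (hQ : ∀ x ∈ Ω, E x 0 * (cplx (Q k ℓ) * (E x 0)ᵀ * cplx (Q k ℓ)) = 1)
    (hξ : IsSmoothOn ξ Ω) (hd : ∀ x ∈ Ω, ∀ i : Fin k, ξ x i i.castSucc = 0) :
    IsSolution ℓ Ω ξ := by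
  refine ⟨hξ, hd, fun x hx i j => ?_⟩
  have key : ∀ i j : Fin k, (Matrix.of fun b c => pd i (pd j fun y => E y 0 b c) x)
      = E x 0 * (lax ℓ ξ i x 0 * lax ℓ ξ j x 0
        + cplx ⁅a ℓ j, pMat ℓ (Matrix.of fun b c => pd i (fun y => ξ y b c) x)⁆) := by
    intro i j
    have h1 := (h.hasPD hΩ h0 hx i).mul (hasPD_lax_zero (ℓ := ℓ) j i (hξ.hasPD hΩ hx i))
    ext b c
    rw [Matrix.of_apply, pd_congr hΩ (fun y hy => (h.hasPD hΩ h0 hy j b c).2) i hx, (h1 b c).2,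
      Matrix.mul_add, Matrix.mul_assoc]
  have hsymm : (Matrix.of fun b c => pd i (pd j fun y => E y 0 b c) x)
      = (Matrix.of fun b c => pd j (pd i fun y => E y 0 b c) x) := by
    ext b c
    exact pd_comm ((h.isSmoothOn h0 b c).contDiffAt (hΩ.mem_nhds hx)) i j
  rw [key i j, key j i] at hsymm
  have h2 := congrArg (cplx (Q k ℓ) * (E x 0)ᵀ * cplx (Q k ℓ) * ·) hsymm
  simp only [← Matrix.mul_assoc _ (E x 0), mul_eq_one_comm.mp (hQ x hx), Matrix.one_mul] at h2
  apply cplx_injective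
  rw [cplx_sub]
  simp only [lax, zero_smul, zero_add, ← cplx_mul] at h2
  rw [Ring.lie_def ⁅a ℓ i, _⁆, cplx_sub]
  rw [sub_eq_sub_iff_add_eq_add]
  refine Eq.trans ?_ (h2.symm.trans ?_) <;> abel

end Compatibility

/-! ### Sym-type frames and their hypersurfaces -/

section SymFrames

variable {k ℓ : ℕ} {Ω : Set (Fin k → ℝ)} {Λ : Set ℂ}
  {ξ : (Fin k → ℝ) → Matrix (Fin k) (Fin (k + 1)) ℝ}
  {E : (Fin k → ℝ) → ℂ → Matrix (Idx k) (Idx k) ℂ}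
  {Ξ : (Fin k → ℝ) → Matrix (Fin (k + 1)) (Fin k) ℝ}

/-- A frame of the Lax pair, complex differentiable at `μ = 0`, with `E(x, 0) = diag(g₁, g₂)` in
`O(k+1) × O(k-ℓ,ℓ)`, and whose logarithmic derivative in `μ` at `0` lies in `𝒫`, with upper right
block `Ξ`. -/
structure IsSymFrame (ℓ : ℕ) (Ω : Set (Fin k → ℝ)) (Λ : Set ℂ)
    (ξ : (Fin k → ℝ) → Matrix (Fin k) (Fin (k + 1)) ℝ)
    (E : (Fin k → ℝ) → ℂ → Matrix (Idx k) (Idx k) ℂ)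
    (Ξ : (Fin k → ℝ) → Matrix (Fin (k + 1)) (Fin k) ℝ) : Prop where
  isOpen : IsOpen Ω
  isOpen_spec : IsOpen Λ
  zero_mem : (0 : ℂ) ∈ Λ
  smooth : IsSmoothOn ξ Ω
  frame : IsFrameFor ℓ Ω Λ ξ E
  diff : ∀ x ∈ Ω, ∀ b c, DifferentiableAt ℂ (fun μ => E x μ b c) 0
  block : ∀ x ∈ Ω, E x 0 = cplx (Matrix.fromBlocks (blk₁ E x) 0 0 (blk₂ E x))
  orth₁ : ∀ x ∈ Ω, (blk₁ E x)ᵀ * blk₁ E x = 1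
  orth₂ : ∀ x ∈ Ω, (blk₂ E x)ᵀ * J k ℓ * blk₂ E x = J k ℓ
  sym : ∀ x ∈ Ω, dSpec E x * (E x 0)⁻¹
    = cplx (Matrix.fromBlocks 0 (Ξ x) (-(J k ℓ * (Ξ x)ᵀ)) 0)

/-- The inverse of an element of `O(k-ℓ,ℓ)`. -/
theorem inv_of_orth₂ {g : Matrix (Fin k) (Fin k) ℝ} (h : gᵀ * J k ℓ * g = J k ℓ) :
    g⁻¹ = J k ℓ * gᵀ * J k ℓ := by
  refine Matrix.inv_eq_left_inv ?_
  rw [Matrix.mul_assoc, Matrix.mul_assoc, ← Matrix.mul_assoc gᵀ, h, J_mul_J]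

theorem inv_mul_of_orth₂ {g : Matrix (Fin k) (Fin k) ℝ} (h : gᵀ * J k ℓ * g = J k ℓ) :
    g⁻¹ * g = 1 := by
  rw [inv_of_orth₂ h, Matrix.mul_assoc, Matrix.mul_assoc, ← Matrix.mul_assoc gᵀ, h, J_mul_J]

theorem inv_of_block {g₁ : Matrix (Fin (k + 1)) (Fin (k + 1)) ℝ} {g₂ : Matrix (Fin k) (Fin k) ℝ}
    (h₁ : g₁ᵀ * g₁ = 1) (h₂ : g₂ᵀ * J k ℓ * g₂ = J k ℓ) :
    (cplx (Matrix.fromBlocks g₁ 0 0 g₂))⁻¹ = cplx (Matrix.fromBlocks g₁ᵀ 0 0 g₂⁻¹) := by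
  refine Matrix.inv_eq_left_inv ?_
  rw [← cplx_mul, Matrix.fromBlocks_multiply]
  simp [h₁, inv_mul_of_orth₂ h₂, cplx_one]

namespace IsSymFrame

theorem mul_Q_transpose_Q (F : IsSymFrame ℓ Ω Λ ξ E Ξ) {x : Fin k → ℝ} (hx : x ∈ Ω) :
    E x 0 * (cplx (Q k ℓ) * (E x 0)ᵀ * cplx (Q k ℓ)) = 1 := by
  rw [mul_Q_transpose_Q_iff, F.block x hx, ← cplx_transpose, ← cplx_mul, ← cplx_mul, Q,
    Matrix.fromBlocks_transpose, Matrix.fromBlocks_multiply, Matrix.fromBlocks_multiply]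
  simp [F.orth₁ x hx, F.orth₂ x hx]

theorem inv_eq (F : IsSymFrame ℓ Ω Λ ξ E Ξ) {x : Fin k → ℝ} (hx : x ∈ Ω) :
    (E x 0)⁻¹ = cplx (Matrix.fromBlocks (blk₁ E x)ᵀ 0 0 (blk₂ E x)⁻¹) := by
  rw [F.block x hx, inv_of_block (F.orth₁ x hx) (F.orth₂ x hx)]

theorem hasPD_blk₁ (F : IsSymFrame ℓ Ω Λ ξ E Ξ) {x : Fin k → ℝ} (hx : x ∈ Ω) (j : Fin k) :
    HasPD j (blk₁ E) (blk₁ E x * ((ξ x)ᵀ * J k ℓ * (D j)ᵀ - D j * J k ℓ * ξ x)) x := by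
  have h := ((F.frame.hasPD F.isOpen F.zero_mem hx j).submatrix Sum.inl Sum.inl).map
    Complex.reCLM
  rw [lax, zero_smul, zero_add, F.block x hx, ← cplx_mul, a, lie_pMat,
    Matrix.fromBlocks_multiply] at h
  convert h using 1
  · rfl
  · ext
    simp [cplx]

theorem isSmoothOn_blk₁ (F : IsSymFrame ℓ Ω Λ ξ E Ξ) : IsSmoothOn (blk₁ E) Ω := fun b c =>
  Complex.reCLM.contDiff.comp_contDiffOn (F.frame.isSmoothOn F.zero_mem (Sum.inl b) (Sum.inl c))

theorem isSmoothOn_blk₂ (F : IsSymFrame ℓ Ω Λ ξ E Ξ) : IsSmoothOn (blk₂ E) Ω := fun b c =>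
  Complex.reCLM.contDiff.comp_contDiffOn (F.frame.isSmoothOn F.zero_mem (Sum.inr b) (Sum.inr c))

theorem eq_re (F : IsSymFrame ℓ Ω Λ ξ E Ξ) {x : Fin k → ℝ} (hx : x ∈ Ω) :
    Ξ x = ((dDir E 1 x * (E x 0)⁻¹).submatrix Sum.inl Sum.inr).map Complex.re := by
  rw [dDir_one_eq F.frame F.isOpen F.isOpen_spec F.zero_mem hx (F.diff x hx), F.sym x hx]
  ext
  simp [cplx]

/-- The partial derivatives of `Ξ` are the upper right blocks of `E a_j E⁻¹`. -/
theorem hasPD_sym (F : IsSymFrame ℓ Ω Λ ξ E Ξ) {x : Fin k → ℝ} (hx : x ∈ Ω) (j : Fin k) :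
    HasPD j Ξ (-(blk₁ E x * D j * J k ℓ * (blk₂ E x)⁻¹)) x := by
  have h := ((hasPD_dDir_mul_inv F.frame F.isOpen F.isOpen_spec F.zero_mem
    (fun x hx => F.mul_Q_transpose_Q hx) 1 hx j).submatrix Sum.inl Sum.inr).map Complex.reCLM
  rw [F.inv_eq hx, F.block x hx, ← cplx_mul, ← cplx_mul, a, pMat, Matrix.fromBlocks_multiply,
    Matrix.fromBlocks_multiply] at h
  have h2 := h.congr F.isOpen hx (B := Ξ) fun y hy => F.eq_re hy
  convert h2 using 1
  ext
  simp [cplx, Matrix.mul_assoc]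

theorem isSmoothOn_sym (F : IsSymFrame ℓ Ω Λ ξ E Ξ) : IsSmoothOn Ξ Ω := fun b c =>
  (Complex.reCLM.contDiff.comp_contDiffOn (isSmoothOn_dDir_mul_inv F.frame F.isOpen F.isOpen_spec
    F.zero_mem (fun x hx => F.mul_Q_transpose_Q hx) 1 (Sum.inl b) (Sum.inr c))).congr
      fun x hx => by rw [F.eq_re hx]; rfl

end IsSymFrame

theorem pd_toLp_apply {N : ℕ} {f : (Fin k → ℝ) → EuclideanSpace ℝ (Fin N)} {x : Fin k → ℝ}
    (hf : ∀ r, DifferentiableAt ℝ (fun y => f y r) x) (j : Fin k) (r : Fin N) :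
    pd j f x r = pd j (fun y => f y r) x := by
  have h := (EuclideanSpace.proj (𝕜 := ℝ) r).hasFDerivAt.comp x
    (differentiableAt_euclidean.mpr hf).hasFDerivAt
  rw [pd, pd]
  erw [h.fderiv]
  rfl

theorem isSmoothOn_col {N m : ℕ} {Y : (Fin k → ℝ) → Matrix (Fin N) (Fin m) ℝ}
    {U : Set (Fin k → ℝ)} (hY : IsSmoothOn Y U) (i : Fin m) : ContDiffOn ℝ ∞ (col Y i) U :=
  contDiffOn_euclidean.mpr fun r => hY r i

theorem HasPD.pd_col {N m : ℕ} {Y : (Fin k → ℝ) → Matrix (Fin N) (Fin m) ℝ}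
    {Y' : Matrix (Fin N) (Fin m) ℝ} {x : Fin k → ℝ} {j : Fin k} (hY : HasPD j Y Y' x) (i : Fin m) :
    pd j (col Y i) x = WithLp.toLp 2 fun r => Y' r i := by
  ext r
  rw [pd_toLp_apply (fun r => (hY r i).1)]
  exact (hY r i).2

theorem mul_D_mul_apply {α β : Type*} (A : Matrix α (Fin (k + 1)) ℝ) (B : Matrix (Fin k) β ℝ)
    (j : Fin k) (r : α) (m : β) : (A * D j * B) r m = A r j.castSucc * B j m := by
  rw [Matrix.mul_assoc, D]
  simp only [Matrix.mul_apply, Matrix.single_apply, Finset.mul_sum]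
  rw [Finset.sum_eq_single j.castSucc, Finset.sum_eq_single j]
  · simp
  · intro i _ hi
    simp [hi.symm]
  · simp
  · intro i _ hi
    simp [hi.symm]
  · simp

namespace IsSymFrame

/-- The coefficients `b_j = -ε_j (g₂⁻¹ c)_j` of the derivatives `∂_j(Ξ c) = b_j e_j`. -/
noncomputable def coeff (ℓ : ℕ) (E : (Fin k → ℝ) → ℂ → Matrix (Idx k) (Idx k) ℂ) (c : Fin k → ℝ)
    (x : Fin k → ℝ) (j : Fin k) : ℝ := -(eps k ℓ j * ((blk₂ E x)⁻¹ *ᵥ c) j)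

theorem orthonormal_col (F : IsSymFrame ℓ Ω Λ ξ E Ξ) {x : Fin k → ℝ} (hx : x ∈ Ω) :
    Orthonormal ℝ fun m => col (blk₁ E) m x := by
  rw [orthonormal_iff_ite]
  intro m m'
  have h := congrFun (congrFun (F.orth₁ x hx) m) m'
  rw [Matrix.mul_apply, Matrix.one_apply] at h
  rw [← h, PiLp.inner_apply]
  exact Finset.sum_congr rfl fun r _ => mul_comm _ _

theorem pd_mulVec (F : IsSymFrame ℓ Ω Λ ξ E Ξ) (c : Fin k → ℝ) {x : Fin k → ℝ} (hx : x ∈ Ω)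
    (j : Fin k) : pd j (fun x => WithLp.toLp 2 (Ξ x *ᵥ c)) x
      = coeff ℓ E c x j • col (blk₁ E) j.castSucc x := by
  have h := ((F.hasPD_sym hx j).mul_const (Matrix.replicateCol (Fin 1) c)).pd_col 0
  refine Eq.trans ?_ (h.trans ?_)
  · rfl
  · ext r
    simp only [Matrix.neg_mul, Matrix.mul_assoc, Matrix.neg_apply]
    rw [← Matrix.mul_assoc, mul_D_mul_apply, J, Matrix.diagonal_mul,
      ← Matrix.replicateCol_mulVec, Matrix.replicateCol_apply]
    simp only [coeff, PiLp.smul_apply, smul_eq_mul, col]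
    ring

theorem isSmoothOn_inv_blk₂ (F : IsSymFrame ℓ Ω Λ ξ E Ξ) :
    IsSmoothOn (fun x => (blk₂ E x)⁻¹) Ω := by
  have h := ((isSmoothOn_const (J k ℓ)).mul F.isSmoothOn_blk₂.transpose).mul
    (isSmoothOn_const (J k ℓ))
  intro b c
  exact (h b c).congr fun x hx => by simp only [inv_of_orth₂ (F.orth₂ x hx)]

/-- The hypersurface `Ξ c` is principally framed by the columns of `g₁`. -/
theorem isPrincipalFrame (F : IsSymFrame ℓ Ω Λ ξ E Ξ) (c : Fin k → ℝ) {U : Set (Fin k → ℝ)}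
    (hU : U ⊆ Ω)
    (hinj : ∀ x ∈ U, Function.Injective (fderiv ℝ (fun x => WithLp.toLp 2 (Ξ x *ᵥ c)) x)) :
    IsPrincipalFrame U (fun x => WithLp.toLp 2 (Ξ x *ᵥ c)) (fun x m => col (blk₁ E) m x)
      (coeff ℓ E c) (fun x j m => eps k ℓ j * ξ x j m) where
  smooth := by
    refine ContDiffOn.mono ?_ hU
    exact isSmoothOn_col (F.isSmoothOn_sym.mul
      (isSmoothOn_const (Matrix.replicateCol (Fin 1) c))) 0
  smooth_frame m := (isSmoothOn_col F.isSmoothOn_blk₁ m).mono hU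
  smooth_coeff j := by
    have h := F.isSmoothOn_inv_blk₂.mul (isSmoothOn_const (Matrix.replicateCol (Fin 1) c))
    exact ((contDiffOn_const.mul (h j 0)).neg).mono hU
  smooth_rot j m := (contDiffOn_const.mul (F.smooth j m)).mono hU
  orthonormal x hx := F.orthonormal_col (hU hx)
  pd_eq x hx j := F.pd_mulVec c (hU hx) j
  pd_frame x hx j m hm := by
    refine ((F.hasPD_blk₁ (hU hx) j).pd_col m).trans ?_
    ext r
    have h1 : (blk₁ E x * ((ξ x)ᵀ * J k ℓ * (D j)ᵀ)) r m = 0 := by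
      rw [← Matrix.mul_assoc, Matrix.mul_apply]
      refine Finset.sum_eq_zero fun i _ => ?_
      simp [D, hm.symm]
    have h2 : (blk₁ E x * (D j * J k ℓ * ξ x)) r m
        = blk₁ E x r j.castSucc * (eps k ℓ j * ξ x j m) := by
      rw [Matrix.mul_assoc, ← Matrix.mul_assoc, mul_D_mul_apply, J, Matrix.diagonal_mul]
    simp only [Matrix.mul_sub, Matrix.sub_apply, h1, h2, col, PiLp.smul_apply, smul_eq_mul]
    ring
  coeff_ne x hx j h0 := by
    have h1 := F.pd_mulVec c (hU hx) j
    rw [h0, zero_smul] at h1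
    have h2 := (injective_iff_map_eq_zero _).mp (hinj x hx) _ h1
    simpa using congrFun h2 j

/-- The first fundamental form of `Ξ c` has constant `J`-trace, since `g₂ ∈ O(k-ℓ,ℓ)`. -/
theorem sum_coeff_sq (F : IsSymFrame ℓ Ω Λ ξ E Ξ) (c : Fin k → ℝ) {x : Fin k → ℝ} (hx : x ∈ Ω) :
    ∑ j, eps k ℓ j * coeff ℓ E c x j ^ 2 = c ⬝ᵥ (J k ℓ *ᵥ c) := by
  set g := blk₂ E x
  have h1 : (g⁻¹)ᵀ * J k ℓ * g⁻¹ = J k ℓ := by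
    have h2 := inv_mul_of_orth₂ (F.orth₂ x hx)
    have h3 : g * g⁻¹ = 1 := mul_eq_one_comm.mp h2
    calc (g⁻¹)ᵀ * J k ℓ * g⁻¹ = (g⁻¹)ᵀ * (gᵀ * J k ℓ * g) * g⁻¹ := by rw [F.orth₂ x hx]
      _ = (g * g⁻¹)ᵀ * J k ℓ * (g * g⁻¹) := by
        rw [Matrix.transpose_mul]; simp only [Matrix.mul_assoc]
      _ = J k ℓ := by rw [h3]; simp
  conv_rhs => rw [← h1]
  rw [← Matrix.mulVec_mulVec, ← Matrix.mulVec_mulVec, Matrix.dotProduct_mulVec,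
    Matrix.vecMul_transpose, dotProduct]
  refine Finset.sum_congr rfl fun j _ => ?_
  rw [J, Matrix.mulVec_diagonal, coeff]
  linear_combination eps k ℓ j * (g⁻¹ *ᵥ c) j ^ 2 * eps_mul_self ℓ j

/-- The columns of `Ξ C` form a `k`-tuple. -/
theorem isKTuple (F : IsSymFrame ℓ Ω Λ ξ E Ξ) {C : Matrix (Fin k) (Fin k) ℝ} (hC : IsUnit C.det)
    {U : Set (Fin k → ℝ)} (hU : U ⊆ Ω) (hUo : IsOpen U)
    (hinj : ∀ i, ∀ x ∈ U, Function.Injective (fderiv ℝ (col (fun x => Ξ x * C) i) x)) :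
    IsKTuple ℓ (fun x => Ξ x * C) U := by
  refine IsPrincipalFrame.isKTuple (B := fun x => Matrix.of fun i => coeff ℓ E (C.col i) x)
    (fun i => F.isPrincipalFrame (C.col i) hU (hinj i)) hUo ℓ (fun x hx => ?_)
    (fun i => C.col i ⬝ᵥ (J k ℓ *ᵥ C.col i)) (fun x hx i => F.sum_coeff_sq (C.col i) (hU hx))
  have h1 : (Matrix.of fun i => coeff ℓ E (C.col i) x)
      = -((J k ℓ * ((blk₂ E x)⁻¹ * C))ᵀ) := by
    ext i j
    simp only [Matrix.of_apply, coeff, Matrix.neg_apply, Matrix.transpose_apply, J,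
      Matrix.diagonal_mul]
    rfl
  rw [h1, IsUnit.neg_iff, Matrix.isUnit_transpose]
  refine (IsUnit.of_mul_eq_one _ (J_mul_J ℓ)).mul
    (IsUnit.mul ?_ ((Matrix.isUnit_iff_isUnit_det _).mpr hC))
  exact IsUnit.of_mul_eq_one _ (inv_mul_of_orth₂ (F.orth₂ x (hU hx)))

end IsSymFrame

end SymFrames

section ParallelSym

variable {k ℓ : ℕ} {Ω : Set (Fin k → ℝ)}
  {ξ : (Fin k → ℝ) → Matrix (Fin k) (Fin (k + 1)) ℝ}
  {E : (Fin k → ℝ) → ℂ → Matrix (Idx k) (Idx k) ℂ} {x₀ : Fin k → ℝ}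

/-- Product rule for matrix valued functions of the spectral parameter. -/
theorem hasDerivAt_matrix_mul {α β γ : Type*} [Fintype β] {A : ℂ → Matrix α β ℂ}
    {B : ℂ → Matrix β γ ℂ} {A' : Matrix α β ℂ} {B' : Matrix β γ ℂ} {μ : ℂ}
    (hA : ∀ b c, HasDerivAt (fun μ => A μ b c) (A' b c) μ)
    (hB : ∀ b c, HasDerivAt (fun μ => B μ b c) (B' b c) μ) (b : α) (c : γ) :
    HasDerivAt (fun μ => (A μ * B μ) b c) ((A' * B μ + A μ * B') b c) μ := by
  have h := HasDerivAt.fun_sum (u := Finset.univ) fun i _ => (hA b i).mul (hB i c)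
  simp only [Matrix.add_apply, Matrix.mul_apply]
  rw [← Finset.sum_add_distrib]
  exact h

theorem dSpec_hasDerivAt {x : Fin k → ℝ}
    (h : ∀ b c, DifferentiableAt ℂ (fun μ => E x μ b c) 0) (b c : Idx k) :
    HasDerivAt (fun μ => E x μ b c) (dSpec E x b c) 0 := (h b c).hasDerivAt

theorem matrix_eq_zero_of_eq_neg {α β : Type*} {A : Matrix α β ℝ} (h : A = -A) : A = 0 := by
  ext b c
  have h1 := congrFun (congrFun h b) c
  rw [Matrix.neg_apply] at h1
  rw [Matrix.zero_apply]
  linarith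

/-- A real matrix commuting with the involution is block diagonal. -/
theorem eq_fromBlocks_of_S_comm {R : Matrix (Idx k) (Idx k) ℝ} (h : S k * R * S k = R) :
    R = Matrix.fromBlocks R.toBlocks₁₁ 0 0 R.toBlocks₂₂ := by
  rw [← Matrix.fromBlocks_toBlocks R] at h ⊢
  simp only [S, Matrix.fromBlocks_multiply] at h
  simp only [Matrix.fromBlocks_inj] at h ⊢
  obtain ⟨-, h12, h21, -⟩ := h
  simp only [Matrix.toBlocks_fromBlocks₁₁, Matrix.toBlocks_fromBlocks₂₂, true_and, and_true]
  constructor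
  · have h3 : -R.toBlocks₁₂ = R.toBlocks₁₂ := by simpa using h12
    exact matrix_eq_zero_of_eq_neg h3.symm
  · have h3 : -R.toBlocks₂₁ = R.toBlocks₂₁ := by simpa using h21
    exact matrix_eq_zero_of_eq_neg h3.symm

/-- The intersection of the orthogonal Lie algebra of `Q` with the `-1`-eigenspace of the
involution. -/
theorem eq_fromBlocks_of_S_anticomm {R : Matrix (Idx k) (Idx k) ℝ} (h : S k * R * S k = -R)
    (hQ : Rᵀ * Q k ℓ = -(Q k ℓ * R)) :
    R = Matrix.fromBlocks 0 R.toBlocks₁₂ (-(J k ℓ * (R.toBlocks₁₂)ᵀ)) 0 := by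
  rw [← Matrix.fromBlocks_toBlocks R] at h hQ ⊢
  simp only [S, Q, Matrix.fromBlocks_multiply, Matrix.fromBlocks_transpose,
    Matrix.fromBlocks_neg] at h hQ
  simp only [Matrix.fromBlocks_inj] at h hQ ⊢
  obtain ⟨h11, -, -, h22⟩ := h
  obtain ⟨-, -, q21, -⟩ := hQ
  simp only [Matrix.toBlocks_fromBlocks₁₂, true_and]
  refine ⟨?_, ?_, ?_⟩
  · have h3 : R.toBlocks₁₁ = -R.toBlocks₁₁ := by simpa using h11
    exact matrix_eq_zero_of_eq_neg h3
  · have h3 : R.toBlocks₁₂ᵀ = -(J k ℓ * R.toBlocks₂₁) := by simpa using q21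
    rw [h3, Matrix.mul_neg, ← Matrix.mul_assoc, J_mul_J, Matrix.one_mul, neg_neg]
  · have h3 : R.toBlocks₂₂ = -R.toBlocks₂₂ := by simpa using h22
    exact matrix_eq_zero_of_eq_neg h3

/-- The Sym-type derivative `Ξ` of a frame: the upper right block of `(∂_μ E) E⁻¹` at `μ = 0`. -/
noncomputable def symBlock (E : (Fin k → ℝ) → ℂ → Matrix (Idx k) (Idx k) ℂ) (x : Fin k → ℝ) :
    Matrix (Fin (k + 1)) (Fin k) ℝ :=
  ((dSpec E x * (E x 0)⁻¹).map Complex.re).toBlocks₁₂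

/-- The symmetries of a parallel frame under transposition, conjugation and the involution,
evaluated and differentiated at `μ = 0`. -/
theorem IsParallelFrame.isSymFrame (hE : IsParallelFrame ℓ Ω x₀ ξ E) (hξ : IsSmoothOn ξ Ω)
    (hΩ : IsOpen Ω) (hΩc : IsPreconnected Ω) (hx₀ : x₀ ∈ Ω) :
    IsSymFrame ℓ Ω Set.univ ξ E (symBlock E) := by
  have hdiff : ∀ x ∈ Ω, ∀ b c, DifferentiableAt ℂ (fun μ => E x μ b c) 0 :=
    fun x hx b c => hE.differentiableAt hΩ hΩc hx₀ hx b c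
  have hblock : ∀ x ∈ Ω, E x 0 = cplx (Matrix.fromBlocks (blk₁ E x) 0 0 (blk₂ E x)) := by
    intro x hx
    have h1 := hE.conj_eq hΩ hΩc hx₀ hx 0
    rw [map_zero] at h1
    have h2 := hE.sigma_eq hΩ hΩc hx₀ hx 0
    rw [neg_zero, eq_cplx_of_conj_eq h1, ← cplx_mul, ← cplx_mul] at h2
    conv_lhs => rw [eq_cplx_of_conj_eq h1, eq_fromBlocks_of_S_comm (cplx_injective h2)]
    rfl
  have horth : ∀ x ∈ Ω, (Matrix.fromBlocks (blk₁ E x) 0 0 (blk₂ E x))ᵀ * Q k ℓ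
      * Matrix.fromBlocks (blk₁ E x) 0 0 (blk₂ E x) = Q k ℓ := by
    intro x hx
    have h1 := mul_Q_transpose_Q_iff.mp (hE.mul_Q_transpose_Q hΩ hΩc hx₀ hx 0)
    rw [hblock x hx, ← cplx_transpose, ← cplx_mul, ← cplx_mul] at h1
    exact cplx_injective h1
  simp only [Q, Matrix.fromBlocks_transpose, Matrix.fromBlocks_multiply, Matrix.fromBlocks_inj]
    at horth
  refine ⟨hΩ, isOpen_univ, Set.mem_univ 0, hξ, hE.1, hdiff, hblock,
    fun x hx => by simpa using (horth x hx).1, fun x hx => by simpa using (horth x hx).2.2.2,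
    fun x hx => ?_⟩
  have hQ := hE.mul_Q_transpose_Q hΩ hΩc hx₀ hx 0
  have hinv := inv_eq_Q_transpose_Q hQ
  have hd := dSpec_hasDerivAt (hdiff x hx)
  have hc0 : (E x 0).map (starRingEnd ℂ) = E x 0 := by
    simpa using hE.conj_eq hΩ hΩc hx₀ hx 0
  have hs0 : cplx (S k) * E x 0 * cplx (S k) = E x 0 := by
    simpa using hE.sigma_eq hΩ hΩc hx₀ hx 0
  have hc : (dSpec E x).map (starRingEnd ℂ) = dSpec E x := by
    ext b c
    have h1 := (hd b c)
    rw [← map_zero (starRingEnd ℂ)] at h1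
    have h2 := h1.conj_conj
    rw [map_zero, map_zero] at h2
    have h3 : HasDerivAt (fun μ => E x μ b c) (starRingEnd ℂ (dSpec E x b c)) 0 :=
      h2.congr_of_eventuallyEq (Filter.Eventually.of_forall fun μ =>
        (congrFun (congrFun (hE.conj_eq hΩ hΩc hx₀ hx μ) b) c).symm)
    exact h3.unique (hd b c)
  have hneg : ∀ b c, HasDerivAt (fun μ => E x (-μ) b c) ((-dSpec E x) b c) 0 := fun b c => by
    have h1 := hd b c
    rw [← neg_zero] at h1
    exact (h1.comp (0 : ℂ) (hasDerivAt_neg (0 : ℂ))).congr_deriv (by simp)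
  have hs : cplx (S k) * dSpec E x * cplx (S k) = -dSpec E x := by
    have h1 := hasDerivAt_matrix_mul (hasDerivAt_matrix_mul
      (A := fun _ => cplx (S k)) (A' := 0) (fun b c => hasDerivAt_const _ _) hneg)
      (B := fun _ => cplx (S k)) (B' := 0) (fun b c => hasDerivAt_const _ _)
    have h2 : dSpec E x = (0 * E x (-0) + cplx (S k) * -dSpec E x) * cplx (S k)
        + cplx (S k) * E x (-0) * 0 := by
      ext b c
      have h2 := h1 b c
      simp only [hE.sigma_eq hΩ hΩc hx₀ hx] at h2
      exact (hd b c).unique h2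
    rw [← neg_eq_iff_eq_neg]
    conv_rhs => rw [h2]
    simp
  have hq : (dSpec E x)ᵀ * cplx (Q k ℓ) * E x 0 = -((E x 0)ᵀ * cplx (Q k ℓ) * dSpec E x) := by
    have h1 := hasDerivAt_matrix_mul (hasDerivAt_matrix_mul
      (A := fun μ => (E x μ)ᵀ) (A' := (dSpec E x)ᵀ) (fun b c => hd c b)
      (B := fun _ => cplx (Q k ℓ)) (B' := 0) (fun b c => hasDerivAt_const _ _)) hd
    rw [← add_eq_zero_iff_eq_neg]
    ext b c
    have h2 := h1 b c
    simp only [mul_Q_transpose_Q_iff.mp (hE.mul_Q_transpose_Q hΩ hΩc hx₀ hx _)] at h2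
    have h3 := h2.unique (hasDerivAt_const _ _)
    simpa using h3
  -- transfer of the three symmetries to `(∂_μ E) E⁻¹`
  set M := dSpec E x * (E x 0)⁻¹ with hM
  have hEi : E x 0 * (E x 0)⁻¹ = 1 := by rw [hinv]; exact hQ
  have hiE : (E x 0)⁻¹ * E x 0 = 1 := mul_eq_one_comm.mp hEi
  have hdM : dSpec E x = M * E x 0 := by rw [hM, Matrix.mul_assoc, hiE, Matrix.mul_one]
  have hMc : M.map (starRingEnd ℂ) = M := by
    rw [hM, conj_mul, hc, hinv, conj_mul, conj_mul, cplx_conj, Matrix.transpose_map, hc0]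
  have hMs : cplx (S k) * M * cplx (S k) = -M := by
    have h1 : cplx (S k) * M * cplx (S k) * E x 0 = -M * E x 0 := by
      calc cplx (S k) * M * cplx (S k) * E x 0
          = cplx (S k) * M * cplx (S k) * (cplx (S k) * E x 0 * cplx (S k)) := by rw [hs0]
        _ = cplx (S k) * M * (cplx (S k) * cplx (S k)) * E x 0 * cplx (S k) := by
          simp only [Matrix.mul_assoc]
        _ = cplx (S k) * dSpec E x * cplx (S k) := by
          rw [cS_mul_cS, Matrix.mul_one, hdM]; simp only [Matrix.mul_assoc]
        _ = -M * E x 0 := by rw [hs, hdM, Matrix.neg_mul]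
    have h2 := congrArg (· * (E x 0)⁻¹) h1
    simpa only [Matrix.mul_assoc, hEi, Matrix.mul_one] using h2
  have hMq : Mᵀ * cplx (Q k ℓ) = -(cplx (Q k ℓ) * M) := by
    rw [hdM, Matrix.transpose_mul] at hq
    have h1 := congrArg (fun A => ((E x 0)⁻¹)ᵀ * A * (E x 0)⁻¹) hq
    have h2 : ((E x 0)⁻¹)ᵀ * (E x 0)ᵀ = 1 := by
      rw [← Matrix.transpose_mul, hEi, Matrix.transpose_one]
    simp only [Matrix.mul_assoc, hEi, Matrix.mul_one, Matrix.mul_neg, Matrix.neg_mul] at h1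
    simpa only [← Matrix.mul_assoc, h2, Matrix.one_mul] using h1
  have hMr := eq_cplx_of_conj_eq hMc
  rw [hMr, ← cplx_mul, ← cplx_mul, ← cplx_neg] at hMs
  rw [hMr, ← cplx_transpose, ← cplx_mul, ← cplx_mul, ← cplx_neg] at hMq
  conv_lhs => rw [hMr]
  exact congrArg cplx (eq_fromBlocks_of_S_anticomm (cplx_injective hMs) (cplx_injective hMq))

end ParallelSym

/-! ### Simple elements -/

section SimpleElements

variable {k : ℕ} (ℓ : ℕ)

/-- The rank one matrix `u u^* Q`. -/
noncomputable def rankOne (u : Idx k → ℂ) : Matrix (Idx k) (Idx k) ℂ :=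
  Matrix.vecMulVec u (star u) * cplx (Q k ℓ)

theorem rankOne_smul (t : ℂ) (u : Idx k → ℂ) :
    rankOne ℓ (t • u) = (t * starRingEnd ℂ t) • rankOne ℓ u := by
  rw [rankOne, star_smul, Matrix.smul_vecMulVec, Matrix.vecMulVec_smul, smul_smul,
    Matrix.smul_mul]
  rfl

theorem vecMulVec_mul_mul_vecMulVec {α : Type*} [Fintype α] (u v u' v' : α → ℂ)
    (A : Matrix α α ℂ) : Matrix.vecMulVec u v * A * Matrix.vecMulVec u' v'
      = (v ⬝ᵥ (A *ᵥ u')) • Matrix.vecMulVec u v' := by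
  rw [Matrix.vecMulVec_mul, Matrix.vecMulVec_mul_vecMulVec, Matrix.dotProduct_mulVec]
  ext
  simp [Matrix.vecMulVec_apply]
  ring

theorem rankOne_conj (u : Idx k → ℂ) : (rankOne ℓ u).map (starRingEnd ℂ)
    = Matrix.vecMulVec (star u) u * cplx (Q k ℓ) := by
  rw [rankOne, conj_mul, cplx_conj]
  congr 1
  ext
  simp [Matrix.vecMulVec_apply]

theorem rankOne_mul_mul_rankOne (u : Idx k → ℂ) (A : Matrix (Idx k) (Idx k) ℂ) :
    rankOne ℓ u * A * rankOne ℓ u = (A * rankOne ℓ u).trace • rankOne ℓ u := by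
  have h : (A * rankOne ℓ u).trace = star u ⬝ᵥ ((cplx (Q k ℓ) * A) *ᵥ u) := by
    rw [rankOne, ← Matrix.mul_assoc, Matrix.trace_mul_comm, ← Matrix.mul_assoc,
      Matrix.mul_vecMulVec, Matrix.trace_vecMulVec, dotProduct_comm]
  rw [h, rankOne, Matrix.mul_assoc _ _ A, ← Matrix.mul_assoc _ _ (cplx (Q k ℓ)),
    vecMulVec_mul_mul_vecMulVec, Matrix.smul_mul]

theorem dotProduct_mulVec_self_eq_zero {α : Type*} [Fintype α] {B : Matrix α α ℂ} (hB : Bᵀ = -B)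
    (u : α → ℂ) : u ⬝ᵥ (B *ᵥ u) = 0 := by
  have h : u ⬝ᵥ (B *ᵥ u) = -(u ⬝ᵥ (B *ᵥ u)) := by
    conv_lhs => rw [Matrix.dotProduct_mulVec, ← Matrix.mulVec_transpose, hB, Matrix.neg_mulVec,
      neg_dotProduct, dotProduct_comm]
  exact self_eq_neg.mp h

/-- If `A` lies in the orthogonal Lie algebra of `Q`, then `ū u^t Q A u u^* Q = 0`. -/
theorem conj_rankOne_mul_mul_rankOne (u : Idx k → ℂ) {A : Matrix (Idx k) (Idx k) ℂ}
    (hA : Aᵀ * cplx (Q k ℓ) = -(cplx (Q k ℓ) * A)) :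
    (rankOne ℓ u).map (starRingEnd ℂ) * A * rankOne ℓ u = 0 := by
  rw [rankOne_conj, rankOne, Matrix.mul_assoc _ _ A, ← Matrix.mul_assoc _ _ (cplx (Q k ℓ)),
    vecMulVec_mul_mul_vecMulVec, dotProduct_mulVec_self_eq_zero, zero_smul, Matrix.zero_mul]
  rw [Matrix.transpose_mul, cQ_transpose, hA]

theorem cQ_mulVec_vec (W : Fin (k + 1) → ℝ) (Z : Fin k → ℝ) :
    cplx (Q k ℓ) *ᵥ vec W Z = vec W (J k ℓ *ᵥ Z) := by
  have h : cplx (Q k ℓ) = Matrix.diagonal (Sum.elim (fun _ => 1) fun j => (eps k ℓ j : ℂ)) := by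
    ext (b | b) (c | c)
    · simp [cplx, Q, Matrix.one_apply, Matrix.diagonal_apply, apply_ite]
    · simp [cplx, Q]
    · simp [cplx, Q]
    · by_cases h : b = c <;> simp [cplx, Q, J, h]
  rw [h]
  ext (b | b)
  · simp [vec, Matrix.mulVec_diagonal]
  · simp only [vec, Matrix.mulVec_diagonal, Sum.elim_inr, J, Complex.ofReal_mul]
    ring

theorem vec_dotProduct_vec (W W' : Fin (k + 1) → ℝ) (Z Z' : Fin k → ℝ) :
    vec W Z ⬝ᵥ vec W' Z' = ((W ⬝ᵥ W' - Z ⬝ᵥ Z' : ℝ) : ℂ) := by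
  simp only [dotProduct, Fintype.sum_sum_type, vec, Sum.elim_inl, Sum.elim_inr]
  push_cast
  rw [sub_eq_add_neg, ← Finset.sum_neg_distrib]
  congr 1
  refine Finset.sum_congr rfl fun i _ => ?_
  linear_combination (Z i * Z' i : ℂ) * Complex.I_mul_I

theorem star_vec (W : Fin (k + 1) → ℝ) (Z : Fin k → ℝ) : star (vec W Z) = vec W (-Z) := by
  ext (b | b) <;> simp [vec]

theorem proj_eq_rankOne (W : Fin (k + 1) → ℝ) (Z : Fin k → ℝ) :
    proj ℓ W Z = (1 / 2 : ℂ) • rankOne ℓ (vec W Z) := rfl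

theorem proj_conj (W : Fin (k + 1) → ℝ) (Z : Fin k → ℝ) : (proj ℓ W Z).map (starRingEnd ℂ)
    = (1 / 2 : ℂ) • (rankOne ℓ (vec W Z)).map (starRingEnd ℂ) := by
  have h2 : starRingEnd ℂ 2 = 2 := Complex.conj_ofNat 2
  rw [proj_eq_rankOne]
  ext
  simp [h2]

theorem trace_rankOne_vec (W : Fin (k + 1) → ℝ) (Z : Fin k → ℝ) :
    (rankOne ℓ (vec W Z)).trace = ((W ⬝ᵥ W + Z ⬝ᵥ (J k ℓ *ᵥ Z) : ℝ) : ℂ) := by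
  rw [rankOne, Matrix.trace_mul_comm, Matrix.mul_vecMulVec, Matrix.trace_vecMulVec,
    cQ_mulVec_vec, star_vec, vec_dotProduct_vec, dotProduct_neg, sub_neg_eq_add,
    dotProduct_comm (J k ℓ *ᵥ Z)]

theorem rankOne_mul_self_vec (W : Fin (k + 1) → ℝ) (Z : Fin k → ℝ) :
    rankOne ℓ (vec W Z) * rankOne ℓ (vec W Z)
      = ((W ⬝ᵥ W + Z ⬝ᵥ (J k ℓ *ᵥ Z) : ℝ) : ℂ) • rankOne ℓ (vec W Z) := by
  have h := rankOne_mul_mul_rankOne ℓ (vec W Z) 1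
  rwa [Matrix.mul_one, Matrix.one_mul, trace_rankOne_vec] at h

/-- `proj` as a block matrix. -/
theorem proj_apply (W : Fin (k + 1) → ℝ) (Z : Fin k → ℝ) : proj ℓ W Z = (1 / 2 : ℂ) •
    (cplx (Matrix.fromBlocks (Matrix.vecMulVec W W) 0 0 (Matrix.vecMulVec Z Z * J k ℓ))
      + Complex.I • cplx (pMat ℓ (Matrix.vecMulVec Z W))) := by
  rw [proj_eq_rankOne, rankOne, Matrix.vecMulVec_mul, ← Matrix.mulVec_transpose, cQ_transpose,
    star_vec, cQ_mulVec_vec]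
  congr 1
  have hI : Complex.I ^ 2 = -1 := Complex.I_sq
  ext (b | b) (c | c) <;>
    simp only [Matrix.vecMulVec_apply, cplx, pMat, vec, J, Matrix.mul_diagonal,
      Matrix.mulVec_diagonal, Matrix.add_apply, Matrix.smul_apply, Matrix.map_apply,
      Matrix.fromBlocks_apply₁₁, Matrix.fromBlocks_apply₁₂, Matrix.fromBlocks_apply₂₁,
      Matrix.fromBlocks_apply₂₂, Sum.elim_inl, Sum.elim_inr, Matrix.zero_apply, Matrix.neg_apply,
      Matrix.transpose_apply, Pi.neg_apply, smul_eq_mul] <;> push_cast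
  · ring
  · ring
  · ring
  · linear_combination (-(Z b * (eps k ℓ c * Z c)) : ℂ) * hI

theorem proj_conj_apply (W : Fin (k + 1) → ℝ) (Z : Fin k → ℝ) :
    (proj ℓ W Z).map (starRingEnd ℂ) = (1 / 2 : ℂ) •
    (cplx (Matrix.fromBlocks (Matrix.vecMulVec W W) 0 0 (Matrix.vecMulVec Z Z * J k ℓ))
      - Complex.I • cplx (pMat ℓ (Matrix.vecMulVec Z W))) := by
  have h2 : starRingEnd ℂ 2 = 2 := Complex.conj_ofNat 2
  rw [proj_apply]
  ext
  simp [cplx, h2]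
  ring

theorem proj_sub_conj (W : Fin (k + 1) → ℝ) (Z : Fin k → ℝ) :
    proj ℓ W Z - (proj ℓ W Z).map (starRingEnd ℂ)
      = Complex.I • cplx (pMat ℓ (Matrix.vecMulVec Z W)) := by
  rw [proj_conj_apply, proj_apply]
  module

theorem proj_add_conj (W : Fin (k + 1) → ℝ) (Z : Fin k → ℝ) :
    proj ℓ W Z + (proj ℓ W Z).map (starRingEnd ℂ)
      = cplx (Matrix.fromBlocks (Matrix.vecMulVec W W) 0 0 (Matrix.vecMulVec Z Z * J k ℓ)) := by
  rw [proj_conj_apply, proj_apply]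
  module

variable {ℓ} {W : Fin (k + 1) → ℝ} {Z : Fin k → ℝ}

theorem conj_proj_mul_mul_proj {A : Matrix (Idx k) (Idx k) ℂ}
    (hA : Aᵀ * cplx (Q k ℓ) = -(cplx (Q k ℓ) * A)) :
    (proj ℓ W Z).map (starRingEnd ℂ) * A * proj ℓ W Z = 0 := by
  rw [proj_conj, proj_eq_rankOne, Matrix.mul_smul, Matrix.smul_mul, Matrix.smul_mul,
    conj_rankOne_mul_mul_rankOne ℓ _ hA, smul_zero, smul_zero]

theorem proj_mul_mul_conj_proj {A : Matrix (Idx k) (Idx k) ℝ}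
    (hA : Aᵀ * Q k ℓ = -(Q k ℓ * A)) :
    proj ℓ W Z * cplx A * (proj ℓ W Z).map (starRingEnd ℂ) = 0 := by
  have hA' : (cplx A)ᵀ * cplx (Q k ℓ) = -(cplx (Q k ℓ) * cplx A) := by
    rw [← cplx_transpose, ← cplx_mul, hA, cplx_neg, cplx_mul]
  have h := congrArg (fun B => B.map (starRingEnd ℂ)) (conj_proj_mul_mul_proj (W := W) (Z := Z) hA')
  simp only [conj_mul, conj_conj, cplx_conj] at h
  rw [h]
  ext
  simp

theorem proj_mul_self (hW : W ⬝ᵥ W = 1) (hZ : Z ⬝ᵥ (J k ℓ *ᵥ Z) = 1) :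
    proj ℓ W Z * proj ℓ W Z = proj ℓ W Z := by
  rw [proj_eq_rankOne, Matrix.mul_smul, Matrix.smul_mul, rankOne_mul_self_vec, hW, hZ]
  module

theorem conj_proj_mul_self (hW : W ⬝ᵥ W = 1) (hZ : Z ⬝ᵥ (J k ℓ *ᵥ Z) = 1) :
    (proj ℓ W Z).map (starRingEnd ℂ) * (proj ℓ W Z).map (starRingEnd ℂ)
      = (proj ℓ W Z).map (starRingEnd ℂ) := by
  rw [← conj_mul, proj_mul_self hW hZ]

theorem conj_proj_mul_proj (hW : W ⬝ᵥ W = 1) (hZ : Z ⬝ᵥ (J k ℓ *ᵥ Z) = 1) :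
    (proj ℓ W Z).map (starRingEnd ℂ) * proj ℓ W Z = 0 := by
  rw [proj_conj, proj_eq_rankOne, Matrix.mul_smul, Matrix.smul_mul, rankOne_conj, rankOne,
    ← Matrix.mul_assoc, vecMulVec_mul_mul_vecMulVec, cQ_mulVec_vec, vec_dotProduct_vec, hW, hZ]
  simp

theorem proj_mul_conj_proj (hW : W ⬝ᵥ W = 1) (hZ : Z ⬝ᵥ (J k ℓ *ᵥ Z) = 1) :
    proj ℓ W Z * (proj ℓ W Z).map (starRingEnd ℂ) = 0 := by
  have h := congrArg (fun B => B.map (starRingEnd ℂ)) (conj_proj_mul_proj (ℓ := ℓ) hW hZ)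
  simp only [conj_mul, conj_conj] at h
  rw [h]
  ext
  simp

/-- The coefficient of `π` in `p_{is,π}⁻¹ - 1`. -/
noncomputable def poleCoeff (s : ℝ) (μ : ℂ) : ℂ := 2 * (Complex.I * s) / (μ - Complex.I * s)

theorem poleCoeff_mul {s : ℝ} {μ : ℂ} (h : μ ≠ Complex.I * s) :
    poleCoeff s μ * (μ - Complex.I * s) = 2 * (Complex.I * s) :=
  div_mul_cancel₀ _ (sub_ne_zero.mpr h)

theorem poleCoeff_neg_mul {s : ℝ} {μ : ℂ} (h : μ ≠ -(Complex.I * s)) :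
    poleCoeff (-s) μ * (μ + Complex.I * s) = -(2 * (Complex.I * s)) := by
  have h1 : μ + Complex.I * s ≠ 0 := fun h0 => h (eq_neg_of_add_eq_zero_left h0)
  rw [poleCoeff]
  push_cast
  rw [mul_neg, sub_neg_eq_add, div_mul_cancel₀ _ h1]
  ring

theorem simpleElt_eq {s : ℝ} {μ : ℂ} (h1 : μ ≠ Complex.I * s) (h2 : μ ≠ -(Complex.I * s))
    (π : Matrix (Idx k) (Idx k) ℂ) : simpleElt s π μ
      = 1 + poleCoeff s μ • π.map (starRingEnd ℂ) + poleCoeff (-s) μ • π := by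
  have h3 : (μ + Complex.I * s) / (μ - Complex.I * s) = 1 + poleCoeff s μ := by
    have := sub_ne_zero.mpr h1
    rw [poleCoeff]
    field_simp
    ring
  have h4 : (μ - Complex.I * s) / (μ + Complex.I * s) = 1 + poleCoeff (-s) μ := by
    have h5 : μ + Complex.I * s ≠ 0 := fun h0 => h2 (eq_neg_of_add_eq_zero_left h0)
    rw [div_eq_iff h5]
    linear_combination -poleCoeff_neg_mul h2
  rw [simpleElt, h3, h4]
  module

theorem poleCoeff_relation {s : ℝ} {μ : ℂ} (h1 : μ ≠ Complex.I * s) (h2 : μ ≠ -(Complex.I * s)) :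
    poleCoeff s μ + poleCoeff (-s) μ + poleCoeff s μ * poleCoeff (-s) μ = 0 := by
  have h3 := sub_ne_zero.mpr h1
  have h5 : μ + Complex.I * s ≠ 0 := fun h0 => h2 (eq_neg_of_add_eq_zero_left h0)
  refine (mul_eq_zero.mp (?_ : _ * ((μ - Complex.I * s) * (μ + Complex.I * s)) = 0)).resolve_right
    (mul_ne_zero h3 h5)
  have e1 := poleCoeff_mul h1
  have e2 := poleCoeff_neg_mul h2
  linear_combination (μ + Complex.I * s + poleCoeff (-s) μ * (μ + Complex.I * s)) * e1
    + (μ - Complex.I * s + 2 * (Complex.I * s)) * e2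

/-- The inverse of a simple element is the simple element with the opposite pole. -/
theorem simpleElt_inv (hW : W ⬝ᵥ W = 1) (hZ : Z ⬝ᵥ (J k ℓ *ᵥ Z) = 1) {s : ℝ} {μ : ℂ}
    (h1 : μ ≠ Complex.I * s) (h2 : μ ≠ -(Complex.I * s)) : (simpleElt s (proj ℓ W Z) μ)⁻¹
      = 1 + poleCoeff (-s) μ • (proj ℓ W Z).map (starRingEnd ℂ) + poleCoeff s μ • proj ℓ W Z := by
  refine Matrix.inv_eq_right_inv ?_
  rw [simpleElt_eq h1 h2]
  have e := poleCoeff_relation h1 h2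
  simp only [Matrix.mul_add, Matrix.add_mul, Matrix.mul_one, Matrix.one_mul, Matrix.smul_mul,
    Matrix.mul_smul, proj_mul_self hW hZ, conj_proj_mul_self hW hZ, conj_proj_mul_proj hW hZ,
    proj_mul_conj_proj hW hZ, smul_zero, add_zero]
  linear_combination (norm := module) e • ((proj ℓ W Z).map (starRingEnd ℂ) + proj ℓ W Z)

end SimpleElements

/-! ### Dressing by a simple element -/

section Dressing

variable {k ℓ : ℕ} {Ω : Set (Fin k → ℝ)}
  {ξ : (Fin k → ℝ) → Matrix (Fin k) (Fin (k + 1)) ℝ}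
  {E : (Fin k → ℝ) → ℂ → Matrix (Idx k) (Idx k) ℂ} {s : ℝ} {W : Fin (k + 1) → ℝ} {Z : Fin k → ℝ}

/-- A frame of the Lax pair for all spectral parameters with the symmetries of a positive loop at
every point. -/
structure IsRealFrame (ℓ : ℕ) (Ω : Set (Fin k → ℝ))
    (ξ : (Fin k → ℝ) → Matrix (Fin k) (Fin (k + 1)) ℝ)
    (E : (Fin k → ℝ) → ℂ → Matrix (Idx k) (Idx k) ℂ) : Prop where
  isOpen : IsOpen Ω
  smooth : IsSmoothOn ξ Ω
  frame : IsFrameFor ℓ Ω Set.univ ξ E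
  orth : ∀ x ∈ Ω, ∀ μ, E x μ * (cplx (Q k ℓ) * (E x μ)ᵀ * cplx (Q k ℓ)) = 1
  conj : ∀ x ∈ Ω, ∀ μ, (E x (starRingEnd ℂ μ)).map (starRingEnd ℂ) = E x μ
  sigma : ∀ x ∈ Ω, ∀ μ, cplx (S k) * E x (-μ) * cplx (S k) = E x μ

theorem IsParallelFrame.isRealFrame {x₀ : Fin k → ℝ} (hE : IsParallelFrame ℓ Ω x₀ ξ E)
    (hξ : IsSmoothOn ξ Ω) (hΩ : IsOpen Ω) (hΩc : IsPreconnected Ω) (hx₀ : x₀ ∈ Ω) :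
    IsRealFrame ℓ Ω ξ E :=
  ⟨hΩ, hξ, hE.1, fun _ hx μ => hE.mul_Q_transpose_Q hΩ hΩc hx₀ hx μ,
    fun _ hx μ => hE.conj_eq hΩ hΩc hx₀ hx μ, fun _ hx μ => hE.sigma_eq hΩ hΩc hx₀ hx μ⟩

theorem cS_mulVec_apply (y : Idx k → ℂ) :
    cplx (S k) *ᵥ y = Sum.elim (fun b => y (Sum.inl b)) (fun b => -y (Sum.inr b)) := by
  have h : cplx (S k) = Matrix.diagonal (Sum.elim (fun _ => 1) fun _ => -1) := by
    ext (b | b) (c | c)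
    · by_cases h : b = c <;> simp [cplx, S, h]
    · simp [cplx, S]
    · simp [cplx, S]
    · by_cases h : b = c <;> simp [cplx, S, h]
  rw [h]
  ext (b | b) <;> simp [Matrix.mulVec_diagonal]

theorem vec_smul (t : ℝ) (W : Fin (k + 1) → ℝ) (Z : Fin k → ℝ) :
    vec (t • W) (t • Z) = (t : ℂ) • vec W Z := by
  ext (b | b)
  · simp [vec]
  · simp [vec]
    ring

theorem star_mulVec_eq {α β : Type*} [Fintype β] (A : Matrix α β ℂ) (u : β → ℂ) :
    star (A *ᵥ u) = A.map (starRingEnd ℂ) *ᵥ star u := by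
  ext b
  simp [Matrix.mulVec, dotProduct]

theorem conj_I_mul (s : ℝ) : starRingEnd ℂ (-(Complex.I * s)) = Complex.I * s := by
  simp

namespace IsRealFrame

theorem inv_eq (R : IsRealFrame ℓ Ω ξ E) {x : Fin k → ℝ} (hx : x ∈ Ω) (μ : ℂ) :
    (E x μ)⁻¹ = cplx (Q k ℓ) * (E x μ)ᵀ * cplx (Q k ℓ) := inv_eq_Q_transpose_Q (R.orth x hx μ)

theorem conj_frame (R : IsRealFrame ℓ Ω ξ E) {x : Fin k → ℝ} (hx : x ∈ Ω) (s : ℝ) :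
    (E x (Complex.I * s)).map (starRingEnd ℂ) = E x (-(Complex.I * s)) := by
  have h := R.conj x hx (-(Complex.I * s))
  rwa [conj_I_mul] at h

theorem conj_inv (R : IsRealFrame ℓ Ω ξ E) {x : Fin k → ℝ} (hx : x ∈ Ω) (s : ℝ) :
    ((E x (Complex.I * s))⁻¹).map (starRingEnd ℂ)
      = cplx (Q k ℓ) * (E x (-(Complex.I * s)))ᵀ * cplx (Q k ℓ) := by
  rw [R.inv_eq hx, conj_mul, conj_mul, cplx_conj, Matrix.transpose_map, R.conj_frame hx]

theorem conj_inv_eq_sigma (R : IsRealFrame ℓ Ω ξ E) {x : Fin k → ℝ} (hx : x ∈ Ω) (s : ℝ) :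
    ((E x (Complex.I * s))⁻¹).map (starRingEnd ℂ)
      = cplx (S k) * (E x (Complex.I * s))⁻¹ * cplx (S k) := by
  have h := R.sigma x hx (-(Complex.I * s))
  rw [neg_neg] at h
  have hS : (cplx (S k))ᵀ = cplx (S k) := by rw [← cplx_transpose, S_transpose]
  have hc := cS_mul_cQ (k := k) ℓ
  rw [R.conj_inv hx, ← h, R.inv_eq hx, Matrix.transpose_mul, Matrix.transpose_mul, hS]
  simp only [← Matrix.mul_assoc, hc]
  simp only [Matrix.mul_assoc, hc]

/-- The reality condition and the involution force `E(x, is)⁻¹ (W, iZ)` to be of the form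
`(W̃, iZ̃)`. -/
theorem inv_mulVec_vec (R : IsRealFrame ℓ Ω ξ E) {x : Fin k → ℝ} (hx : x ∈ Ω) :
    (E x (Complex.I * s))⁻¹ *ᵥ vec W Z = vec (tildeW E s W Z x) (tildeZ E s W Z x) := by
  have hw : cplx (S k) *ᵥ star (vec W Z) = vec W Z := by
    rw [star_vec, cS_mulVec_apply]
    ext (b | b) <;> simp [vec]
  set y := (E x (Complex.I * s))⁻¹ *ᵥ vec W Z with hy
  have h : star y = cplx (S k) *ᵥ y := by
    rw [hy, star_mulVec_eq, R.conj_inv_eq_sigma hx, Matrix.mul_assoc, ← Matrix.mulVec_mulVec,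
      ← Matrix.mulVec_mulVec, hw]
  rw [cS_mulVec_apply] at h
  ext (b | b)
  · have h1 := congrFun h (Sum.inl b)
    simp only [Pi.star_apply, Sum.elim_inl] at h1
    change _ = ((y (Sum.inl b)).re : ℂ)
    exact (Complex.conj_eq_iff_re.mp h1).symm
  · have h1 := congrFun h (Sum.inr b)
    simp only [Pi.star_apply, Sum.elim_inr] at h1
    change _ = Complex.I * ((y (Sum.inr b)).im : ℂ)
    have h2 := congrArg Complex.re h1
    have h3 : (y (Sum.inr b)).re = -(y (Sum.inr b)).re := h2
    apply Complex.ext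
    · simp only [Complex.mul_re, Complex.I_re, Complex.ofReal_re, Complex.I_im, Complex.ofReal_im]
      linarith
    · simp

/-- `E(x, is)⁻¹` preserves the complex bilinear form of `Q`, for which `(W, iZ)` is isotropic. -/
theorem tilde_norm (R : IsRealFrame ℓ Ω ξ E) (hW : W ⬝ᵥ W = 1)
    (hZ : Z ⬝ᵥ (J k ℓ *ᵥ Z) = 1) {x : Fin k → ℝ} (hx : x ∈ Ω) :
    tildeW E s W Z x ⬝ᵥ tildeW E s W Z x
      = tildeZ E s W Z x ⬝ᵥ (J k ℓ *ᵥ tildeZ E s W Z x) := by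
  have h1 : vec (tildeW E s W Z x) (tildeZ E s W Z x) ⬝ᵥ
      (cplx (Q k ℓ) *ᵥ vec (tildeW E s W Z x) (tildeZ E s W Z x)) = 0 := by
    have h2 : ((E x (Complex.I * s))⁻¹)ᵀ * cplx (Q k ℓ) * (E x (Complex.I * s))⁻¹
        = cplx (Q k ℓ) := by
      rw [R.inv_eq hx, Matrix.transpose_mul, Matrix.transpose_mul, Matrix.transpose_transpose,
        cQ_transpose]
      calc _ = cplx (Q k ℓ) * E x (Complex.I * s) * (cplx (Q k ℓ) * cplx (Q k ℓ))
            * cplx (Q k ℓ) * (E x (Complex.I * s))ᵀ * cplx (Q k ℓ) := by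
            simp only [Matrix.mul_assoc]
        _ = cplx (Q k ℓ) * (E x (Complex.I * s) * (cplx (Q k ℓ) * (E x (Complex.I * s))ᵀ
            * cplx (Q k ℓ))) := by
            rw [cQ_mul_cQ]; simp only [Matrix.mul_assoc, Matrix.one_mul]
        _ = cplx (Q k ℓ) := by rw [R.orth x hx, Matrix.mul_one]
    rw [← R.inv_mulVec_vec hx, Matrix.mulVec_mulVec, dotProduct_comm, Matrix.dotProduct_mulVec,
      ← Matrix.mulVec_transpose, dotProduct_comm, Matrix.mulVec_mulVec, ← Matrix.mul_assoc, h2,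
      cQ_mulVec_vec, vec_dotProduct_vec, hW, hZ]
    simp
  rw [cQ_mulVec_vec, vec_dotProduct_vec] at h1
  exact sub_eq_zero.mp (by exact_mod_cast h1)

theorem tilde_pos {x : Fin k → ℝ} (hx : x ∈ dressedDomain E s W Z Ω) :
    0 < tildeW E s W Z x ⬝ᵥ tildeW E s W Z x :=
  lt_of_le_of_ne (Finset.sum_nonneg fun _ _ => mul_self_nonneg _)
    fun h => hx.2 (dotProduct_self_eq_zero.mp h.symm)

theorem hatZ_eq (R : IsRealFrame ℓ Ω ξ E) (hW : W ⬝ᵥ W = 1)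
    (hZ : Z ⬝ᵥ (J k ℓ *ᵥ Z) = 1) {x : Fin k → ℝ} (hx : x ∈ Ω) : hatZ ℓ E s W Z x
      = (Real.sqrt (tildeW E s W Z x ⬝ᵥ tildeW E s W Z x))⁻¹ • tildeZ E s W Z x := by
  rw [hatZ, R.tilde_norm hW hZ hx]

theorem hatW_norm {x : Fin k → ℝ} (hx : x ∈ dressedDomain E s W Z Ω) :
    hatW E s W Z x ⬝ᵥ hatW E s W Z x = 1 := by
  have h := tilde_pos hx
  rw [hatW, smul_dotProduct, dotProduct_smul, smul_smul, ← mul_inv, Real.mul_self_sqrt h.le,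
    smul_eq_mul, inv_mul_cancel₀ h.ne']

theorem hatZ_norm (R : IsRealFrame ℓ Ω ξ E) (hW : W ⬝ᵥ W = 1)
    (hZ : Z ⬝ᵥ (J k ℓ *ᵥ Z) = 1) {x : Fin k → ℝ} (hx : x ∈ dressedDomain E s W Z Ω) :
    hatZ ℓ E s W Z x ⬝ᵥ (J k ℓ *ᵥ hatZ ℓ E s W Z x) = 1 := by
  have h := tilde_pos hx
  rw [R.hatZ_eq hW hZ hx.1, Matrix.mulVec_smul, smul_dotProduct, dotProduct_smul, smul_smul,
    ← mul_inv, Real.mul_self_sqrt h.le, ← R.tilde_norm hW hZ hx.1, smul_eq_mul,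
    inv_mul_cancel₀ h.ne']

end IsRealFrame

/-- The rank one matrix `E(x, is)⁻¹ w w^* Q E(x, -is)` for `w = (W, iZ)`, where the inverse is
expressed through `Q`, so that this is a product of smooth matrices. It is a multiple of `π̂`. -/
noncomputable def dressY (ℓ : ℕ) (E : (Fin k → ℝ) → ℂ → Matrix (Idx k) (Idx k) ℂ) (s : ℝ)
    (W : Fin (k + 1) → ℝ) (Z : Fin k → ℝ) (x : Fin k → ℝ) : Matrix (Idx k) (Idx k) ℂ :=
  cplx (Q k ℓ) * (E x (Complex.I * s))ᵀ * cplx (Q k ℓ) * rankOne ℓ (vec W Z)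
    * E x (-(Complex.I * s))

namespace IsRealFrame

/-- `dressY` is the rank one matrix of `(W̃, iZ̃)`, because `E(x, -is) = conj E(x, is)`. -/
theorem dressY_eq (R : IsRealFrame ℓ Ω ξ E) {x : Fin k → ℝ} (hx : x ∈ Ω) :
    dressY ℓ E s W Z x = rankOne ℓ (vec (tildeW E s W Z x) (tildeZ E s W Z x)) := by
  rw [← R.inv_mulVec_vec hx, dressY, ← R.inv_eq hx]
  simp only [rankOne]
  rw [star_mulVec_eq, R.conj_inv hx, ← Matrix.mul_vecMulVec, ← Matrix.vecMul_transpose,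
    ← Matrix.vecMulVec_mul]
  simp only [Matrix.transpose_mul, cQ_transpose, Matrix.transpose_transpose, Matrix.mul_assoc,
    cQ_mul_cQ, Matrix.mul_one]

theorem trace_dressY (R : IsRealFrame ℓ Ω ξ E) (hW : W ⬝ᵥ W = 1)
    (hZ : Z ⬝ᵥ (J k ℓ *ᵥ Z) = 1) {x : Fin k → ℝ} (hx : x ∈ Ω) :
    (dressY ℓ E s W Z x).trace = ((2 * (tildeW E s W Z x ⬝ᵥ tildeW E s W Z x) : ℝ) : ℂ) := by
  rw [R.dressY_eq hx, trace_rankOne_vec, ← R.tilde_norm hW hZ hx, two_mul]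

theorem trace_dressY_ne (R : IsRealFrame ℓ Ω ξ E) (hW : W ⬝ᵥ W = 1)
    (hZ : Z ⬝ᵥ (J k ℓ *ᵥ Z) = 1) {x : Fin k → ℝ} (hx : x ∈ dressedDomain E s W Z Ω) :
    (dressY ℓ E s W Z x).trace ≠ 0 := by
  rw [R.trace_dressY hW hZ hx.1, Complex.ofReal_ne_zero]
  exact (mul_pos two_pos (tilde_pos hx)).ne'

/-- The projection `π̂` is the normalization of `dressY` to trace one. -/
theorem proj_hat_eq (R : IsRealFrame ℓ Ω ξ E) (hW : W ⬝ᵥ W = 1)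
    (hZ : Z ⬝ᵥ (J k ℓ *ᵥ Z) = 1) {x : Fin k → ℝ} (hx : x ∈ dressedDomain E s W Z Ω) :
    proj ℓ (hatW E s W Z x) (hatZ ℓ E s W Z x)
      = ((dressY ℓ E s W Z x).trace)⁻¹ • dressY ℓ E s W Z x := by
  have h := tilde_pos hx
  rw [R.trace_dressY hW hZ hx.1, R.dressY_eq hx.1, proj_eq_rankOne, R.hatZ_eq hW hZ hx.1, hatW,
    vec_smul, rankOne_smul, smul_smul, Complex.conj_ofReal, ← Complex.ofReal_mul, ← mul_inv,
    Real.mul_self_sqrt h.le]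
  congr 1
  push_cast
  rw [mul_inv]
  norm_num

theorem isSmoothOn_dressY (R : IsRealFrame ℓ Ω ξ E) : IsSmoothOn (dressY ℓ E s W Z) Ω :=
  ((((isSmoothOn_const _).mul (R.frame.isSmoothOn (Set.mem_univ _)).transpose).mul
    (isSmoothOn_const _)).mul (isSmoothOn_const _)).mul (R.frame.isSmoothOn (Set.mem_univ _))

theorem smooth_trace (R : IsRealFrame ℓ Ω ξ E) :
    ContDiffOn ℝ ∞ (fun x => (dressY ℓ E s W Z x).trace) Ω :=
  ContDiffOn.sum fun b _ => R.isSmoothOn_dressY b b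

theorem isOpen_dressedDomain (R : IsRealFrame ℓ Ω ξ E) (hW : W ⬝ᵥ W = 1)
    (hZ : Z ⬝ᵥ (J k ℓ *ᵥ Z) = 1) : IsOpen (dressedDomain E s W Z Ω) := by
  have h : dressedDomain E s W Z Ω
      = Ω ∩ (fun x => (dressY ℓ E s W Z x).trace) ⁻¹' {0}ᶜ := by
    ext x
    constructor
    · exact fun hx => ⟨hx.1, R.trace_dressY_ne hW hZ hx⟩
    · rintro ⟨hx, h0⟩
      refine ⟨hx, fun h1 => h0 ?_⟩
      simp [R.trace_dressY hW hZ hx, h1]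
  rw [h]
  exact R.smooth_trace.continuousOn.isOpen_inter_preimage R.isOpen isOpen_compl_singleton

theorem isSmoothOn_proj_hat (R : IsRealFrame ℓ Ω ξ E) (hW : W ⬝ᵥ W = 1)
    (hZ : Z ⬝ᵥ (J k ℓ *ᵥ Z) = 1) :
    IsSmoothOn (fun x => proj ℓ (hatW E s W Z x) (hatZ ℓ E s W Z x))
      (dressedDomain E s W Z Ω) := by
  have hsub : dressedDomain E s W Z Ω ⊆ Ω := fun _ hx => hx.1
  intro b c
  have h := ((R.smooth_trace.mono hsub).inv fun x hx => R.trace_dressY_ne hW hZ hx).mul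
    ((R.isSmoothOn_dressY (s := s) (W := W) (Z := Z) b c).mono hsub)
  exact h.congr fun x hx => congrFun (congrFun (R.proj_hat_eq hW hZ hx) b) c

theorem hasPD_dressY (R : IsRealFrame ℓ Ω ξ E) {x : Fin k → ℝ} (hx : x ∈ Ω) (j : Fin k) :
    HasPD j (dressY ℓ E s W Z)
      (dressY ℓ E s W Z x * lax ℓ ξ j x (-(Complex.I * s))
        - lax ℓ ξ j x (Complex.I * s) * dressY ℓ E s W Z x) x := by
  have h := ((((R.frame.hasPD R.isOpen (Set.mem_univ (Complex.I * s)) hx j).transpose.const_mul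
    (cplx (Q k ℓ))).mul_const (cplx (Q k ℓ))).mul_const (rankOne ℓ (vec W Z))).mul
      (R.frame.hasPD R.isOpen (Set.mem_univ (-(Complex.I * s))) hx j)
  rw [Matrix.transpose_mul, ← Matrix.mul_assoc (cplx (Q k ℓ)), Q_mul_lax_transpose] at h
  convert h using 1
  · rfl
  · simp only [dressY, Matrix.mul_assoc, Matrix.neg_mul]
    exact sub_eq_neg_add _ _

theorem hasPD_trace {A : (Fin k → ℝ) → Matrix (Idx k) (Idx k) ℂ} {A' : Matrix (Idx k) (Idx k) ℂ}
    {j : Fin k} {x : Fin k → ℝ} (h : HasPD j A A' x) :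
    DifferentiableAt ℝ (fun y => (A y).trace) x ∧ pd j (fun y => (A y).trace) x = A'.trace := by
  have h1 := HasFDerivAt.fun_sum (u := Finset.univ) fun b _ => (h b b).1.hasFDerivAt
  refine ⟨h1.differentiableAt, ?_⟩
  rw [pd]
  erw [h1.fderiv]
  rw [sum_apply]
  exact Finset.sum_congr rfl fun b _ => (h b b).2

/-- The Lax pair at `is` and at `-is` differ by `2is a_j`. -/
theorem lax_sub_lax (ξ : (Fin k → ℝ) → Matrix (Fin k) (Fin (k + 1)) ℝ) (j : Fin k)
    (x : Fin k → ℝ) (s : ℝ) :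
    lax ℓ ξ j x (Complex.I * s)
      = lax ℓ ξ j x (-(Complex.I * s)) + (2 * (Complex.I * s)) • cplx (a ℓ j) := by
  rw [lax, lax]
  module

/-- The differential equation of the projection `π̂`. -/
theorem hasPD_proj_hat (R : IsRealFrame ℓ Ω ξ E) (hW : W ⬝ᵥ W = 1)
    (hZ : Z ⬝ᵥ (J k ℓ *ᵥ Z) = 1) {x : Fin k → ℝ} (hx : x ∈ dressedDomain E s W Z Ω) (j : Fin k)
    {P : Matrix (Idx k) (Idx k) ℂ} (hP : P = proj ℓ (hatW E s W Z x) (hatZ ℓ E s W Z x)) :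
    HasPD j (fun x => proj ℓ (hatW E s W Z x) (hatZ ℓ E s W Z x))
      (P * lax ℓ ξ j x (-(Complex.I * s)) - lax ℓ ξ j x (Complex.I * s) * P
        + (2 * (Complex.I * s)) • (P * cplx (a ℓ j) * P)) x := by
  have hY := R.hasPD_dressY (s := s) (W := W) (Z := Z) hx.1 j
  obtain ⟨hT, hT'⟩ := hasPD_trace hY
  have hne := R.trace_dressY_ne hW hZ hx
  have hinv : pd j (fun y => ((dressY ℓ E s W Z y).trace)⁻¹) x
      = -(pd j (fun y => (dressY ℓ E s W Z y).trace) x)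
        / (dressY ℓ E s W Z x).trace ^ 2 := by
    have h1 := (hasDerivAt_inv hne).hasFDerivAt.restrictScalars ℝ |>.comp x hT.hasFDerivAt
    rw [pd]
    erw [h1.fderiv]
    simp [pd]
    ring
  have hmain := HasPD.smul (hT.inv hne) hY
  rw [hP]
  refine HasPD.congr (U := dressedDomain E s W Z Ω) ?_ (R.isOpen_dressedDomain hW hZ) hx
    fun y hy => R.proj_hat_eq hW hZ hy
  rw [hT'] at hinv
  have htr : (dressY ℓ E s W Z x * lax ℓ ξ j x (-(Complex.I * s))
      - lax ℓ ξ j x (Complex.I * s) * dressY ℓ E s W Z x).trace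
      = -((2 * (Complex.I * s)) * (cplx (a ℓ j) * dressY ℓ E s W Z x).trace) := by
    rw [Matrix.trace_sub, Matrix.trace_mul_comm, lax_sub_lax, Matrix.add_mul, Matrix.trace_add,
      Matrix.smul_mul, Matrix.trace_smul, smul_eq_mul]
    ring
  have hr : dressY ℓ E s W Z x * cplx (a ℓ j) * dressY ℓ E s W Z x
      = (cplx (a ℓ j) * dressY ℓ E s W Z x).trace • dressY ℓ E s W Z x := by
    rw [R.dressY_eq hx.1, rankOne_mul_mul_rankOne]
  rw [htr] at hinv
  convert hmain using 1
  · rfl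
  · change _ = _ + pd j (fun y => ((dressY ℓ E s W Z y).trace)⁻¹) x • dressY ℓ E s W Z x
    rw [hinv, R.proj_hat_eq hW hZ hx]
    simp only [Matrix.smul_mul, Matrix.mul_smul, hr, Pi.inv_apply]
    match_scalars <;> field_simp

end IsRealFrame

end Dressing

section DressedFrame

variable {k ℓ : ℕ} {Ω : Set (Fin k → ℝ)}
  {ξ : (Fin k → ℝ) → Matrix (Fin k) (Fin (k + 1)) ℝ}
  {E : (Fin k → ℝ) → ℂ → Matrix (Idx k) (Idx k) ℂ} {s : ℝ} {W : Fin (k + 1) → ℝ} {Z : Fin k → ℝ}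

theorem D_mul_apply {β : Type*} (N : Matrix (Fin k) β ℝ) (j : Fin k) (m : Fin (k + 1)) (c : β) :
    (D j * N) m c = if m = j.castSucc then N j c else 0 := by
  by_cases h : m = j.castSucc
  · simp [D, h]
  · simp [D, h]

theorem mul_D_apply {β : Type*} (N : Matrix β (Fin (k + 1)) ℝ) (j : Fin k) (b : β) (c : Fin k) :
    (N * D j) b c = if c = j then N b j.castSucc else 0 := by
  by_cases h : c = j
  · simp [D, h]
  · simp [D, h]

/-- The span of `a_1, …, a_k` is abelian, so diagonal entries of `ξ` do not contribute to the Lax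
pair. -/
theorem lie_a_diag (η : Matrix (Fin k) (Fin (k + 1)) ℝ) (j : Fin k) :
    ⁅a ℓ j, pMat ℓ (Matrix.of fun i c => if c = i.castSucc then η i c else 0)⁆ = 0 := by
  set δ : Matrix (Fin k) (Fin (k + 1)) ℝ :=
    Matrix.of fun i c => if c = i.castSucc then η i c else 0 with hδ
  have h1 : D j * (J k ℓ * δ) = (D j * (J k ℓ * δ))ᵀ := by
    ext m m'
    rw [Matrix.transpose_apply, D_mul_apply, D_mul_apply, J, Matrix.diagonal_mul,
      Matrix.diagonal_mul]
    by_cases h1 : m = j.castSucc <;> by_cases h2 : m' = j.castSucc <;> simp [h1, h2, hδ]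
  have h2 : δ * D j = (δ * D j)ᵀ := by
    ext m m'
    rw [Matrix.transpose_apply, mul_D_apply, mul_D_apply]
    by_cases h1 : m = j <;> by_cases h2 : m' = j <;> simp [h1, h2, hδ, Ne.symm]
  rw [a, lie_pMat, ← Matrix.fromBlocks_zero]
  congr 1
  · rw [Matrix.transpose_transpose, Matrix.mul_assoc (D j), h1, Matrix.transpose_mul,
      Matrix.transpose_mul, J_transpose, sub_self]
  · rw [Matrix.transpose_transpose, h2, Matrix.transpose_mul, sub_self]

/-- The Lax pair of the dressed solution is the gauge transform `θ + 2is [a_j, π̂ - conj π̂]`. -/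
theorem lax_dressedSolution (j : Fin k) (x : Fin k → ℝ) (μ : ℂ) {P : Matrix (Idx k) (Idx k) ℂ}
    (hP : P = proj ℓ (hatW E s W Z x) (hatZ ℓ E s W Z x)) :
    lax ℓ (dressedSolution ℓ E s W Z ξ) j x μ = lax ℓ ξ j x μ + (2 * (Complex.I * s)) •
      (cplx (a ℓ j) * (P - P.map (starRingEnd ℂ))
        - (P - P.map (starRingEnd ℂ)) * cplx (a ℓ j)) := by
  set η := Matrix.vecMulVec (hatZ ℓ E s W Z x) (hatW E s W Z x) with hη
  have h1 : dressedSolution ℓ E s W Z ξ x = ξ x - (2 * s) • (η -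
      Matrix.of fun i c => if c = i.castSucc then η i c else 0) := by
    rw [dressedSolution]
    congr 2
    ext i c
    by_cases h : c = i.castSucc <;> simp [h, hη, Matrix.vecMulVec_apply]
  have h2 : ⁅a ℓ j, pMat ℓ (dressedSolution ℓ E s W Z ξ x)⁆
      = ⁅a ℓ j, pMat ℓ (ξ x)⁆ - (2 * s) • ⁅a ℓ j, pMat ℓ η⁆ := by
    have h3 := lie_a_diag (ℓ := ℓ) η j
    rw [h1, pMat_sub, pMat_smul, pMat_sub]
    simp only [Ring.lie_def, Matrix.mul_sub, Matrix.sub_mul, Matrix.mul_smul,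
      Matrix.smul_mul] at h3 ⊢
    linear_combination (norm := module) (2 * s) • h3
  rw [lax, lax, h2, cplx_sub, cplx_smul, Ring.lie_def (a ℓ j) (pMat ℓ η), cplx_sub, cplx_mul,
    cplx_mul, hP, proj_sub_conj, ← hη, Matrix.mul_smul, Matrix.smul_mul, ← smul_sub, smul_smul]
  have hI : 2 * (Complex.I * s) * Complex.I = -((2 * s : ℝ) : ℂ) := by
    push_cast
    linear_combination (2 * s : ℂ) * Complex.I_mul_I
  rw [hI]
  module

theorem ne_of_mem_compl {μ : ℂ}
    (hμ : μ ∈ ({Complex.I * s, -(Complex.I * s)}ᶜ : Set ℂ)) :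
    μ ≠ Complex.I * s ∧ μ ≠ -(Complex.I * s) := by
  simpa [not_or] using hμ

theorem isOpen_compl_poles : IsOpen ({Complex.I * s, -(Complex.I * s)}ᶜ : Set ℂ) :=
  (Set.toFinite _).isClosed.isOpen_compl

theorem zero_mem_compl_poles (hs : s ≠ 0) :
    (0 : ℂ) ∈ ({Complex.I * s, -(Complex.I * s)}ᶜ : Set ℂ) := by
  simp [eq_comm, hs]

theorem contDiffOn_poleCoeff {X : Type*} [NormedAddCommGroup X] [NormedSpace ℝ X] {U : Set X}
    {Λ : Set ℂ} (h : ∀ μ ∈ Λ, μ ≠ Complex.I * s) :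
    ContDiffOn ℝ ∞ (fun p : X × ℂ => poleCoeff s p.2) (U ×ˢ Λ) := by
  have h1 : ContDiffOn ℝ ∞ (fun p : X × ℂ => (p.2 - Complex.I * s)⁻¹) (U ×ˢ Λ) :=
    (contDiff_snd.sub contDiff_const).contDiffOn.inv fun p hp => sub_ne_zero.mpr (h p.2 hp.2)
  exact contDiffOn_const.mul h1

theorem hasDerivAt_poleCoeff (hs : s ≠ 0) :
    HasDerivAt (poleCoeff s) (2 * Complex.I / s) 0 := by
  have hne : (0 : ℂ) - Complex.I * s ≠ 0 := by simp [hs]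
  have h1 := (hasDerivAt_const (0 : ℂ) (2 * (Complex.I * s))).div
    ((hasDerivAt_id (0 : ℂ)).sub_const (Complex.I * s)) hne
  refine h1.congr_deriv ?_
  have hI := Complex.I_ne_zero
  have hs' : (s : ℂ) ≠ 0 := by exact_mod_cast hs
  simp only [id, zero_mul, zero_sub, mul_one]
  field_simp
  linear_combination (-1 : ℂ) * Complex.I_sq

theorem poleCoeff_zero (hs : s ≠ 0) : poleCoeff s 0 = -2 := by
  have hs' : (s : ℂ) ≠ 0 := by exact_mod_cast hs
  have hI := Complex.I_ne_zero
  rw [poleCoeff]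
  field_simp
  ring

namespace IsRealFrame

/-- The partial fraction decomposition of the dressed frame. -/
theorem dressedFrame_eq (R : IsRealFrame ℓ Ω ξ E) (hW : W ⬝ᵥ W = 1)
    (hZ : Z ⬝ᵥ (J k ℓ *ᵥ Z) = 1) {x : Fin k → ℝ} (hx : x ∈ dressedDomain E s W Z Ω) {μ : ℂ}
    (hμ : μ ∈ ({Complex.I * s, -(Complex.I * s)}ᶜ : Set ℂ)) : dressedFrame ℓ E s W Z x μ
      = E x μ * (1
        + poleCoeff (-s) μ • (proj ℓ (hatW E s W Z x) (hatZ ℓ E s W Z x)).map (starRingEnd ℂ)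
        + poleCoeff s μ • proj ℓ (hatW E s W Z x) (hatZ ℓ E s W Z x)) := by
  rw [dressedFrame, simpleElt_inv (hatW_norm hx) (R.hatZ_norm hW hZ hx) (ne_of_mem_compl hμ).1
    (ne_of_mem_compl hμ).2]

/-- The dressed frame solves the Lax pair of the dressed solution: comparing residues at `±is` and
the polynomial part, this is the differential equation of `π̂`. -/
theorem isFrameFor_dressedFrame (R : IsRealFrame ℓ Ω ξ E) (hW : W ⬝ᵥ W = 1)
    (hZ : Z ⬝ᵥ (J k ℓ *ᵥ Z) = 1) :
    IsFrameFor ℓ (dressedDomain E s W Z Ω) {Complex.I * s, -(Complex.I * s)}ᶜ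
      (dressedSolution ℓ E s W Z ξ) (dressedFrame ℓ E s W Z) := by
  have hΩ' := R.isOpen_dressedDomain (s := s) hW hZ
  constructor
  · have hPs : IsSmoothOn (fun p : (Fin k → ℝ) × ℂ =>
        proj ℓ (hatW E s W Z p.1) (hatZ ℓ E s W Z p.1))
        (dressedDomain E s W Z Ω ×ˢ ({Complex.I * s, -(Complex.I * s)}ᶜ : Set ℂ)) := fun b c =>
      (R.isSmoothOn_proj_hat hW hZ b c).comp contDiff_fst.contDiffOn fun p hp => hp.1
    have hEs : IsSmoothOn (fun p : (Fin k → ℝ) × ℂ => E p.1 p.2)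
        (dressedDomain E s W Z Ω ×ˢ ({Complex.I * s, -(Complex.I * s)}ᶜ : Set ℂ)) := fun b c =>
      (R.frame.1 b c).mono (Set.prod_mono (fun _ hx => hx.1) (Set.subset_univ _))
    have h := hEs.mul (((isSmoothOn_const (1 : Matrix (Idx k) (Idx k) ℂ)).add
      (IsSmoothOn.smul (contDiffOn_poleCoeff (s := -s) fun μ hμ => by
        simpa using (ne_of_mem_compl hμ).2) hPs.conj)).add
      (IsSmoothOn.smul (contDiffOn_poleCoeff fun μ hμ => (ne_of_mem_compl hμ).1) hPs))
    intro b c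
    exact (h b c).congr fun p hp =>
      congrFun (congrFun (R.dressedFrame_eq hW hZ hp.1 hp.2) b) c
  · intro x hx μ hμ j
    obtain ⟨hμ1, hμ2⟩ := ne_of_mem_compl hμ
    set P := proj ℓ (hatW E s W Z x) (hatZ ℓ E s W Z x) with hP
    have hWh := hatW_norm hx
    have hZh := R.hatZ_norm hW hZ hx
    have hPd := R.hasPD_proj_hat hW hZ hx j hP
    have hE := R.frame.hasPD R.isOpen (Set.mem_univ μ) hx.1 j
    have hmain := (hE.mul (((hasPD_const (1 : Matrix (Idx k) (Idx k) ℂ)).add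
      (hPd.conj.const_smul (poleCoeff (-s) μ))).add (hPd.const_smul (poleCoeff s μ)))).congr hΩ' hx
        fun y hy => R.dressedFrame_eq hW hZ hy hμ
    refine Eq.trans ?_ (Eq.trans (Matrix.ext fun b c => (hmain b c).2) ?_)
    · rfl
    rw [R.dressedFrame_eq hW hZ hx hμ, ← hP, lax_dressedSolution j x μ hP,
      Matrix.mul_assoc (E x μ) (lax ℓ ξ j x μ), ← Matrix.mul_add, Matrix.mul_assoc (E x μ)]
    refine congrArg (E x μ * ·) ?_
    -- the conjugate of the equation of `π̂`
    have hconj : (P * lax ℓ ξ j x (-(Complex.I * s)) - lax ℓ ξ j x (Complex.I * s) * P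
        + (2 * (Complex.I * s)) • (P * cplx (a ℓ j) * P)).map (starRingEnd ℂ)
        = P.map (starRingEnd ℂ) * lax ℓ ξ j x (Complex.I * s)
          - lax ℓ ξ j x (-(Complex.I * s)) * P.map (starRingEnd ℂ)
          - (2 * (Complex.I * s)) •
            (P.map (starRingEnd ℂ) * cplx (a ℓ j) * P.map (starRingEnd ℂ)) := by
      have h1 : (lax ℓ ξ j x (-(Complex.I * s))).map (starRingEnd ℂ)
          = lax ℓ ξ j x (Complex.I * s) := by
        rw [← lax_conj ℓ ξ j x (Complex.I * s)]
        simp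
      have h2 : (lax ℓ ξ j x (Complex.I * s)).map (starRingEnd ℂ)
          = lax ℓ ξ j x (-(Complex.I * s)) := by
        rw [← h1, conj_conj]
      have h3 : starRingEnd ℂ (2 * (Complex.I * s)) = -(2 * (Complex.I * s)) := by
        rw [map_mul, Complex.conj_ofNat]
        simp
      have h4 : ∀ (t : ℂ) (A B C : Matrix (Idx k) (Idx k) ℂ),
          (A - B + t • C).map (starRingEnd ℂ) = A.map (starRingEnd ℂ) - B.map (starRingEnd ℂ)
            + starRingEnd ℂ t • C.map (starRingEnd ℂ) := fun t A B C => by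
        ext
        simp
      rw [h4, conj_mul, conj_mul, conj_mul, conj_mul, h1, h2, h3, cplx_conj, neg_smul,
        sub_eq_add_neg _ (_ • _)]
    rw [hconj, zero_add]
    have hPP := conj_proj_mul_proj (ℓ := ℓ) hWh hZh
    have hPP' := proj_mul_conj_proj (ℓ := ℓ) hWh hZh
    have hPaP := conj_proj_mul_mul_proj (W := hatW E s W Z x) (Z := hatZ ℓ E s W Z x)
      (ca_transpose ℓ j)
    have hPaP' := proj_mul_mul_conj_proj (W := hatW E s W Z x) (Z := hatZ ℓ E s W Z x)
      (pMat_transpose_mul_Q ℓ (D j)ᵀ)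
    rw [← a] at hPaP'
    -- `π̂` and `conj π̂` are orthogonal projections which `a_j` does not mix
    have hid := proj_mul_self (ℓ := ℓ) hWh hZh
    have hid' := conj_proj_mul_self (ℓ := ℓ) hWh hZh
    rw [← hP] at hPP hPP' hPaP hPaP' hid hid'
    have e1 := poleCoeff_mul hμ1
    have e2 := poleCoeff_neg_mul hμ2
    simp only [lax]
    generalize cplx ⁅a ℓ j, pMat ℓ (ξ x)⁆ = u
    generalize cplx (a ℓ j) = α at *
    generalize P.map (starRingEnd ℂ) = P' at *
    clear_value P
    generalize poleCoeff s μ = A at *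
    generalize poleCoeff (-s) μ = B at *
    simp only [Matrix.mul_add, Matrix.add_mul, Matrix.mul_sub, Matrix.sub_mul, Matrix.smul_mul,
      Matrix.mul_smul, Matrix.mul_one, Matrix.one_mul, ← Matrix.mul_assoc, hPP, hPP', hPaP, hPaP',
      hid, hid', Matrix.zero_mul, smul_zero, smul_add, smul_sub]
    -- the defining relations of the pole coefficients cancel the residues at `is` and `-is`
    linear_combination (norm := module) e1 • (α * P - P * α) + e2 • (α * P' - P' * α)

/-- The dressed solution is smooth: the products of entries of `Ẑ` and `Ŵ` are entries of `π̂`. -/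
theorem isSmoothOn_dressedSolution (R : IsRealFrame ℓ Ω ξ E) (hW : W ⬝ᵥ W = 1)
    (hZ : Z ⬝ᵥ (J k ℓ *ᵥ Z) = 1) :
    IsSmoothOn (dressedSolution ℓ E s W Z ξ) (dressedDomain E s W Z Ω) := by
  intro i c
  have hsub : dressedDomain E s W Z Ω ⊆ Ω := fun _ hx => hx.1
  have h1 : ContDiffOn ℝ ∞ (fun x => hatZ ℓ E s W Z x i * hatW E s W Z x c)
      (dressedDomain E s W Z Ω) := by
    have h2 := Complex.imCLM.contDiff.comp_contDiffOn
      (R.isSmoothOn_proj_hat (s := s) hW hZ (Sum.inr i) (Sum.inl c))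
    refine (contDiffOn_const (c := (2 : ℝ)).mul h2).congr fun x _ => ?_
    simp only [Function.comp, proj_apply]
    simp [cplx, pMat, Matrix.vecMulVec_apply]
  by_cases h : c = i.castSucc
  · refine ((R.smooth i c).mono hsub).congr fun x _ => ?_
    simp [dressedSolution, h]
  · refine (((R.smooth i c).mono hsub).sub (contDiffOn_const (c := 2 * s).mul h1)).congr
      fun x _ => ?_
    simp [dressedSolution, h]

end IsRealFrame

/-! ### The dressed Sym-type frame -/

/-- The reflection `1 - 2 W W^t`. -/
def refl₁ (W : Fin (k + 1) → ℝ) : Matrix (Fin (k + 1)) (Fin (k + 1)) ℝ :=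
  1 - (2 : ℝ) • Matrix.vecMulVec W W

/-- The reflection `1 - 2 Z Z^t J`. -/
noncomputable def refl₂ (ℓ : ℕ) (Z : Fin k → ℝ) : Matrix (Fin k) (Fin k) ℝ :=
  1 - (2 : ℝ) • (Matrix.vecMulVec Z Z * J k ℓ)

theorem refl₁_transpose : (refl₁ W)ᵀ = refl₁ W := by
  rw [refl₁, Matrix.transpose_sub, Matrix.transpose_smul, Matrix.transpose_one]
  congr 2
  ext
  simp [Matrix.vecMulVec_apply, mul_comm]

theorem vecMulVec_mul_refl₁ {α : Type*} (V : α → ℝ) (hW : W ⬝ᵥ W = 1) :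
    Matrix.vecMulVec V W * refl₁ W = -Matrix.vecMulVec V W := by
  have h : Matrix.vecMulVec V W * Matrix.vecMulVec W W = Matrix.vecMulVec V W := by
    rw [Matrix.vecMulVec_mul_vecMulVec, hW, one_smul]
  rw [refl₁, Matrix.mul_sub, Matrix.mul_smul, h, Matrix.mul_one]
  module

theorem vecMulVec_mul_J_mul_refl₂ {α : Type*} (V : α → ℝ) (hZ : Z ⬝ᵥ (J k ℓ *ᵥ Z) = 1) :
    Matrix.vecMulVec V Z * J k ℓ * refl₂ ℓ Z = -(Matrix.vecMulVec V Z * J k ℓ) := by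
  have h : Matrix.vecMulVec V Z * J k ℓ * (Matrix.vecMulVec Z Z * J k ℓ)
      = Matrix.vecMulVec V Z * J k ℓ := by
    rw [← Matrix.mul_assoc, Matrix.vecMulVec_mul, Matrix.vecMulVec_mul_vecMulVec,
      ← Matrix.dotProduct_mulVec, hZ, one_smul, Matrix.vecMulVec_mul]
  rw [refl₂, Matrix.mul_sub, Matrix.mul_smul, h, Matrix.mul_one]
  module

theorem refl₁_mul_self (hW : W ⬝ᵥ W = 1) : refl₁ W * refl₁ W = 1 := by
  conv_lhs => lhs; rw [refl₁]
  rw [Matrix.sub_mul, Matrix.smul_mul, vecMulVec_mul_refl₁ _ hW, Matrix.one_mul, refl₁]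
  module

theorem refl₂_mul_self (hZ : Z ⬝ᵥ (J k ℓ *ᵥ Z) = 1) : refl₂ ℓ Z * refl₂ ℓ Z = 1 := by
  conv_lhs => lhs; rw [refl₂]
  rw [Matrix.sub_mul, Matrix.smul_mul, vecMulVec_mul_J_mul_refl₂ _ hZ, Matrix.one_mul, refl₂]
  module

theorem refl₂_transpose_mul_J : (refl₂ ℓ Z)ᵀ * J k ℓ = J k ℓ * refl₂ ℓ Z := by
  have h : (Matrix.vecMulVec Z Z)ᵀ = Matrix.vecMulVec Z Z := by
    ext
    simp [Matrix.vecMulVec_apply, mul_comm]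
  rw [refl₂, Matrix.transpose_sub, Matrix.transpose_smul, Matrix.transpose_one,
    Matrix.transpose_mul, h, J_transpose, Matrix.sub_mul, Matrix.mul_sub, Matrix.smul_mul,
    Matrix.mul_smul, Matrix.one_mul, Matrix.mul_one, Matrix.mul_assoc]

/-- The dressed Sym-type map `Ξ̂ = Ξ - (2/s) g₁ Ŵ Ẑ^t J g₂⁻¹`. -/
noncomputable def dressedSymBlock (ℓ : ℕ) (E : (Fin k → ℝ) → ℂ → Matrix (Idx k) (Idx k) ℂ) (s : ℝ)
    (W : Fin (k + 1) → ℝ) (Z : Fin k → ℝ) (Ξ : (Fin k → ℝ) → Matrix (Fin (k + 1)) (Fin k) ℝ)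
    (x : Fin k → ℝ) : Matrix (Fin (k + 1)) (Fin k) ℝ :=
  Ξ x - (2 / s) • (blk₁ E x * Matrix.vecMulVec (hatW E s W Z x) (hatZ ℓ E s W Z x) * J k ℓ
    * (blk₂ E x)⁻¹)

variable {Ξ : (Fin k → ℝ) → Matrix (Fin (k + 1)) (Fin k) ℝ}

namespace IsRealFrame

/-- At `μ = 0` the inverse simple element is the product of the reflections in `Ŵ` and `Ẑ`. -/
theorem dressedFrame_zero (R : IsRealFrame ℓ Ω ξ E) (F : IsSymFrame ℓ Ω Set.univ ξ E Ξ)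
    (hW : W ⬝ᵥ W = 1) (hZ : Z ⬝ᵥ (J k ℓ *ᵥ Z) = 1) (hs : s ≠ 0) {x : Fin k → ℝ}
    (hx : x ∈ dressedDomain E s W Z Ω) : dressedFrame ℓ E s W Z x 0
      = cplx (Matrix.fromBlocks (blk₁ E x * refl₁ (hatW E s W Z x)) 0 0
        (blk₂ E x * refl₂ ℓ (hatZ ℓ E s W Z x))) := by
  have h1 : (1 + poleCoeff (-s) 0 •
      (proj ℓ (hatW E s W Z x) (hatZ ℓ E s W Z x)).map (starRingEnd ℂ)
      + poleCoeff s 0 • proj ℓ (hatW E s W Z x) (hatZ ℓ E s W Z x))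
      = cplx (Matrix.fromBlocks (refl₁ (hatW E s W Z x)) 0 0 (refl₂ ℓ (hatZ ℓ E s W Z x))) := by
    have h2 : Matrix.fromBlocks (refl₁ (hatW E s W Z x)) 0 0 (refl₂ ℓ (hatZ ℓ E s W Z x))
        = 1 - (2 : ℝ) • Matrix.fromBlocks (Matrix.vecMulVec (hatW E s W Z x) (hatW E s W Z x)) 0 0
          (Matrix.vecMulVec (hatZ ℓ E s W Z x) (hatZ ℓ E s W Z x) * J k ℓ) := by
      rw [← Matrix.fromBlocks_one, Matrix.fromBlocks_smul, fromBlocks_sub]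
      simp [refl₁, refl₂]
    rw [poleCoeff_zero hs, poleCoeff_zero (neg_ne_zero.mpr hs), h2, cplx_sub, cplx_smul, cplx_one,
      ← proj_add_conj]
    push_cast
    module
  rw [R.dressedFrame_eq hW hZ hx (zero_mem_compl_poles hs), h1, F.block x hx.1, ← cplx_mul,
    Matrix.fromBlocks_multiply]
  simp

theorem blk₁_dressedFrame (R : IsRealFrame ℓ Ω ξ E) (F : IsSymFrame ℓ Ω Set.univ ξ E Ξ)
    (hW : W ⬝ᵥ W = 1) (hZ : Z ⬝ᵥ (J k ℓ *ᵥ Z) = 1) (hs : s ≠ 0) {x : Fin k → ℝ}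
    (hx : x ∈ dressedDomain E s W Z Ω) :
    blk₁ (dressedFrame ℓ E s W Z) x = blk₁ E x * refl₁ (hatW E s W Z x) := by
  ext b c
  rw [blk₁, Matrix.of_apply, R.dressedFrame_zero F hW hZ hs hx]
  simp [cplx]

theorem blk₂_dressedFrame (R : IsRealFrame ℓ Ω ξ E) (F : IsSymFrame ℓ Ω Set.univ ξ E Ξ)
    (hW : W ⬝ᵥ W = 1) (hZ : Z ⬝ᵥ (J k ℓ *ᵥ Z) = 1) (hs : s ≠ 0) {x : Fin k → ℝ}
    (hx : x ∈ dressedDomain E s W Z Ω) :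
    blk₂ (dressedFrame ℓ E s W Z) x = blk₂ E x * refl₂ ℓ (hatZ ℓ E s W Z x) := by
  ext b c
  rw [blk₂, Matrix.of_apply, R.dressedFrame_zero F hW hZ hs hx]
  simp [cplx]

/-- The dressed frame is of the same type as the original one. The derivative of `E p⁻¹` at `μ = 0`
is computed from `d/dμ p⁻¹ = (2i/s) (π̂ - conj π̂)`, and `p⁻¹(0)` is a product of reflections. -/
theorem isSymFrame_dressed (R : IsRealFrame ℓ Ω ξ E) (F : IsSymFrame ℓ Ω Set.univ ξ E Ξ)
    (hW : W ⬝ᵥ W = 1) (hZ : Z ⬝ᵥ (J k ℓ *ᵥ Z) = 1) (hs : s ≠ 0) :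
    IsSymFrame ℓ (dressedDomain E s W Z Ω) {Complex.I * s, -(Complex.I * s)}ᶜ
      (dressedSolution ℓ E s W Z ξ) (dressedFrame ℓ E s W Z)
      (dressedSymBlock ℓ E s W Z Ξ) := by
  have hb₁ : ∀ x ∈ dressedDomain E s W Z Ω, _ := fun x hx => R.blk₁_dressedFrame F hW hZ hs hx
  have hb₂ : ∀ x ∈ dressedDomain E s W Z Ω, _ := fun x hx => R.blk₂_dressedFrame F hW hZ hs hx
  have hder : ∀ x ∈ dressedDomain E s W Z Ω, ∀ b c,
      HasDerivAt (fun μ => dressedFrame ℓ E s W Z x μ b c)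
        ((dSpec E x * (1 + poleCoeff (-s) 0 •
            (proj ℓ (hatW E s W Z x) (hatZ ℓ E s W Z x)).map (starRingEnd ℂ)
          + poleCoeff s 0 • proj ℓ (hatW E s W Z x) (hatZ ℓ E s W Z x))
          + E x 0 * ((2 * Complex.I / s) • (proj ℓ (hatW E s W Z x) (hatZ ℓ E s W Z x)
            - (proj ℓ (hatW E s W Z x) (hatZ ℓ E s W Z x)).map (starRingEnd ℂ)))) b c) 0 := by
    intro x hx b c
    have h1 := hasDerivAt_matrix_mul (dSpec_hasDerivAt (F.diff x hx.1))
      (B := fun μ => 1 + poleCoeff (-s) μ •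
            (proj ℓ (hatW E s W Z x) (hatZ ℓ E s W Z x)).map (starRingEnd ℂ)
          + poleCoeff s μ • proj ℓ (hatW E s W Z x) (hatZ ℓ E s W Z x))
      (B' := (2 * Complex.I / s) • (proj ℓ (hatW E s W Z x) (hatZ ℓ E s W Z x)
            - (proj ℓ (hatW E s W Z x) (hatZ ℓ E s W Z x)).map (starRingEnd ℂ)))
      (fun b c => by
        have h2 := (((hasDerivAt_poleCoeff (neg_ne_zero.mpr hs)).mul_const
          ((proj ℓ (hatW E s W Z x) (hatZ ℓ E s W Z x)).map (starRingEnd ℂ) b c)).const_add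
            ((1 : Matrix (Idx k) (Idx k) ℂ) b c)).add
          ((hasDerivAt_poleCoeff hs).mul_const
            (proj ℓ (hatW E s W Z x) (hatZ ℓ E s W Z x) b c))
        refine h2.congr_deriv ?_
        simp only [Matrix.smul_apply, Matrix.sub_apply, smul_eq_mul]
        push_cast
        rw [div_neg]
        ring) b c
    refine h1.congr_of_eventuallyEq ?_
    filter_upwards [isOpen_compl_poles.mem_nhds (zero_mem_compl_poles hs)] with μ hμ
    rw [R.dressedFrame_eq hW hZ hx hμ]
  refine ⟨R.isOpen_dressedDomain hW hZ, isOpen_compl_poles, zero_mem_compl_poles hs,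
    R.isSmoothOn_dressedSolution hW hZ, R.isFrameFor_dressedFrame hW hZ,
    fun x hx b c => (hder x hx b c).differentiableAt, fun x hx => ?_, fun x hx => ?_,
    fun x hx => ?_, fun x hx => ?_⟩
  · rw [hb₁ x hx, hb₂ x hx, R.dressedFrame_zero F hW hZ hs hx]
  · rw [hb₁ x hx, Matrix.transpose_mul, Matrix.mul_assoc, ← Matrix.mul_assoc _ _ (refl₁ _),
      F.orth₁ x hx.1, Matrix.one_mul, refl₁_transpose, refl₁_mul_self (hatW_norm hx)]
  · rw [hb₂ x hx, Matrix.transpose_mul]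
    calc _ = (refl₂ ℓ (hatZ ℓ E s W Z x))ᵀ * ((blk₂ E x)ᵀ * J k ℓ * blk₂ E x)
          * refl₂ ℓ (hatZ ℓ E s W Z x) := by simp only [Matrix.mul_assoc]
      _ = J k ℓ := by
        rw [F.orth₂ x hx.1, refl₂_transpose_mul_J, Matrix.mul_assoc,
          refl₂_mul_self (R.hatZ_norm hW hZ hx), Matrix.mul_one]
  · set g₁ := blk₁ E x with hg₁
    set g₂ := blk₂ E x with hg₂
    set Wh := hatW E s W Z x with hWh
    set Zh := hatZ ℓ E s W Z x with hZh
    have hWn : Wh ⬝ᵥ Wh = 1 := hatW_norm hx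
    have hZn : Zh ⬝ᵥ (J k ℓ *ᵥ Zh) = 1 := R.hatZ_norm hW hZ hx
    set r := Matrix.fromBlocks (refl₁ Wh) 0 0 (refl₂ ℓ Zh) with hr
    have hrr : r * r = 1 := by
      rw [hr, Matrix.fromBlocks_multiply]
      simp [refl₁_mul_self hWn, refl₂_mul_self hZn]
    have hE0 := F.block x hx.1
    have hE' : dressedFrame ℓ E s W Z x 0 = E x 0 * cplx r := by
      rw [R.dressedFrame_zero F hW hZ hs hx, hE0, ← cplx_mul, Matrix.fromBlocks_multiply]
      simp [hWh, hZh]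
    have hEi : E x 0 * (E x 0)⁻¹ = 1 := by
      rw [R.inv_eq hx.1]; exact R.orth x hx.1 0
    have hinv : (dressedFrame ℓ E s W Z x 0)⁻¹ = cplx r * (E x 0)⁻¹ := by
      rw [hE']
      refine Matrix.inv_eq_right_inv ?_
      rw [Matrix.mul_assoc, ← Matrix.mul_assoc (cplx r), ← cplx_mul, hrr, cplx_one,
        Matrix.one_mul, hEi]
    have hpr : pMat ℓ (Matrix.vecMulVec Zh Wh) * r = -pMat ℓ (Matrix.vecMulVec Zh Wh) := by
      have ht : (Matrix.vecMulVec Zh Wh)ᵀ = Matrix.vecMulVec Wh Zh := by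
        ext
        simp [Matrix.vecMulVec_apply, mul_comm]
      rw [pMat, hr, Matrix.fromBlocks_multiply, Matrix.fromBlocks_neg, ht]
      simp [vecMulVec_mul_refl₁ _ hWn, vecMulVec_mul_J_mul_refl₂ _ hZn]
    have hd : dSpec (dressedFrame ℓ E s W Z) x = dSpec E x * cplx r
        + E x 0 * (((-(2 / s) : ℝ) : ℂ) • cplx (pMat ℓ (Matrix.vecMulVec Zh Wh))) := by
      have h1 : dSpec (dressedFrame ℓ E s W Z) x = _ :=
        Matrix.ext fun b c => (hder x hx b c).deriv
      have h2 : (1 + poleCoeff (-s) 0 • (proj ℓ Wh Zh).map (starRingEnd ℂ)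
          + poleCoeff s 0 • proj ℓ Wh Zh) = cplx r := by
        have h3 := congrArg ((E x 0)⁻¹ * ·)
          ((R.dressedFrame_eq hW hZ hx (zero_mem_compl_poles hs)).symm.trans hE')
        simpa only [← Matrix.mul_assoc, mul_eq_one_comm.mp hEi, Matrix.one_mul] using h3
      rw [h1, h2, proj_sub_conj, smul_smul]
      congr 3
      push_cast
      rw [div_mul_eq_mul_div, mul_assoc, Complex.I_mul_I]
      ring
    rw [hd, hinv, Matrix.add_mul]
    have h3 : dSpec E x * cplx r * (cplx r * (E x 0)⁻¹) = dSpec E x * (E x 0)⁻¹ := by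
      rw [Matrix.mul_assoc, ← Matrix.mul_assoc (cplx r), ← cplx_mul, hrr, cplx_one,
        Matrix.one_mul]
    have h4 : E x 0 * (((-(2 / s) : ℝ) : ℂ) • cplx (pMat ℓ (Matrix.vecMulVec Zh Wh)))
        * (cplx r * (E x 0)⁻¹)
        = cplx ((2 / s) • (Matrix.fromBlocks g₁ 0 0 g₂ * pMat ℓ (Matrix.vecMulVec Zh Wh)
          * Matrix.fromBlocks g₁ᵀ 0 0 g₂⁻¹)) := by
      rw [Matrix.mul_smul, Matrix.smul_mul, Matrix.mul_assoc, ← Matrix.mul_assoc _ (cplx r),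
        ← cplx_mul, hpr, cplx_neg, F.inv_eq hx.1, hE0, cplx_smul, cplx_mul, cplx_mul]
      simp only [Matrix.neg_mul, Matrix.mul_neg, smul_neg, Matrix.mul_assoc]
      push_cast
      module
    rw [h3, h4, F.sym x hx.1, ← cplx_add, dressedSymBlock]
    congr 1
    have ht : (Matrix.vecMulVec Zh Wh)ᵀ = Matrix.vecMulVec Wh Zh := by
      ext
      simp [Matrix.vecMulVec_apply, mul_comm]
    have ht' : (Matrix.vecMulVec Wh Zh)ᵀ = Matrix.vecMulVec Zh Wh := by
      rw [← ht, Matrix.transpose_transpose]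
    have h5 : J k ℓ * (g₁ * Matrix.vecMulVec Wh Zh * J k ℓ * g₂⁻¹)ᵀ
        = g₂ * Matrix.vecMulVec Zh Wh * g₁ᵀ := by
      rw [inv_of_orth₂ (F.orth₂ x hx.1)]
      simp only [Matrix.transpose_mul, J_transpose, Matrix.transpose_transpose, ht']
      simp only [← Matrix.mul_assoc, J_mul_J, Matrix.one_mul]
      simp only [Matrix.mul_assoc]
      rw [← Matrix.mul_assoc (J k ℓ) (J k ℓ), J_mul_J, Matrix.one_mul]
    rw [pMat, Matrix.fromBlocks_multiply, Matrix.fromBlocks_multiply, Matrix.fromBlocks_smul,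
      Matrix.fromBlocks_add, ht]
    congr 1
    · simp
    · simp only [Matrix.mul_zero, Matrix.zero_mul, zero_add, add_zero, Matrix.mul_neg,
        Matrix.neg_mul, smul_neg, ← Matrix.mul_assoc]
      rw [sub_eq_add_neg]
    · rw [Matrix.transpose_sub, Matrix.mul_sub, Matrix.transpose_smul, Matrix.mul_smul, h5]
      simp only [Matrix.mul_zero, Matrix.zero_mul, zero_add, add_zero]
      abel
    · simp

end IsRealFrame

end DressedFrame

/-! ### The Ribaucour transform -/

section Ribaucour

variable {k ℓ : ℕ} {Ω U : Set (Fin k → ℝ)} {ξ : (Fin k → ℝ) → Matrix (Fin k) (Fin (k + 1)) ℝ}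
  {E : (Fin k → ℝ) → ℂ → Matrix (Idx k) (Idx k) ℂ} {s : ℝ} {W : Fin (k + 1) → ℝ} {Z : Fin k → ℝ}
  {Ξ : (Fin k → ℝ) → Matrix (Fin (k + 1)) (Fin k) ℝ}

/-- The translation from `Ξ c` to `Ξ̂ c`, along the direction `∑ q_j e_j` with `Ŵ = (q_j)`. -/
theorem dressedSymBlock_mulVec (ℓ : ℕ) (E : (Fin k → ℝ) → ℂ → Matrix (Idx k) (Idx k) ℂ) (s : ℝ)
    (W : Fin (k + 1) → ℝ) (Z : Fin k → ℝ) (Ξ : (Fin k → ℝ) → Matrix (Fin (k + 1)) (Fin k) ℝ)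
    (c : Fin k → ℝ) (x : Fin k → ℝ) :
    WithLp.toLp 2 (dressedSymBlock ℓ E s W Z Ξ x *ᵥ c) = WithLp.toLp 2 (Ξ x *ᵥ c)
      - (2 * (hatZ ℓ E s W Z x ⬝ᵥ (J k ℓ *ᵥ ((blk₂ E x)⁻¹ *ᵥ c))) / s) •
        ∑ j, hatW E s W Z x j • col (blk₁ E) j x := by
  have h1 : dressedSymBlock ℓ E s W Z Ξ x *ᵥ c = Ξ x *ᵥ c
      - (2 / s) • (hatZ ℓ E s W Z x ⬝ᵥ (J k ℓ *ᵥ ((blk₂ E x)⁻¹ *ᵥ c))) •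
        (blk₁ E x *ᵥ hatW E s W Z x) := by
    rw [dressedSymBlock, Matrix.sub_mulVec, Matrix.smul_mulVec, ← Matrix.mulVec_mulVec,
      ← Matrix.mulVec_mulVec, ← Matrix.mulVec_mulVec, Matrix.vecMulVec_mulVec,
      op_smul_eq_smul, Matrix.mulVec_smul]
  ext r
  rw [h1]
  simp only [PiLp.sub_apply, PiLp.smul_apply, WithLp.ofLp_sum, Finset.sum_apply, Pi.sub_apply,
    Pi.smul_apply, smul_eq_mul, col, Matrix.mulVec, dotProduct, WithLp.ofLp_smul, mul_comm]
  ring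

/-- The frame of the dressed hypersurface is the reflection of `(e_j)` along `∑ q_l e_l`. -/
theorem IsRealFrame.col_blk₁_dressedFrame (R : IsRealFrame ℓ Ω ξ E)
    (F : IsSymFrame ℓ Ω Set.univ ξ E Ξ) (hW : W ⬝ᵥ W = 1) (hZ : Z ⬝ᵥ (J k ℓ *ᵥ Z) = 1)
    (hs : s ≠ 0) {x : Fin k → ℝ} (hx : x ∈ dressedDomain E s W Z Ω) (j : Fin (k + 1)) :
    col (blk₁ (dressedFrame ℓ E s W Z)) j x = col (blk₁ E) j x
      - (2 * hatW E s W Z x j) • ∑ l, hatW E s W Z x l • col (blk₁ E) l x := by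
  ext r
  simp only [PiLp.sub_apply, PiLp.smul_apply, WithLp.ofLp_sum, Finset.sum_apply, smul_eq_mul, col,
    WithLp.ofLp_smul, Pi.smul_apply]
  rw [R.blk₁_dressedFrame F hW hZ hs hx, refl₁, Matrix.mul_sub, Matrix.mul_one, Matrix.mul_smul]
  simp only [Matrix.sub_apply, Matrix.smul_apply, Matrix.mul_apply, Matrix.vecMulVec_apply,
    smul_eq_mul, Finset.mul_sum]
  congr 1
  exact Finset.sum_congr rfl fun l _ => by ring

/-- The normal and the tangent lines of `Ξ c` and `Ξ̂ c` in the frame directions meet. -/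
theorem IsRealFrame.dressedSymBlock_mulVec_sub (R : IsRealFrame ℓ Ω ξ E)
    (F : IsSymFrame ℓ Ω Set.univ ξ E Ξ) (hW : W ⬝ᵥ W = 1) (hZ : Z ⬝ᵥ (J k ℓ *ᵥ Z) = 1)
    (hs : s ≠ 0) (c : Fin k → ℝ) {β : ℝ} {x : Fin k → ℝ} (hx : x ∈ dressedDomain E s W Z Ω)
    (hβ : β = hatZ ℓ E s W Z x ⬝ᵥ (J k ℓ *ᵥ ((blk₂ E x)⁻¹ *ᵥ c))) {j : Fin (k + 1)}
    (hj : hatW E s W Z x j ≠ 0) :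
    WithLp.toLp 2 (dressedSymBlock ℓ E s W Z Ξ x *ᵥ c)
        - (β / (s * hatW E s W Z x j)) • col (blk₁ (dressedFrame ℓ E s W Z)) j x
      = WithLp.toLp 2 (Ξ x *ᵥ c) - (β / (s * hatW E s W Z x j)) • col (blk₁ E) j x := by
  rw [dressedSymBlock_mulVec, R.col_blk₁_dressedFrame F hW hZ hs hx, ← hβ, smul_sub, smul_smul,
    show β / (s * hatW E s W Z x j) * (2 * hatW E s W Z x j) = 2 * β / s by field_simp]
  abel

/-- A column of `Ξ C` of a frame has a principal frame. -/
theorem IsSymFrame.isPrincipalFrame_col {Λ : Set ℂ} (F : IsSymFrame ℓ Ω Λ ξ E Ξ)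
    (C : Matrix (Fin k) (Fin k) ℝ) (i : Fin k) (hU : U ⊆ Ω)
    (hinj : ∀ x ∈ U, Function.Injective (fderiv ℝ (col (fun x => Ξ x * C) i) x)) :
    IsPrincipalFrame U (col (fun x => Ξ x * C) i) (fun x m => col (blk₁ E) m x)
      (coeff ℓ E (C.col i)) (fun x j m => eps k ℓ j * ξ x j m) :=
  F.isPrincipalFrame (C.col i) hU hinj

theorem IsSymFrame.isIsothermic {Λ : Set ℂ} (F : IsSymFrame ℓ Ω Λ ξ E Ξ) {c : Fin k → ℝ}
    (hc : c ⬝ᵥ (J k ℓ *ᵥ c) = 0) (hU : U ⊆ Ω) (hUo : IsOpen U)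
    (hinj : ∀ x ∈ U, Function.Injective (fderiv ℝ (fun x => WithLp.toLp 2 (Ξ x *ᵥ c)) x)) :
    IsIsothermic ℓ (fun x => WithLp.toLp 2 (Ξ x *ᵥ c)) U :=
  (F.isPrincipalFrame c hU hinj).isIsothermic hUo fun _ hx =>
    (F.sum_coeff_sq c (hU hx)).trans hc

end Ribaucour

end KTuple

theorem mainTheorem3
    (k ℓ : ℕ) (hℓ : ℓ ≤ k)
    (Ω : Set (Fin k → ℝ)) (hΩ : IsOpen Ω) (hΩc : IsPreconnected Ω)
    (x₀ : Fin k → ℝ) (hx₀ : x₀ ∈ Ω)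
    (ξ : (Fin k → ℝ) → Matrix (Fin k) (Fin (k + 1)) ℝ) (hξ : KTuple.IsSolution ℓ Ω ξ)
    (E : (Fin k → ℝ) → ℂ → Matrix (KTuple.Idx k) (KTuple.Idx k) ℂ)
    (hE : KTuple.IsParallelFrame ℓ Ω x₀ ξ E)
    (W : Fin (k + 1) → ℝ) (Z : Fin k → ℝ)
    (hW : W ⬝ᵥ W = 1) (hZ : Z ⬝ᵥ (KTuple.J k ℓ *ᵥ Z) = 1)
    (s : ℝ) (hs : s ≠ 0)
    (Ω' : Set (Fin k → ℝ)) (hΩ' : Ω' = KTuple.dressedDomain E s W Z Ω)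
    (E' : (Fin k → ℝ) → ℂ → Matrix (KTuple.Idx k) (KTuple.Idx k) ℂ)
    (hE' : E' = KTuple.dressedFrame ℓ E s W Z) :
    -- the dressing is well defined, and `E'` is a frame for the dressed solution
    (∀ x ∈ Ω, (E x (Complex.I * s))⁻¹ *ᵥ KTuple.vec W Z
        = KTuple.vec (KTuple.tildeW E s W Z x) (KTuple.tildeZ E s W Z x) ∧
      KTuple.tildeW E s W Z x ⬝ᵥ KTuple.tildeW E s W Z x
        = KTuple.tildeZ E s W Z x ⬝ᵥ (KTuple.J k ℓ *ᵥ KTuple.tildeZ E s W Z x)) ∧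
    KTuple.IsSolution ℓ Ω' (KTuple.dressedSolution ℓ E s W Z ξ) ∧
    KTuple.IsFrameFor ℓ Ω' {Complex.I * s, -(Complex.I * s)}ᶜ
      (KTuple.dressedSolution ℓ E s W Z ξ) E' ∧
    ∃ Ξ Ξ' : (Fin k → ℝ) → Matrix (Fin (k + 1)) (Fin k) ℝ,
      -- (1)
      (∀ x ∈ Ω, (∀ b c, DifferentiableAt ℂ (fun μ => E x μ b c) 0) ∧
        KTuple.dSpec E x * (E x 0)⁻¹
          = KTuple.cplx (Matrix.fromBlocks 0 (Ξ x) (-(KTuple.J k ℓ * (Ξ x)ᵀ)) 0)) ∧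
      (∀ x ∈ Ω', (∀ b c, DifferentiableAt ℂ (fun μ => E' x μ b c) 0) ∧
        KTuple.dSpec E' x * (E' x 0)⁻¹
          = KTuple.cplx (Matrix.fromBlocks 0 (Ξ' x) (-(KTuple.J k ℓ * (Ξ' x)ᵀ)) 0)) ∧
      -- (2)
      (∀ (c : Fin k → ℝ) (f : (Fin k → ℝ) → EuclideanSpace ℝ (Fin (k + 1))),
        (f = fun x => WithLp.toLp 2 (Ξ x *ᵥ c)) →
        ∀ U ⊆ Ω, IsOpen U → (∀ x ∈ U, Function.Injective (fderiv ℝ f x)) →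
          KTuple.IsLineOfCurvatureParam f U ∧ KTuple.HasFlatNormalBundle f U ∧
          (∀ x ∈ U, ∑ i, KTuple.eps k ℓ i * ‖KTuple.pd i f x‖ ^ 2
            = c ⬝ᵥ (KTuple.J k ℓ *ᵥ c)) ∧
          (c ⬝ᵥ (KTuple.J k ℓ *ᵥ c) = 0 → KTuple.IsIsothermic ℓ f U)) ∧
      -- (3)
      (∀ (c₁ c₂ : Fin k → ℝ) (f₁ f₂ : (Fin k → ℝ) → EuclideanSpace ℝ (Fin (k + 1))),
        (f₁ = fun x => WithLp.toLp 2 (Ξ x *ᵥ c₁)) →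
        (f₂ = fun x => WithLp.toLp 2 (Ξ x *ᵥ c₂)) →
        ∀ U ⊆ Ω, IsOpen U → (∀ x ∈ U, Function.Injective (fderiv ℝ f₁ x)) →
          (∀ x ∈ U, Function.Injective (fderiv ℝ f₂ x)) →
          KTuple.IsCombescureOTransform f₁ f₂ U) ∧
      -- (4)
      (∀ (C : Matrix (Fin k) (Fin k) ℝ), IsUnit C.det →
        ∀ Y Y' : (Fin k → ℝ) → Matrix (Fin (k + 1)) (Fin k) ℝ,
        (Y = fun x => Ξ x * C) → (Y' = fun x => Ξ' x * C) →
        -- (a)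
        (∀ U ⊆ Ω, IsOpen U →
          (∀ i, ∀ x ∈ U, Function.Injective (fderiv ℝ (KTuple.col Y i) x)) →
          KTuple.IsKTuple ℓ Y U) ∧
        (∀ U ⊆ Ω', IsOpen U →
          (∀ i, ∀ x ∈ U, Function.Injective (fderiv ℝ (KTuple.col Y' i) x)) →
          KTuple.IsKTuple ℓ Y' U) ∧
        -- (b)
        ((∀ i, C.col i ⬝ᵥ (KTuple.J k ℓ *ᵥ C.col i) = 0) →
          (∀ i, ∀ U ⊆ Ω, IsOpen U →
            (∀ x ∈ U, Function.Injective (fderiv ℝ (KTuple.col Y i) x)) →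
            KTuple.IsIsothermic ℓ (KTuple.col Y i) U) ∧
          (∀ i, ∀ U ⊆ Ω', IsOpen U →
            (∀ x ∈ U, Function.Injective (fderiv ℝ (KTuple.col Y' i) x)) →
            KTuple.IsIsothermic ℓ (KTuple.col Y' i) U)) ∧
        -- (c)
        (∀ x ∈ Ω,
          E x 0 = KTuple.cplx (Matrix.fromBlocks (KTuple.blk₁ E x) 0 0 (KTuple.blk₂ E x)) ∧
          (KTuple.blk₁ E x)ᵀ * KTuple.blk₁ E x = 1 ∧
          (KTuple.blk₂ E x)ᵀ * KTuple.J k ℓ * KTuple.blk₂ E x = KTuple.J k ℓ) ∧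
        (∀ x ∈ Ω',
          E' x 0 = KTuple.cplx (Matrix.fromBlocks (KTuple.blk₁ E' x) 0 0 (KTuple.blk₂ E' x)) ∧
          (KTuple.blk₁ E' x)ᵀ * KTuple.blk₁ E' x = 1 ∧
          (KTuple.blk₂ E' x)ᵀ * KTuple.J k ℓ * KTuple.blk₂ E' x = KTuple.J k ℓ) ∧
        ∀ i : Fin k,
          ∀ β : (Fin k → ℝ) → ℝ,
          (β = fun x => KTuple.hatZ ℓ E s W Z x ⬝ᵥ
            (KTuple.J k ℓ *ᵥ ((KTuple.blk₂ E x)⁻¹ *ᵥ C.col i))) →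
          -- (d)
          (∀ x ∈ Ω', KTuple.col Y' i x = KTuple.col Y i x
            - (2 * β x / s) • ∑ j, KTuple.hatW E s W Z x j • KTuple.col (KTuple.blk₁ E) j x) ∧
          -- (e)
          (∀ x ∈ Ω', ∀ j, KTuple.hatW E s W Z x j ≠ 0 →
            KTuple.col Y' i x
                - (β x / (s * KTuple.hatW E s W Z x j)) • KTuple.col (KTuple.blk₁ E') j x
              = KTuple.col Y i x
                - (β x / (s * KTuple.hatW E s W Z x j)) • KTuple.col (KTuple.blk₁ E) j x) ∧
          (∀ U ⊆ Ω', IsOpen U →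
            (∀ x ∈ U, Function.Injective (fderiv ℝ (KTuple.col Y i) x)) →
            (∀ x ∈ U, Function.Injective (fderiv ℝ (KTuple.col Y' i) x)) →
            (∀ x ∈ U, ∀ j, KTuple.hatW E s W Z x j ≠ 0) →
            KTuple.IsRibaucourFrame (KTuple.col Y i) (KTuple.col Y' i) U ∧
            ((∀ x ∈ U, ∀ u, KTuple.IsPrincipal (KTuple.col Y i) x u →
                ∃ (j : Fin k) (t : ℝ), u = t • Pi.single j 1) →
              KTuple.IsRibaucour (KTuple.col Y i) (KTuple.col Y' i) U))) := by

  subst hΩ' hE'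
  have R := hE.isRealFrame hξ.smooth hΩ hΩc hx₀
  have F := hE.isSymFrame hξ.smooth hΩ hΩc hx₀
  have F' := R.isSymFrame_dressed F hW hZ hs
  refine ⟨fun x hx => ⟨R.inv_mulVec_vec hx, R.tilde_norm hW hZ hx⟩,
    F'.frame.isSolution F'.isOpen F'.zero_mem (fun x hx => F'.mul_Q_transpose_Q hx) F'.smooth
      fun x hx i => by simp [KTuple.dressedSolution, hξ.diag x hx.1 i],
    F'.frame, KTuple.symBlock E, KTuple.dressedSymBlock ℓ E s W Z (KTuple.symBlock E),
    fun x hx => ⟨F.diff x hx, F.sym x hx⟩, fun x hx => ⟨F'.diff x hx, F'.sym x hx⟩,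
    ?_, ?_, ?_⟩
  · rintro c _ rfl U hU hUo hinj
    have P := F.isPrincipalFrame c hU hinj
    exact ⟨P.isLineOfCurvatureParam hUo, P.hasFlatNormalBundle,
      fun x hx => (P.sum_eps_mul_norm_sq ℓ hx).trans (F.sum_coeff_sq c (hU hx)),
      fun hc => F.isIsothermic hc hU hUo hinj⟩
  · rintro c₁ c₂ _ _ rfl rfl U hU hUo hinj₁ hinj₂
    exact (F.isPrincipalFrame c₁ hU hinj₁).isCombescureOTransform
      (F.isPrincipalFrame c₂ hU hinj₂) hUo
  rintro C hC _ _ rfl rfl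
  refine ⟨fun U hU hUo hinj => F.isKTuple hC hU hUo hinj,
    fun U hU hUo hinj => F'.isKTuple hC hU hUo hinj,
    fun hc => ⟨fun i U hU hUo hinj => F.isIsothermic (hc i) hU hUo hinj,
      fun i U hU hUo hinj => F'.isIsothermic (hc i) hU hUo hinj⟩,
    fun x hx => ⟨F.block x hx, F.orth₁ x hx, F.orth₂ x hx⟩,
    fun x hx => ⟨F'.block x hx, F'.orth₁ x hx, F'.orth₂ x hx⟩, ?_⟩
  rintro i _ rfl
  refine ⟨fun x _ => KTuple.dressedSymBlock_mulVec ℓ E s W Z (KTuple.symBlock E) (C.col i) x,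
    fun x hx j hj => R.dressedSymBlock_mulVec_sub F hW hZ hs (C.col i) hx rfl hj,
    fun U hU hUo hinj hinj' hq => ?_⟩
  have P := F.isPrincipalFrame_col C i (fun x hx => (hU hx).1) hinj
  have P' := F'.isPrincipalFrame_col C i hU hinj'
  have hρ : ∀ x ∈ U, ∀ m, _ := fun x hx m =>
    R.dressedSymBlock_mulVec_sub F hW hZ hs (C.col i) (hU hx) rfl (hq x hx m)
  simp only [sub_eq_add_neg, ← neg_smul] at hρ
  exact ⟨P.isRibaucourFrame P' hUo _ fun x hx m => (hρ x hx m).symm,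
    P.isRibaucour P' hUo _ fun x hx m => (hρ x hx m).symm⟩
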